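/- Let $d\ge 0$, let $N$ be a positive semi-definite real symmetric $d\times d$ matrix, $l\in\mathbb{R}^d$, $c>0$, and put $\phi(x)=x\cdot Nx+l\cdot x$, $d\mu=e^{-\phi(x)}\,dx$ on $\mathbb{R}^d$ and $\mathcal{C}_\phi=\{g\,e^{\phi/2}: g\in C_c^\infty(\mathbb{R}^d;\mathbb{C})\}$. Let $L$ be the Ornstein–Uhlenbeck operator of $\phi$: the operator in $L^2(\mu)$ associated with the closure of the Dirichlet form $(f,g)\mapsto\int\nabla f\cdot\overline{\nabla g}\,d\mu$ with domain $\mathcal{C}_\phi$. Let $(\exp(-tL))_{t\ge 0}$ be the strongly continuous semigroup on $L^2(\mu)$ with generator $-L$ (it exists and is unique). For $M:\mathbb{R}^d\to\mathbb{R}^d$ measurable, a bounded symbol $a\in L^\infty(\mathbb{R}^{2d})$ belongs to $HS_0(M)$ if there is a measurable function $g_a$ on $\mathbb{R}^{2d}$, unique up to null sets, such that $|g_a(x,k)|<G(k)$ almost everywhere for some $G\in L^1(\mathbb{R}^d)$ and such that, for almost every $x$, the distributional Fourier transform $\mathcal{F}$ (normalised by $\mathcal{F}\psi(k)=(2\pi)^{-d/2}\int\psi(\xi)e^{-i\xi\cdot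 k}\,d\xi$) of $a(x,\cdot)$ is the function $\mathcal{F}_2a(x,k)=(2\pi)^{d/2}e^{-|M(x)\cdot k|}g_a(x,k)$. For such $a$, with $(Q,P)$ the generalised Weyl pair with parameter $c$ associated with $\phi$, the operator $a(Q,P):\mathcal{C}_\phi\to L^1_{loc}(\mathbb{R}^d)$ is \[(a(Q,P)f)(y)=\frac{1}{(2\pi)^{d/2}c^d}\int_{\mathbb{R}^d}\mathcal{F}_2a\Big(\frac{x+y}{2c},\frac{x-y}{c}\Big)\,e^{\frac12(\phi(y)-\phi(x))}f(x)\,dx .\] For $t>0$ let $N_t=N^{-1}\tanh(tN)$ and \[a_t^{N,l}(x,\xi)=\det\big(\cosh(tN)^{-1}\exp(tN)\big)\exp\Big(-\frac1{c^2}\,\xi\cdot N_t\xi-\big(cNx+\tfrac l2\big)\cdot N_t\big(cNx+\tfrac l2\big)\Big),\] where functions of $N$ are taken in the functional calculus of symmetric matrices and $N_t$ acts as multiplication by $t$ on the kernel of $N$. Then for every $t>0$: $a_t^{N,l}\in HS_0(M)$ for some measurable $M$; and, for every measurable $M$ with $a_t^{N,l}\in HS_0(M)$ and every $f\in\mathcal{C}_\phi$,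 the integral defining $(a_t^{N,l}(Q,P)f)(y)$ converges absolutely for almost every $y$, $a_t^{N,l}(Q,P)f\in L^1_{loc}(\mathbb{R}^d)$, $f\in L^2(\mu)$, and \[\exp(-tL)f=a_t^{N,l}(Q,P)f\quad\text{almost everywhere.}\] -/

import Mathlib

open MeasureTheory Filter Topology Set
open scoped NNReal ENNReal SchwartzMap Matrix ContDiff

namespace OUWeyl

noncomputable section

/-- Euclidean space `ℝ^d`. -/
abbrev E (d : ℕ) : Type := EuclideanSpace ℝ (Fin d)

/-! ### The weighted measure and the core -/

/-- The measure `dμ = exp(-φ(x)) dx`. -/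
def mu {d : ℕ} (φ : E d → ℝ) : Measure (E d) :=
  (volume : Measure (E d)).withDensity fun x => ENNReal.ofReal (Real.exp (-φ x))

/-- The complex Hilbert space `L²(μ)`. -/
abbrev L2 {d : ℕ} (φ : E d → ℝ) : Type := Lp ℂ 2 (mu φ)

/-- The space `L²(μ; ℂ^d)` of square integrable vector fields. -/
abbrev L2Vec {d : ℕ} (φ : E d → ℝ) : Type := Lp (EuclideanSpace ℂ (Fin d)) 2 (mu φ)

/-- The core `C_φ`: all `f` such that `f exp(-φ/2)` is smooth with compact support. -/
def core {d : ℕ} (φ : E d → ℝ) : Set (E d → ℂ) :=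
  {f | ContDiff ℝ ∞ (fun x => f x * (Real.exp (-φ x / 2) : ℂ)) ∧ HasCompactSupport f}

/-- The gradient of a complex valued function on `ℝ^d`, as a vector in `ℂ^d`. -/
def grad {d : ℕ} (f : E d → ℂ) (x : E d) : EuclideanSpace ℂ (Fin d) :=
  WithLp.toLp 2 fun i => fderiv ℝ f x (EuclideanSpace.single i 1)

/-! ### The Dirichlet form, the Ornstein-Uhlenbeck operator and its semigroup -/

/-- The pairs `(f, ∇f)` with `f ∈ C_φ`, as a subset of `L²(μ) × L²(μ; ℂ^d)`. -/
def coreGraph {d : ℕ} (φ : E d → ℝ) : Set (L2 φ × L2Vec φ) :=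
  {p | ∃ f ∈ core φ, (p.1 : E d → ℂ) =ᵐ[mu φ] f ∧
    (p.2 : E d → EuclideanSpace ℂ (Fin d)) =ᵐ[mu φ] grad f}

/-- The graph of the Ornstein-Uhlenbeck operator `L`, the operator in `L²(μ)` associated with the
closure of the Dirichlet form `(f, g) ↦ ∫ ∇f · conj (∇g) dμ` on `C_φ`: `u` is in the domain of `L`
with `L u = w` iff `u` is in the domain of the closed form (with closed gradient `F`) and
`∫ F · conj (∇v) dμ = ∫ w conj v dμ` for all `v ∈ C_φ`. -/
def ouGraph {d : ℕ} (φ : E d → ℝ) : Set (L2 φ × L2 φ) :=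
  {q | ∃ F : L2Vec φ, (q.1, F) ∈ closure (coreGraph φ) ∧
    ∀ p ∈ coreGraph φ, inner ℂ p.2 F = inner ℂ p.1 q.2}

/-- `S` is a strongly continuous one-parameter semigroup on the Banach space `X`. -/
structure IsC0Semigroup {X : Type*} [NormedAddCommGroup X] [NormedSpace ℂ X]
    (S : ℝ≥0 → X →L[ℂ] X) : Prop where
  map_zero : S 0 = ContinuousLinearMap.id ℂ X
  map_add : ∀ s t : ℝ≥0, S (s + t) = (S s).comp (S t)
  continuous : ∀ u : X, Continuous fun t => S t u

/-- `S` is the Ornstein-Uhlenbeck semigroup `(exp(-tL))_{t ≥ 0}` on `L²(μ)`: the strongly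
continuous semigroup whose infinitesimal generator is exactly `-L` (same domain, same action). -/
structure IsOUSemigroup {d : ℕ} (φ : E d → ℝ) (S : ℝ≥0 → L2 φ →L[ℂ] L2 φ) : Prop where
  isC0Semigroup : IsC0Semigroup S
  generator : ∀ u w : L2 φ, (u, w) ∈ ouGraph φ ↔
    Tendsto (fun t : ℝ≥0 => (((t : ℝ) : ℂ))⁻¹ • (S t u - u)) (𝓝[>] 0) (𝓝 (-w))

/-! ### The symbol class and the generalised Weyl calculus -/

/-- The Fourier transform `(2π)^{-d/2} ∫ ψ(ξ) exp(-i ξ·k) dξ`. -/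
def fourierU {d : ℕ} (ψ : E d → ℂ) (k : E d) : ℂ :=
  (((2 * Real.pi) ^ (-(d : ℝ) / 2) : ℝ) : ℂ) *
    ∫ ξ : E d, ψ ξ * Complex.exp (-Complex.I * ((inner ℝ ξ k : ℝ) : ℂ))

/-- The function `(x, k) ↦ (2π)^{d/2} exp(-|M(x)·k|) g(x, k)`; it is the partial Fourier transform
`ℱ₂ a` in the second variable when `g` represents `a` as below. -/
def F2 {d : ℕ} (M : E d → E d) (g : E d × E d → ℂ) (x k : E d) : ℂ :=
  (((2 * Real.pi) ^ ((d : ℝ) / 2) * Real.exp (-|inner ℝ (M x) k|) : ℝ) : ℂ) * g (x, k)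

/-- The function `g` is `L¹`-dominated and the distributional Fourier transform of `a(x, ·)` is
`(2π)^{d/2} exp(-|M(x)·k|) g(x, k)`, as tempered distributions in `k`. -/
structure Represents {d : ℕ} (M : E d → E d) (a g : E d × E d → ℂ) : Prop where
  aestronglyMeasurable : AEStronglyMeasurable g volume
  dominated : ∃ G : E d → ℝ, Integrable G volume ∧
    ∀ᵐ p : E d × E d ∂volume, ‖g p‖ < G p.2
  fourier : ∀ᵐ x : E d ∂volume, ∀ ψ : 𝓢(E d, ℂ),
    ∫ ξ : E d, a (x, ξ) * fourierU ψ ξ = ∫ k : E d, F2 M g x k * ψ k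

/-- The space `HS₀(M)` of holomorphic strip symbols: bounded symbols with a representing function
`g` which is unique up to null sets. -/
def HS0 {d : ℕ} (M : E d → E d) : Set (E d × E d → ℂ) :=
  {a | MemLp a ∞ volume ∧
    ∃ g, Represents M a g ∧ ∀ g', Represents M a g' → g' =ᵐ[volume] g}

/-- The integrand defining `(a(Q,P)f)(y)`, in terms of `F = ℱ₂ a`. -/
def weylIntegrand {d : ℕ} (φ : E d → ℝ) (c : ℝ) (F : E d → E d → ℂ) (f : E d → ℂ)
    (y x : E d) : ℂ :=
  F ((2 * c)⁻¹ • (x + y)) (c⁻¹ • (x - y)) * (Real.exp ((φ y - φ x) / 2) : ℂ) * f x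

/-- The operator `a(Q,P)` on `C_φ`, in terms of `F = ℱ₂ a`:
`(a(Q,P)f)(y) = (2π)^{-d/2} c^{-d} ∫ ℱ₂a((x+y)/(2c), (x-y)/c) exp((φ(y)-φ(x))/2) f(x) dx`. -/
def weylOp {d : ℕ} (φ : E d → ℝ) (c : ℝ) (F : E d → E d → ℂ) (f : E d → ℂ) (y : E d) : ℂ :=
  (((2 * Real.pi) ^ (-(d : ℝ) / 2) * (c ^ d)⁻¹ : ℝ) : ℂ) *
    ∫ x : E d, weylIntegrand φ c F f y x

/-! ### Quadratic potentials and the Gaussian symbol -/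

/-- The action of a real matrix on `ℝ^d`. -/
abbrev act {d : ℕ} (N : Matrix (Fin d) (Fin d) ℝ) (x : E d) : E d := Matrix.toEuclideanLin N x

/-- The potential `φ(x) = x·Nx + l·x`. -/
def quadPotential {d : ℕ} (N : Matrix (Fin d) (Fin d) ℝ) (l : E d) (x : E d) : ℝ :=
  inner ℝ x (act N x) + inner ℝ l x

/-- The function `n ↦ tanh(tn)/n`, with value `t` at `n = 0`. -/
def tanhDiv (t n : ℝ) : ℝ := if n = 0 then t else Real.tanh (t * n) / n

/-- `N_t = N⁻¹ tanh(tN)`, by the functional calculus of symmetric matrices. -/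
def Nt {d : ℕ} (N : Matrix (Fin d) (Fin d) ℝ) (t : ℝ) : Matrix (Fin d) (Fin d) ℝ :=
  cfc (tanhDiv t) N

/-- The Gaussian symbol `a_t^{N,l}`. -/
def gaussSymbol {d : ℕ} (N : Matrix (Fin d) (Fin d) ℝ) (l : E d) (c t : ℝ) (p : E d × E d) : ℂ :=
  (((cfc (fun n => Real.cosh (t * n)) N)⁻¹ * cfc (fun n => Real.exp (t * n)) N).det *
    Real.exp (-(1 / c ^ 2) * inner ℝ p.2 (act (Nt N t) p.2) -
      inner ℝ (c • act N p.1 + (1 / 2 : ℝ) • l)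
        (act (Nt N t) (c • act N p.1 + (1 / 2 : ℝ) • l))) : ℝ)

end

end OUWeyl

namespace OUWeyl

noncomputable section

/-! ### Semigroups generated by inverses of bounded self-adjoint operators -/

/-! In an orthonormal eigenbasis of `N` the potential becomes `∑ n_j y_j² + l_j y_j` with `n_j ≥ 0`,
and `L` acts on smooth functions as `-Δ + ∇φ·∇`, a sum of one-dimensional Ornstein-Uhlenbeck
operators. The semigroup should therefore be a product of Mehler kernels. The work is to identify
the abstractly defined semigroup with that kernel, and the kernel with the Weyl integral.

Existence and uniqueness of the semigroup rest on the resolvent `J = (1 + L)⁻¹`, obtained by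
projecting `(h, 0)` orthogonally onto the closed graph of the gradient and keeping the first
component (`formResolvent`). It is self-adjoint and injective with `0 ≤ J ≤ 1`, so `exp(-tL)` is the
function `exp(-t(1/x - 1))` of `J`. Accretivity of `L` forces every classical solution of `u' = -Lu`
to be an orbit of the semigroup (`IsResolvent.semigroup_apply_eq`).

Classical solutions are available explicitly: the data `exp(-∑ (y_j - iβ_j)²/2)` stay Gaussian, with
moving complex centre and growing variance (`semigroup_gaussSol`). The Mehler kernel sends the same
data to the same functions, by a one-dimensional Gaussian integral (`integral_mehler_mul_gaussSol`).

The passage from Gaussians to the core is by duality, which avoids proving that the kernel operator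
is bounded on `L²(μ)`. The semigroup is symmetric and the kernel satisfies detailed balance with
respect to `μ`, so for `f` in the core both images of `f` have the same pairing with each Gaussian
datum. Conjugated data are a fixed Gaussian weight times the characters `exp(-iβ·y)`, up to
constants; hence a weighted difference of the two images has vanishing Fourier transform
(`semigroup_apply_core`).

It remains to rewrite the kernel. Completing the square with `ν = tanh(tn)/n` turns each Mehler
factor into a Gaussian in the midpoint, a Gaussian in the difference, and the factor `exp((φ(y) -
φ(x))/2)` (`weyl_exponent`). This is the Weyl kernel of the symbol, whose partial Fourier transform
is an explicit Gaussian. That transform is determined almost everywhere by the symbol, so the choice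
of `M` and of the representing function is immaterial (`Represents.F2_ae_eq`). -/

/-- `J` is a candidate for `(1 + L)⁻¹` with `L` positive and self-adjoint. -/
structure IsResolvent {H : Type*} [NormedAddCommGroup H] [InnerProductSpace ℂ H] [CompleteSpace H]
    (J : H →L[ℂ] H) : Prop where
  isSelfAdjoint : IsSelfAdjoint J
  norm_sq_le : ∀ h, ‖J h‖ ^ 2 ≤ (inner ℂ h (J h)).re
  injective : ∀ h, J h = 0 → h = 0

/-- The function `x ↦ exp(-t (1/x - 1))` on `(0, ∞)`, extended by zero. -/
def decay (t x : ℝ) : ℝ := if x ≤ 0 then 0 else Real.exp (-(t * (x⁻¹ - 1)))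

lemma decay_nonneg (t x : ℝ) : 0 ≤ decay t x := by
  unfold decay; split_ifs <;> positivity

lemma decay_le_one {t x : ℝ} (ht : 0 ≤ t) (hx : x ∈ Icc (0 : ℝ) 1) : decay t x ≤ 1 := by
  unfold decay
  split_ifs with h
  · norm_num
  · have : 1 ≤ x⁻¹ := (one_le_inv₀ (not_le.1 h)).2 hx.2
    apply Real.exp_le_one_iff.2
    nlinarith

lemma decay_add (s t x : ℝ) : decay (s + t) x = decay s x * decay t x := by
  unfold decay
  split_ifs
  · simp
  · rw [← Real.exp_add]; ring_nf

lemma decay_le_mul {t x : ℝ} (ht : 0 < t) (hx : 0 < x) : decay t x ≤ Real.exp t / t * x := by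
  rw [decay, if_neg (not_le.2 hx)]
  have h1 : -(t * (x⁻¹ - 1)) = t - t / x := by field_simp; ring
  have h2 : t / x ≤ Real.exp (t / x) := by linarith [Real.add_one_le_exp (t / x)]
  rw [h1, Real.exp_sub, div_mul_eq_mul_div, div_le_div_iff₀ (Real.exp_pos _) ht]
  have h3 : x * (t / x) = t := by field_simp
  have h4 : t ≤ x * Real.exp (t / x) := by
    calc t = x * (t / x) := h3.symm
      _ ≤ _ := by gcongr
  have := Real.exp_pos t
  nlinarith

lemma continuous_decay {t : ℝ} (ht : 0 < t) : Continuous (decay t) := by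
  rw [continuous_iff_continuousAt]
  intro x
  rcases lt_trichotomy x 0 with hx | rfl | hx
  · refine (continuousAt_const (y := (0 : ℝ))).congr ?_
    filter_upwards [eventually_lt_nhds hx] with y hy
    simp [decay, hy.le]
  · have h0 : decay t 0 = 0 := by simp [decay]
    rw [ContinuousAt, h0]
    refine squeeze_zero (g := fun x => Real.exp t / t * |x|) (fun x => decay_nonneg t x) ?_ ?_
    · intro x
      rcases le_or_gt x 0 with hx | hx
      · simp only [decay, if_pos hx]; positivity
      · rw [abs_of_pos hx]; exact decay_le_mul ht hx
    · have : Continuous fun x : ℝ => Real.exp t / t * |x| := by fun_prop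
      simpa using this.tendsto 0
  · have h : ContinuousAt (fun x : ℝ => Real.exp (-(t * (x⁻¹ - 1)))) x := by
      have : x ≠ 0 := hx.ne'
      fun_prop (disch := assumption)
    refine h.congr ?_
    filter_upwards [eventually_gt_nhds hx] with y hy
    simp [decay, not_le.2 hy]

lemma abs_exp_neg_sub_exp_neg_le {a b : ℝ} (ha : 0 ≤ a) (hb : 0 ≤ b) :
    |Real.exp (-a) - Real.exp (-b)| ≤ |a - b| := by
  wlog h : a ≤ b generalizing a b
  · rw [abs_sub_comm, abs_sub_comm a]; exact this hb ha (le_of_not_ge h)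
  rw [abs_of_nonneg (by simpa using h), abs_of_nonpos (by linarith)]
  have h1 : Real.exp (-b) = Real.exp (-a) * Real.exp (a - b) := by rw [← Real.exp_add]; ring_nf
  have h2 := Real.add_one_le_exp (a - b)
  have h3 : Real.exp (-a) ≤ 1 := Real.exp_le_one_iff.2 (by linarith)
  have h4 := Real.exp_pos (-a)
  rw [h1]
  nlinarith

/-- The exponent `1/x - 1` is unbounded near zero, but `x (1/x - 1) = 1 - x ≤ 1`: after one
application of the resolvent the semigroup is Lipschitz in time, uniformly on the spectrum. -/
lemma abs_decay_mul_sub_le {s t x : ℝ} (hs : 0 ≤ s) (ht : 0 ≤ t) (hx : x ∈ Icc (0 : ℝ) 1) :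
    |decay s x * x - decay t x * x| ≤ |s - t| := by
  rcases hx.1.eq_or_lt with rfl | h
  · simp
  have hy : 1 ≤ x⁻¹ := (one_le_inv₀ h).2 hx.2
  simp only [decay, if_neg (not_le.2 h)]
  rw [← sub_mul, abs_mul, abs_of_pos h]
  have := abs_exp_neg_sub_exp_neg_le (a := s * (x⁻¹ - 1)) (b := t * (x⁻¹ - 1))
    (mul_nonneg hs (by linarith)) (mul_nonneg ht (by linarith))
  rw [← sub_mul, abs_mul, abs_of_nonneg (a := x⁻¹ - 1) (by linarith)] at this
  calc _ ≤ |s - t| * (x⁻¹ - 1) * x := by gcongr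
    _ = |s - t| * (1 - x) := by field_simp
    _ ≤ |s - t| * 1 := by gcongr; linarith
    _ = _ := mul_one _

/-- The error in the generator, as a function on the spectrum of the resolvent. -/
def generatorError (t x : ℝ) : ℝ := t⁻¹ * (decay t x * x - x) + (1 - x)

/-- With `y = 1/x - 1` the error is `x (exp(-ty) - 1 + ty) / t`. The bound of the bracket by `ty`
gives uniform boundedness, and the bound by `(ty)²` gives the rate `t` after another factor `x`.
Together these yield strong convergence, since the resolvent has dense range. -/
lemma generatorError_bounds {t x : ℝ} (ht : 0 < t) (hx : x ∈ Icc (0 : ℝ) 1) :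
    0 ≤ generatorError t x ∧ generatorError t x ≤ 1 ∧ generatorError t x * x ≤ t := by
  rcases hx.1.eq_or_lt with rfl | h
  · simp [generatorError, ht.le]
  have hy : 1 ≤ x⁻¹ := (one_le_inv₀ h).2 hx.2
  obtain ⟨y, hy'⟩ : ∃ y, y = x⁻¹ - 1 := ⟨_, rfl⟩
  have hy0 : 0 ≤ y := by linarith
  have hxy : x * y = 1 - x := by rw [hy']; field_simp
  have ha : 0 ≤ t * y := by positivity
  have he : generatorError t x = t⁻¹ * x * (Real.exp (-(t * y)) - 1 + t * y) := by
    simp only [generatorError, decay, if_neg (not_le.2 h), ← hy', ← hxy]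
    field_simp
  have h1 : 0 ≤ Real.exp (-(t * y)) - 1 + t * y := by
    linarith [Real.add_one_le_exp (-(t * y))]
  have h2 : Real.exp (-(t * y)) - 1 + t * y ≤ t * y := by
    linarith [Real.exp_le_one_iff.2 (neg_nonpos.2 ha)]
  have h3 : Real.exp (-(t * y)) - 1 + t * y ≤ (t * y) ^ 2 := by
    have h4 : Real.exp (-(t * y)) ≤ (1 + t * y)⁻¹ := by
      rw [Real.exp_neg]
      apply inv_anti₀ (by positivity)
      linarith [Real.add_one_le_exp (t * y)]
    have h5 : (1 + t * y)⁻¹ ≤ 1 - t * y + (t * y) ^ 2 := by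
      rw [inv_le_iff_one_le_mul₀ (by positivity)]
      nlinarith [pow_nonneg ha 3]
    linarith
  have hxy1 : x * y ≤ 1 := by rw [hxy]; linarith
  have hxy0 : 0 ≤ x * y := by positivity
  rw [he]
  refine ⟨by positivity, ?_, ?_⟩
  · calc _ ≤ t⁻¹ * x * (t * y) := by gcongr
      _ = x * y := by field_simp
      _ ≤ 1 := hxy1
  · calc _ ≤ t⁻¹ * x * (t * y) ^ 2 * x := by gcongr
      _ = t * (x * y) ^ 2 := by field_simp
      _ ≤ t * 1 := by gcongr; exact pow_le_one₀ hxy0 hxy1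
      _ = t := mul_one t

/-! ### Functional calculus of the resolvent, and uniqueness of the semigroup. -/

section Abstract

variable {H : Type*} [NormedAddCommGroup H] [InnerProductSpace ℂ H] {J : H →L[ℂ] H}

/-- Operators of uniformly bounded norm which converge to zero on a dense set converge strongly. -/
lemma tendsto_apply_zero_of_denseRange {α : Type*} {f : Filter α} (hJ : DenseRange J)
    {D : α → H →L[ℂ] H} {C : ℝ} (hC : ∀ᶠ a in f, ‖D a‖ ≤ C)
    (h : ∀ u, Tendsto (fun a => D a (J u)) f (𝓝 0)) (u : H) :
    Tendsto (fun a => D a u) f (𝓝 0) := by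
  rw [Metric.tendsto_nhds]
  intro ε hε
  obtain ⟨v, hv⟩ := Metric.denseRange_iff.1 hJ u (ε / (2 * (|C| + 1))) (by positivity)
  have h1 := (Metric.tendsto_nhds.1 (h v)) (ε / 2) (by positivity)
  filter_upwards [hC, h1] with a ha hav
  rw [dist_zero_right] at hav ⊢
  have h2 : ‖D a (u - J v)‖ ≤ (|C| + 1) * (ε / (2 * (|C| + 1))) := by
    refine (D a).le_of_opNorm_le_of_le (ha.trans ?_) ?_
    · linarith [le_abs_self C]
    · rw [← dist_eq_norm]; exact hv.le
  have h3 : (|C| + 1) * (ε / (2 * (|C| + 1))) = ε / 2 := by field_simp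
  calc ‖D a u‖ = ‖D a (u - J v) + D a (J v)‖ := by rw [← map_add, sub_add_cancel]
    _ ≤ _ := norm_add_le _ _
    _ < ε := by linarith

lemma IsC0Semigroup.apply_apply_comm {S : ℝ≥0 → H →L[ℂ] H} (hS : IsC0Semigroup S) (s t : ℝ≥0)
    (u : H) : S s (S t u) = S t (S s u) := by
  rw [← ContinuousLinearMap.comp_apply, ← ContinuousLinearMap.comp_apply, ← hS.map_add,
    ← hS.map_add, add_comm]

/-- Energy estimate: `‖y‖²` has right derivative `-2 Re ⟨y, z⟩ ≤ 0` and starts at zero. Right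
derivatives suffice, and they are all that a strongly continuous semigroup supplies directly. -/
lemma eq_zero_of_hasDerivWithinAt_of_monotone {y z : ℝ → H} {T : ℝ}
    (hc : ContinuousOn y (Icc 0 T))
    (hd : ∀ s ∈ Ico 0 T, HasDerivWithinAt y (-z s) (Ici s) s)
    (hm : ∀ s ∈ Ico 0 T, 0 ≤ (inner ℂ (y s) (z s)).re) (h0 : y 0 = 0) :
    ∀ s ∈ Icc 0 T, y s = 0 := by
  let _ : InnerProductSpace ℝ H := InnerProductSpace.rclikeToReal ℂ H
  intro s hs
  have key := image_le_of_deriv_right_le_deriv_boundary (f := fun s => ‖y s‖ ^ 2)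
    (f' := fun s => 2 * inner ℝ (y s) (-z s)) (a := 0) (b := T) (by fun_prop)
    (fun x hx => (hd x hx).norm_sq) (B := fun _ => 0) (B' := fun _ => 0) (by simp [h0])
    continuousOn_const (fun x _ => hasDerivWithinAt_const _ _ _) (fun x hx => ?_) hs
  · have h9 : ‖y s‖ = 0 := by nlinarith [norm_nonneg (y s)]
    exact norm_eq_zero.1 h9
  · have := hm x hx
    have h1 : inner ℝ (y x) (-z x) = -(inner ℂ (y x) (z x)).re := by
      rw [inner_neg_right]; rfl
    rw [h1]
    linarith

lemma IsC0Semigroup.hasDerivWithinAt {S : ℝ≥0 → H →L[ℂ] H} (hS : IsC0Semigroup S) {u w : H}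
    (h : Tendsto (fun t : ℝ≥0 => (((t : ℝ) : ℂ))⁻¹ • (S t u - u)) (𝓝[>] 0) (𝓝 (-w)))
    {s : ℝ} (hs : 0 ≤ s) :
    HasDerivWithinAt (fun s : ℝ => S s.toNNReal u) (-S s.toNNReal w) (Ici s) s := by
  rw [hasDerivWithinAt_iff_tendsto_slope, Ici_sdiff_left]
  have h1 : Tendsto (fun x : ℝ => (x - s).toNNReal) (𝓝[>] s) (𝓝[>] 0) := by
    refine tendsto_nhdsWithin_iff.2 ⟨?_, ?_⟩
    · have : Continuous fun x : ℝ => (x - s).toNNReal := by fun_prop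
      simpa using (this.tendsto s).mono_left nhdsWithin_le_nhds
    · filter_upwards [self_mem_nhdsWithin] with x hx
      simpa using hx
  have h2 := ((S s.toNNReal).continuous.tendsto _).comp (h.comp h1)
  rw [map_neg] at h2
  refine h2.congr' ?_
  filter_upwards [self_mem_nhdsWithin] with x hx
  have hx' : s < x := hx
  have h3 : x.toNNReal = s.toNNReal + (x - s).toNNReal := by
    rw [← Real.toNNReal_add hs (by linarith)]; congr 1; ring
  rw [slope_def_module, h3, hS.map_add]
  simp only [Function.comp, map_smul, map_sub, ContinuousLinearMap.comp_apply]
  rw [Real.coe_toNNReal _ (by linarith), ← Complex.ofReal_inv, Complex.coe_smul]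

variable [CompleteSpace H]

lemma IsResolvent.norm_le (hJ : IsResolvent J) : ‖J‖ ≤ 1 := by
  refine J.opNorm_le_bound zero_le_one fun h => ?_
  have h1 := hJ.norm_sq_le h
  have h2 : (inner ℂ h (J h)).re ≤ ‖h‖ * ‖J h‖ := re_inner_le_norm (𝕜 := ℂ) h (J h)
  rcases (norm_nonneg (J h)).eq_or_lt with h0 | h0
  · rw [← h0]; positivity
  · nlinarith

lemma IsResolvent.spectrum_subset (hJ : IsResolvent J) : spectrum ℝ J ⊆ Icc 0 1 := by
  intro x hx
  have hpos : 0 ≤ J := by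
    rw [ContinuousLinearMap.nonneg_iff_isPositive, ContinuousLinearMap.isPositive_iff']
    refine ⟨hJ.isSelfAdjoint, fun h => ?_⟩
    have h1 : inner ℂ (J h) h = ((inner ℂ (J h) h).re : ℂ) :=
      (hJ.isSelfAdjoint.isSymmetric.coe_re_inner_apply_self h).symm
    rw [h1, ← inner_conj_symm, Complex.conj_re]
    exact_mod_cast (sq_nonneg _).trans (hJ.norm_sq_le h)
  refine ⟨spectrum_nonneg_of_nonneg hpos hx, ?_⟩
  have := spectrum.norm_le_norm_mul_of_mem hx
  have h1 : ‖(1 : H →L[ℂ] H)‖ ≤ 1 := ContinuousLinearMap.norm_id_le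
  have h2 := hJ.norm_le
  calc x ≤ ‖x‖ := Real.le_norm_self x
    _ ≤ _ := this
    _ ≤ 1 * 1 := by gcongr
    _ = 1 := one_mul 1

lemma IsResolvent.dense_range (hJ : IsResolvent J) : DenseRange J := by
  have h : (J : H →ₗ[ℂ] H).rangeᗮ = ⊥ := by
    rw [ContinuousLinearMap.orthogonal_range, hJ.isSelfAdjoint.adjoint_eq]
    exact (Submodule.eq_bot_iff _).2 fun x hx => hJ.injective x hx
  have := (Submodule.dense_iff_topologicalClosure_eq_top).2
    ((Submodule.topologicalClosure_eq_top_iff).2 h)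
  exact this

/-- The semigroup with generator `1 - J⁻¹`. -/
def resolventSemigroup (J : H →L[ℂ] H) (t : ℝ≥0) : H →L[ℂ] H :=
  -- `decay 0` jumps at the origin, which may lie in the spectrum; there `cfc` of a discontinuous
  -- function is only a default value.
  if t = 0 then 1 else cfc (decay t) J

/-- The factor `x` removes the jump of `decay 0` at the origin, so products of the semigroup with
`J` can be handled by one formula for all `t ≥ 0`. -/
lemma IsResolvent.continuousOn_decay_mul (t : ℝ≥0) (s : Set ℝ) (hs : s ⊆ Icc 0 1) :
    ContinuousOn (fun x => decay t x * x) s := by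
  rcases eq_or_ne t 0 with rfl | ht
  · refine continuousOn_id.congr fun x hx => ?_
    rcases (hs hx).1.eq_or_lt with rfl | h
    · simp
    · simp [decay, not_le.2 h]
  · exact ((continuous_decay (NNReal.coe_pos.2 (pos_iff_ne_zero.2 ht))).mul
      continuous_id).continuousOn

lemma IsResolvent.semigroup_mul (hJ : IsResolvent J) (t : ℝ≥0) :
    resolventSemigroup J t * J = cfc (fun x => decay t x * x) J := by
  have hp : IsSelfAdjoint J := hJ.isSelfAdjoint
  rcases eq_or_ne t 0 with rfl | ht
  · rw [resolventSemigroup, if_pos rfl, one_mul]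
    conv_lhs => rw [← cfc_id' ℝ J]
    refine cfc_congr fun x hx => ?_
    rcases (hJ.spectrum_subset hx).1.eq_or_lt with rfl | h
    · simp
    · simp [decay, not_le.2 h]
  · have hc := continuous_decay (NNReal.coe_pos.2 (pos_iff_ne_zero.2 ht))
    rw [resolventSemigroup, if_neg ht, cfc_mul _ _ J hc.continuousOn, cfc_id' ℝ J]

lemma IsResolvent.norm_semigroup_le (hJ : IsResolvent J) (t : ℝ≥0) :
    ‖resolventSemigroup J t‖ ≤ 1 := by
  rw [resolventSemigroup]
  split_ifs
  · exact ContinuousLinearMap.norm_id_le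
  · refine norm_cfc_le zero_le_one fun x hx => ?_
    rw [Real.norm_of_nonneg (decay_nonneg _ _)]
    exact decay_le_one t.2 (hJ.spectrum_subset hx)

lemma IsResolvent.isC0Semigroup (hJ : IsResolvent J) : IsC0Semigroup (resolventSemigroup J) := by
  have hp : IsSelfAdjoint J := hJ.isSelfAdjoint
  refine ⟨by simp [resolventSemigroup, ContinuousLinearMap.one_def], fun s t => ?_, fun u => ?_⟩
  · rcases eq_or_ne s 0 with rfl | hs
    · simp [resolventSemigroup, ContinuousLinearMap.one_def]
    rcases eq_or_ne t 0 with rfl | ht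
    · simp [resolventSemigroup, ContinuousLinearMap.one_def]
    have hst : s + t ≠ 0 := by positivity
    rw [resolventSemigroup, resolventSemigroup, resolventSemigroup, if_neg hs, if_neg ht,
      if_neg hst, ← ContinuousLinearMap.mul_def, ← cfc_mul _ _ J
        (continuous_decay (NNReal.coe_pos.2 (pos_iff_ne_zero.2 hs))).continuousOn
        (continuous_decay (NNReal.coe_pos.2 (pos_iff_ne_zero.2 ht))).continuousOn]
    congr 1
    ext x
    exact_mod_cast decay_add s t x
  · rw [continuous_iff_continuousAt]
    intro t
    have key : Tendsto (fun s => (resolventSemigroup J s - resolventSemigroup J t) u) (𝓝 t)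
        (𝓝 0) := by
      refine tendsto_apply_zero_of_denseRange hJ.dense_range (C := 2)
        (Eventually.of_forall fun s => ?_) (fun v => ?_) u
      · refine (norm_sub_le _ _).trans ?_
        linarith [hJ.norm_semigroup_le s, hJ.norm_semigroup_le t]
      · refine squeeze_zero_norm (a := fun s : ℝ≥0 => |(s : ℝ) - t| * ‖v‖) (fun s => ?_) ?_
        · have h : (resolventSemigroup J s - resolventSemigroup J t) (J v)
              = (cfc (fun x => decay s x * x - decay t x * x) J) v := by
            rw [cfc_sub _ _ J (continuousOn_decay_mul s _ hJ.spectrum_subset)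
              (continuousOn_decay_mul t _ hJ.spectrum_subset), ← hJ.semigroup_mul,
              ← hJ.semigroup_mul]
            rfl
          rw [h]
          refine ContinuousLinearMap.le_of_opNorm_le _ (norm_cfc_le (abs_nonneg _) fun x hx => ?_) v
          exact abs_decay_mul_sub_le s.2 t.2 (hJ.spectrum_subset hx)
        · have : Continuous fun s : ℝ≥0 => |(s : ℝ) - t| * ‖v‖ := by fun_prop
          simpa using this.tendsto t
    have := key.add_const (resolventSemigroup J t u)
    simpa [ContinuousAt] using this

/-- Since `LJ = 1 - J`, `generatorError` is the symbol of `((exp(-tL) - 1)/t + L) J`. It is applied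
to `u + w`, the vector with `J (u + w) = u`. -/
lemma IsResolvent.tendsto_generator (hJ : IsResolvent J) {u w : H} (huw : J (u + w) = u) :
    Tendsto (fun t : ℝ≥0 => (((t : ℝ) : ℂ))⁻¹ • (resolventSemigroup J t u - u)) (𝓝[>] 0)
      (𝓝 (-w)) := by
  have hp : IsSelfAdjoint J := hJ.isSelfAdjoint
  have hcont (t : ℝ≥0) : ContinuousOn (generatorError t) (spectrum ℝ J) := by
    have := IsResolvent.continuousOn_decay_mul t _ hJ.spectrum_subset
    unfold generatorError
    fun_prop
  have hD (t : ℝ≥0) : cfc (generatorError t) J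
      = (t : ℝ)⁻¹ • (resolventSemigroup J t * J - J) + (1 - J) := by
    have h1 := IsResolvent.continuousOn_decay_mul t _ hJ.spectrum_subset
    have h2 : cfc (generatorError t) J = cfc (fun x => (t : ℝ)⁻¹ • (decay t x * x - x) + (1 - x)) J :=
      rfl
    rw [h2, cfc_add (a := J) (fun x => (t : ℝ)⁻¹ • (decay t x * x - x)) (fun x => 1 - x)
      (by fun_prop) (by fun_prop), cfc_smul _ _ J (by fun_prop), cfc_sub _ _ J h1 (by fun_prop),
      cfc_sub _ _ J (by fun_prop) (by fun_prop), cfc_id' ℝ J, hJ.semigroup_mul, cfc_const_one ℝ J]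
  have key : Tendsto (fun t : ℝ≥0 => cfc (generatorError t) J (u + w)) (𝓝[>] 0) (𝓝 0) := by
    refine tendsto_apply_zero_of_denseRange hJ.dense_range (C := 1) ?_ (fun v => ?_) _
    · filter_upwards [self_mem_nhdsWithin] with t ht
      refine norm_cfc_le zero_le_one fun x hx => ?_
      obtain ⟨h1, h2, -⟩ := generatorError_bounds (NNReal.coe_pos.2 ht) (hJ.spectrum_subset hx)
      rwa [Real.norm_of_nonneg h1]
    · refine squeeze_zero_norm' (a := fun s : ℝ≥0 => (s : ℝ) * ‖v‖) ?_ ?_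
      · filter_upwards [self_mem_nhdsWithin] with t ht
        have h : cfc (generatorError t) J (J v) = (cfc (fun x => generatorError t x * x) J) v := by
          rw [cfc_mul _ _ J (hcont t) (by fun_prop), cfc_id' ℝ J]
          rfl
        rw [h]
        refine ContinuousLinearMap.le_of_opNorm_le _ (norm_cfc_le t.2 fun x hx => ?_) v
        obtain ⟨h1, -, h2⟩ := generatorError_bounds (NNReal.coe_pos.2 ht) (hJ.spectrum_subset hx)
        rwa [Real.norm_of_nonneg (mul_nonneg h1 (hJ.spectrum_subset hx).1)]
      · have : Continuous fun s : ℝ≥0 => (s : ℝ) * ‖v‖ := by fun_prop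
        simpa using (this.tendsto 0).mono_left nhdsWithin_le_nhds
  have h3 := key.sub_const w
  rw [zero_sub] at h3
  refine h3.congr fun t => ?_
  have h4 : cfc (generatorError t) J (u + w)
      = (t : ℝ)⁻¹ • (resolventSemigroup J t u - u) + w := by
    rw [hD]
    simp only [add_apply, smul_apply,
      sub_apply, mul_apply_eq_comp, huw,
      one_apply_eq_self]
    abel
  rw [h4, add_sub_cancel_right, ← Complex.ofReal_inv, Complex.coe_smul]

lemma IsResolvent.generator_iff (hJ : IsResolvent J) (u w : H) :
    J (u + w) = u ↔
    Tendsto (fun t : ℝ≥0 => (((t : ℝ) : ℂ))⁻¹ • (resolventSemigroup J t u - u)) (𝓝[>] 0)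
      (𝓝 (-w)) := by
  refine ⟨hJ.tendsto_generator, fun h => ?_⟩
  -- The generator has no proper extension of this kind: `e` would satisfy `-L e = e`, while
  -- contractivity makes the real part of `⟨e, (S_t e - e)/t⟩` nonpositive, so `e = 0`.
  set e := u - J (u + w) with he
  have h2 := hJ.tendsto_generator (u := J (u + w)) (w := u + w - J (u + w)) (by simp)
  have h3 : Tendsto (fun t : ℝ≥0 => (((t : ℝ) : ℂ))⁻¹ • (resolventSemigroup J t e - e)) (𝓝[>] 0)
      (𝓝 e) := by
    have h4 := h.sub h2
    have h5 : -w - -(u + w - J (u + w)) = e := by rw [he]; abel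
    rw [h5] at h4
    refine h4.congr fun t => ?_
    rw [← smul_sub, he, map_sub]
    congr 1
    abel
  have h4 : Tendsto (fun t : ℝ≥0 =>
      (inner ℂ e ((((t : ℝ) : ℂ))⁻¹ • (resolventSemigroup J t e - e))).re) (𝓝[>] 0)
      (𝓝 (inner ℂ e e).re) :=
    (Complex.continuous_re.tendsto _).comp (tendsto_const_nhds.inner h3)
  have : NeBot (𝓝[>] (0 : ℝ≥0)) := inferInstance
  have h5 : (inner ℂ e e).re ≤ 0 := by
    refine le_of_tendsto h4 (Eventually.of_forall fun t => ?_)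
    rw [inner_smul_right, inner_sub_right, ← Complex.ofReal_inv, Complex.re_ofReal_mul,
      Complex.sub_re]
    have h6 : (inner ℂ e (resolventSemigroup J t e)).re ≤ ‖e‖ * ‖resolventSemigroup J t e‖ :=
      re_inner_le_norm (𝕜 := ℂ) _ _
    have h7 : ‖resolventSemigroup J t e‖ ≤ 1 * ‖e‖ :=
      ContinuousLinearMap.le_of_opNorm_le _ (hJ.norm_semigroup_le t) e
    have h8 : (inner ℂ e e).re = ‖e‖ ^ 2 := inner_self_eq_norm_sq (𝕜 := ℂ) e
    have h9 := norm_nonneg e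
    refine mul_nonpos_of_nonneg_of_nonpos (by positivity) ?_
    nlinarith
  have h8 : (inner ℂ e e).re = ‖e‖ ^ 2 := inner_self_eq_norm_sq (𝕜 := ℂ) e
  have h9 : ‖e‖ = 0 := by nlinarith [norm_nonneg e]
  rw [norm_eq_zero, he, sub_eq_zero] at h9
  exact h9.symm

lemma IsResolvent.monotone (hJ : IsResolvent J) {u w : H} (h : J (u + w) = u) :
    0 ≤ (inner ℂ u w).re := by
  have h1 := hJ.norm_sq_le (u + w)
  rw [h, ← inner_conj_symm, Complex.conj_re, inner_add_right, Complex.add_re] at h1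
  have h8 : (inner ℂ u u).re = ‖u‖ ^ 2 := inner_self_eq_norm_sq (𝕜 := ℂ) u
  linarith

/-- A classical solution of `u' = -Lu` in the domain of the generator is given by the semigroup. -/
lemma IsResolvent.semigroup_apply_eq (hJ : IsResolvent J) {S : ℝ≥0 → H →L[ℂ] H}
    (hS : IsC0Semigroup S)
    (hgen : ∀ u w, J (u + w) = u ↔
      Tendsto (fun t : ℝ≥0 => (((t : ℝ) : ℂ))⁻¹ • (S t u - u)) (𝓝[>] 0) (𝓝 (-w)))
    {u w : ℝ → H} {T : ℝ≥0} (hc : ContinuousOn u (Icc 0 T))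
    (hd : ∀ s ∈ Ico (0 : ℝ) T, HasDerivWithinAt u (-w s) (Ici s) s)
    (hu : ∀ s ∈ Icc (0 : ℝ) T, J (u s + w s) = u s) : S T (u 0) = u T := by
  have h0 : J (u 0 + w 0) = u 0 := hu 0 ⟨le_rfl, T.2⟩
  have hlim := (hgen _ _).1 h0
  have hSw (s : ℝ≥0) : J (S s (u 0) + S s (w 0)) = S s (u 0) := by
    rw [hgen]
    have := ((S s).continuous.tendsto _).comp hlim
    rw [map_neg] at this
    refine this.congr fun t => ?_
    simp only [Function.comp, map_smul, map_sub]
    rw [hS.apply_apply_comm]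
  have hcS : Continuous fun s : ℝ => S s.toNNReal (u 0) :=
    (hS.continuous (u 0)).comp continuous_real_toNNReal
  -- The difference of the two solutions solves the same equation with zero initial value, and `L`
  -- is accretive.
  have key := eq_zero_of_hasDerivWithinAt_of_monotone
    (y := fun s => S s.toNNReal (u 0) - u s) (z := fun s => S s.toNNReal (w 0) - w s) (T := T)
    (hcS.continuousOn.sub hc) (fun s hs => ?_) (fun s hs => ?_) ?_ T ⟨T.2, le_rfl⟩
  · simpa [sub_eq_zero] using key
  · have := (hS.hasDerivWithinAt hlim hs.1).sub (hd s hs)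
    have h1 : -(S s.toNNReal (w 0) - w s) = -(S s.toNNReal (w 0)) - -w s := by abel
    rw [h1]
    exact this
  · refine hJ.monotone ?_
    have := congrArg₂ (· - ·) (hSw s.toNNReal) (hu s ⟨hs.1, hs.2.le⟩)
    simp only [← map_sub] at this
    rw [sub_add_sub_comm, this]
  · simp [hS.map_zero]

lemma IsResolvent.existsUnique_semigroup (hJ : IsResolvent J) :
    ∃! S : ℝ≥0 → H →L[ℂ] H, IsC0Semigroup S ∧ ∀ u w, J (u + w) = u ↔
      Tendsto (fun t : ℝ≥0 => (((t : ℝ) : ℂ))⁻¹ • (S t u - u)) (𝓝[>] 0) (𝓝 (-w)) := by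
  refine ⟨resolventSemigroup J, ⟨hJ.isC0Semigroup, hJ.generator_iff⟩, fun S ⟨hS, hgen⟩ => ?_⟩
  have key (h : H) (t : ℝ≥0) : resolventSemigroup J t (J h) = S t (J h) := by
    have h0 : J (J h + (h - J h)) = J h := by simp
    have hlim := (hgen _ _).1 h0
    have := hJ.semigroup_apply_eq hJ.isC0Semigroup hJ.generator_iff (T := t)
      (u := fun s => S s.toNNReal (J h)) (w := fun s => S s.toNNReal (h - J h))
      ((hS.continuous _).comp continuous_real_toNNReal).continuousOn
      (fun s hs => hS.hasDerivWithinAt hlim hs.1) (fun s hs => ?_)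
    · simpa [hS.map_zero] using this
    · rw [hgen]
      have := ((S s.toNNReal).continuous.tendsto _).comp hlim
      rw [map_neg] at this
      refine this.congr fun t => ?_
      simp only [Function.comp, map_smul, map_sub]
      rw [hS.apply_apply_comm]
  funext t
  refine ContinuousLinearMap.ext fun u => ?_
  exact congrFun (hJ.dense_range.equalizer (S t).continuous (resolventSemigroup J t).continuous
    (funext fun h => (key h t).symm)) u

end Abstract

/-! ### The resolvent of a closed form -/

section Form

variable {H K : Type*} [NormedAddCommGroup H] [InnerProductSpace ℂ H]
  [NormedAddCommGroup K] [InnerProductSpace ℂ K]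

/-- The closure of `C` in the Hilbert space sum of `H` and `K`. -/
def formDomain (C : Submodule ℂ (H × K)) : Submodule ℂ (WithLp 2 (H × K)) :=
  (C.comap (WithLp.prodContinuousLinearEquiv 2 ℂ H K).toLinearMap).topologicalClosure

lemma mem_formDomain_iff (C : Submodule ℂ (H × K)) (x : WithLp 2 (H × K)) :
    x ∈ formDomain C ↔ WithLp.prodContinuousLinearEquiv 2 ℂ H K x ∈ closure (C : Set (H × K)) := by
  have h := (WithLp.prodContinuousLinearEquiv 2 ℂ H K).toHomeomorph.preimage_closure
    (C : Set (H × K))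
  have h2 := Set.ext_iff.1 h x
  exact h2.symm

variable [CompleteSpace H] [CompleteSpace K]

instance (C : Submodule ℂ (H × K)) : CompleteSpace (formDomain C) :=
  (Submodule.isClosed_topologicalClosure _).completeSpace_coe

/-- The resolvent `(1 + L)⁻¹` of the operator associated with the closed form. -/
def formResolvent (C : Submodule ℂ (H × K)) : H →L[ℂ] H :=
  (ContinuousLinearMap.fst ℂ H K).comp
    ((WithLp.prodContinuousLinearEquiv 2 ℂ H K).toContinuousLinearMap.comp
      ((formDomain C).starProjection.comp
        ((WithLp.prodContinuousLinearEquiv 2 ℂ H K).symm.toContinuousLinearMap.comp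
          (ContinuousLinearMap.inl ℂ H K))))

lemma formResolvent_apply (C : Submodule ℂ (H × K)) (h : H) :
    formResolvent C h = ((formDomain C).starProjection (WithLp.toLp 2 (h, 0))).ofLp.1 := rfl

lemma inner_formResolvent (C : Submodule ℂ (H × K)) (u v : H) :
    inner ℂ u (formResolvent C v) = inner ℂ (WithLp.toLp 2 (u, (0 : K)))
      ((formDomain C).starProjection (WithLp.toLp 2 (v, 0))) := by
  rw [WithLp.prod_inner_apply, formResolvent_apply]
  simp

/-- The operator is `ι* P ι`, where `ι h = (h, 0)` and `P` is the projection onto the form domain.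
Hence `⟨h, J h⟩ = ‖P ι h‖²`, which dominates the squared norm of the first component. If `J h = 0`,
then `(h, 0)` is orthogonal to `C`, and the hypothesis applies. -/
lemma isResolvent_formResolvent (C : Submodule ℂ (H × K))
    (hC : ∀ h : H, (∀ p ∈ C, inner ℂ p.1 h = 0) → h = 0) : IsResolvent (formResolvent C) := by
  have hsq (h : H) : inner ℂ h (formResolvent C h)
      = inner ℂ ((formDomain C).starProjection (WithLp.toLp 2 (h, (0 : K))))
        ((formDomain C).starProjection (WithLp.toLp 2 (h, 0))) := by
    rw [inner_formResolvent, Submodule.inner_starProjection_left_eq_right,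
      Submodule.starProjection_eq_self_iff.2 (Submodule.starProjection_apply_mem _ _)]
  have hre (h : H) : (inner ℂ h (formResolvent C h)).re
      = ‖(formDomain C).starProjection (WithLp.toLp 2 (h, (0 : K)))‖ ^ 2 := by
    rw [hsq]
    exact inner_self_eq_norm_sq (𝕜 := ℂ) (E := WithLp 2 (H × K)) _
  refine ⟨?_, fun h => ?_, fun h hh => hC h fun p hp => ?_⟩
  · rw [ContinuousLinearMap.isSelfAdjoint_iff_isSymmetric]
    intro u v
    change inner ℂ (formResolvent C u) v = inner ℂ u (formResolvent C v)
    rw [inner_formResolvent, ← inner_conj_symm, inner_formResolvent, inner_conj_symm,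
      Submodule.inner_starProjection_left_eq_right]
  · rw [hre, WithLp.prod_norm_sq_eq_of_L2, formResolvent_apply]
    simp
  · have h0 : (formDomain C).starProjection (WithLp.toLp 2 (h, (0 : K))) = 0 := by
      rw [← norm_eq_zero, ← sq_eq_zero_iff, ← hre, hh]
      simp
    have hm : WithLp.toLp 2 p ∈ formDomain C := (mem_formDomain_iff C _).2 (subset_closure hp)
    have h1 := (formDomain C).inner_starProjection_left_eq_right (WithLp.toLp 2 p)
      (WithLp.toLp 2 (h, (0 : K)))
    rw [h0, Submodule.starProjection_eq_self_iff.2 hm, WithLp.prod_inner_apply] at h1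
    simpa using h1

/-- Both sides say that `(u, F)` is the projection of `(u + w, 0)` for some `F`: it lies in the
closure, and `(w, -F)` is orthogonal to `C`, which is the weak equation `L u = w`. Closability of
the form plays no role here. -/
lemma formResolvent_add_eq_iff (C : Submodule ℂ (H × K)) (u w : H) :
    formResolvent C (u + w) = u ↔ ∃ F : K, (u, F) ∈ closure (C : Set (H × K)) ∧
      ∀ p ∈ C, inner ℂ p.2 F = inner ℂ p.1 w := by
  constructor
  · intro h
    set q := (formDomain C).starProjection (WithLp.toLp 2 (u + w, (0 : K))) with hq
    have hu : q.ofLp.1 = u := h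
    have hqm : q ∈ formDomain C := Submodule.starProjection_apply_mem _ _
    have hqm' := (mem_formDomain_iff C _).1 hqm
    refine ⟨q.ofLp.2, ?_, fun p hp => ?_⟩
    · rw [← hu]; exact hqm'
    · have hm : WithLp.toLp 2 p ∈ formDomain C := (mem_formDomain_iff C _).2 (subset_closure hp)
      have h1 := (formDomain C).inner_starProjection_left_eq_right (WithLp.toLp 2 p)
        (WithLp.toLp 2 (u + w, (0 : K)))
      rw [Submodule.starProjection_eq_self_iff.2 hm, ← hq, WithLp.prod_inner_apply,
        WithLp.prod_inner_apply, hu] at h1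
      simp only [inner_zero_right, add_zero, inner_add_right] at h1
      exact (add_left_cancel h1).symm
  · rintro ⟨F, hF, hinner⟩
    have hm : WithLp.toLp 2 (u, F) ∈ formDomain C := (mem_formDomain_iff C _).2 hF
    rw [formResolvent_apply, Submodule.eq_starProjection_of_mem_of_inner_eq_zero hm]
    intro v hv
    have hcl : IsClosed {v : WithLp 2 (H × K) |
        inner ℂ (WithLp.toLp 2 (u + w, (0 : K)) - WithLp.toLp 2 (u, F)) v = 0} :=
      isClosed_eq (by fun_prop) continuous_const
    refine (Submodule.topologicalClosure_minimal (t := LinearMap.ker (innerSL ℂ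
      (WithLp.toLp 2 (u + w, (0 : K)) - WithLp.toLp 2 (u, F))).toLinearMap) _ ?_ hcl) hv
    intro v hv
    have hv' : v.ofLp ∈ C := hv
    have := hinner _ hv'
    rw [← inner_conj_symm, ← inner_conj_symm v.ofLp.1] at this
    have h2 := (starRingEnd ℂ).injective this
    change inner ℂ (WithLp.toLp 2 (u + w, (0 : K)) - WithLp.toLp 2 (u, F)) v = 0
    rw [WithLp.prod_inner_apply]
    simp only [WithLp.ofLp_sub, Prod.fst_sub, Prod.snd_sub, add_sub_cancel_left, zero_sub,
      inner_neg_left, h2, add_neg_cancel]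

end Form

/-! ### The Ornstein-Uhlenbeck graph of a smooth potential -/

/-- Dominated convergence for the squared norms. -/
lemma tendsto_L2_zero {α F ι : Type*} [MeasurableSpace α] {μ : Measure α}
    [NormedAddCommGroup F] [InnerProductSpace ℂ F] {l : Filter ι} [l.IsCountablyGenerated]
    {h : ι → Lp F 2 μ} {f : ι → α → F} {B : α → ℝ} (hB : MemLp B 2 μ)
    (hf : ∀ᶠ n in l, h n =ᵐ[μ] f n)
    (hle : ∀ᶠ n in l, ∀ᵐ a ∂μ, ‖f n a‖ ≤ B a)
    (hlim : ∀ᵐ a ∂μ, Tendsto (fun n => f n a) l (𝓝 0)) : Tendsto h l (𝓝 0) := by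
  have h1 : Tendsto (fun n => ∫ a, ‖f n a‖ ^ 2 ∂μ) l (𝓝 (∫ _, (0 : ℝ) ∂μ)) := by
    refine tendsto_integral_filter_of_dominated_convergence (fun a => B a ^ 2) ?_ ?_
      hB.integrable_sq ?_
    · filter_upwards [hf] with n hn
      exact (((Lp.aestronglyMeasurable (h n)).congr hn).norm.pow 2)
    · filter_upwards [hle] with n hn
      filter_upwards [hn] with a ha
      rw [Real.norm_of_nonneg (by positivity)]
      gcongr
    · filter_upwards [hlim] with a ha
      simpa using (ha.norm.pow 2)
  have h2 : Tendsto (fun n => ‖h n‖ ^ 2) l (𝓝 0) := by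
    rw [integral_zero] at h1
    refine h1.congr' ?_
    filter_upwards [hf] with n hn
    have h3 : ((‖h n‖ ^ 2 : ℝ) : ℂ) = inner ℂ (h n) (h n) := by
      rw [inner_self_eq_norm_sq_to_K]; simp
    rw [← Complex.ofReal_inj, h3, L2.inner_def, ← integral_complex_ofReal]
    refine integral_congr_ae ?_
    filter_upwards [hn] with a ha
    rw [ha, inner_self_eq_norm_sq_to_K]
    simp
  rw [tendsto_zero_iff_norm_tendsto_zero]
  have h4 := (Real.continuous_sqrt.tendsto _).comp h2
  simpa [Function.comp_def, Real.sqrt_sq] using h4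

section Potential

variable {d : ℕ} {φ : E d → ℝ}

lemma ae_mu (hφ : Continuous φ) : ae (mu φ) = ae (volume : Measure (E d)) := by
  refine le_antisymm (withDensity_absolutelyContinuous _ _).ae_le
    (withDensity_absolutelyContinuous' ?_ ?_).ae_le
  · exact (ENNReal.continuous_ofReal.comp (by fun_prop : Continuous fun x => Real.exp (-φ x))).aemeasurable
  · refine Eventually.of_forall fun x => ?_
    simpa using Real.exp_pos _

lemma isLocallyFiniteMeasure_mu (hφ : Continuous φ) : IsLocallyFiniteMeasure (mu φ) :=
  IsLocallyFiniteMeasure.withDensity_ofReal (by fun_prop)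

lemma integral_mu {G : Type*} [NormedAddCommGroup G] [NormedSpace ℝ G] (hφ : Continuous φ)
    (f : E d → G) : ∫ x, f x ∂(mu φ) = ∫ x, Real.exp (-φ x) • f x := by
  rw [mu, integral_withDensity_eq_integral_toReal_smul]
  · simp [ENNReal.toReal_ofReal, Real.exp_nonneg]
  · exact (ENNReal.continuous_ofReal.comp (by fun_prop : Continuous fun x => Real.exp (-φ x))).measurable
  · simp

lemma integrable_mu {G : Type*} [NormedAddCommGroup G] [NormedSpace ℝ G] (hφ : Continuous φ)
    {f : E d → G} : Integrable f (mu φ) ↔ Integrable fun x => Real.exp (-φ x) • f x := by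
  rw [mu, integrable_withDensity_iff_integrable_smul']
  · simp [ENNReal.toReal_ofReal, Real.exp_nonneg]
  · exact (ENNReal.continuous_ofReal.comp (by fun_prop : Continuous fun x => Real.exp (-φ x))).measurable
  · simp

lemma mem_core_iff (hφ : ContDiff ℝ ∞ φ) {f : E d → ℂ} :
    f ∈ core φ ↔ ContDiff ℝ ∞ f ∧ HasCompactSupport f := by
  refine and_congr_left fun _ => ⟨fun h => ?_, fun h => ?_⟩
  · have h1 : ContDiff ℝ ∞ fun x => (Real.exp (φ x / 2) : ℂ) :=
      Complex.ofRealCLM.contDiff.comp (Real.contDiff_exp.comp (hφ.div_const 2))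
    have h2 := h.mul h1
    have h3 : f = fun x => f x * (Real.exp (-φ x / 2) : ℂ) * (Real.exp (φ x / 2) : ℂ) := by
      ext x
      rw [mul_assoc, ← Complex.ofReal_mul, ← Real.exp_add, neg_div, neg_add_cancel]
      simp
    rwa [h3]
  · have h1 : ContDiff ℝ ∞ fun x => (Real.exp (-φ x / 2) : ℂ) :=
      Complex.ofRealCLM.contDiff.comp (Real.contDiff_exp.comp (hφ.neg.div_const 2))
    exact h.mul h1

lemma grad_add {f g : E d → ℂ} (hf : Differentiable ℝ f) (hg : Differentiable ℝ g) :
    grad (f + g) = grad f + grad g := by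
  ext x i
  simp [grad, fderiv_add (hf x) (hg x)]

lemma grad_const_smul {f : E d → ℂ} (hf : Differentiable ℝ f) (c : ℂ) :
    grad (c • f) = c • grad f := by
  ext x i
  simp [grad, fderiv_const_smul (hf x) c]

lemma ContDiff.continuous_grad {f : E d → ℂ} (hf : ContDiff ℝ ∞ f) : Continuous (grad f) := by
  have h := hf.continuous_fderiv (by simp)
  unfold grad
  fun_prop

lemma HasCompactSupport.grad {f : E d → ℂ} (hf : HasCompactSupport f) :
    HasCompactSupport (grad f) := by
  refine (hf.fderiv (𝕜 := ℝ)).mono' ?_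
  refine (Function.support_subset_iff'.2 fun x hx => ?_).trans subset_closure
  have h : fderiv ℝ f x = 0 := by simpa using hx
  ext i
  simp [OUWeyl.grad, h]

/-- The graph of the gradient on the core, as a subspace. -/
def coreSubmodule (hφ : ContDiff ℝ ∞ φ) : Submodule ℂ (L2 φ × L2Vec φ) where
  carrier := coreGraph φ
  zero_mem' := by
    refine ⟨0, (mem_core_iff hφ).2 ⟨contDiff_const, HasCompactSupport.zero⟩, Lp.coeFn_zero _ _ _, ?_⟩
    have h : grad (0 : E d → ℂ) = 0 := by ext x i; simp [grad]
    rw [h]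
    exact Lp.coeFn_zero _ _ _
  add_mem' := by
    rintro p q ⟨f, hf, hpf, hpF⟩ ⟨g, hg, hqg, hqG⟩
    rw [mem_core_iff hφ] at hf hg
    refine ⟨f + g, (mem_core_iff hφ).2 ⟨hf.1.add hg.1, hf.2.add hg.2⟩, ?_, ?_⟩
    · exact (Lp.coeFn_add _ _).trans (hpf.add hqg)
    · rw [grad_add (hf.1.differentiable (by simp)) (hg.1.differentiable (by simp))]
      exact (Lp.coeFn_add _ _).trans (hpF.add hqG)
  smul_mem' := by
    rintro c p ⟨f, hf, hpf, hpF⟩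
    rw [mem_core_iff hφ] at hf
    refine ⟨c • f, (mem_core_iff hφ).2 ⟨contDiff_const.smul hf.1, hf.2.smul_left⟩, ?_, ?_⟩
    · exact (Lp.coeFn_smul _ _).trans (hpf.const_smul c)
    · rw [grad_const_smul (hf.1.differentiable (by simp))]
      exact (Lp.coeFn_smul _ _).trans (hpF.const_smul c)

lemma memLp_of_continuous_of_hasCompactSupport {G : Type*} [NormedAddCommGroup G]
    (hφ : Continuous φ) {f : E d → G} (hf : Continuous f) (hs : HasCompactSupport f) :
    MemLp f 2 (mu φ) :=
  have := isLocallyFiniteMeasure_mu hφ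
  hf.memLp_of_hasCompactSupport hs

lemma mk_mem_coreGraph (hφ : ContDiff ℝ ∞ φ) {f : E d → ℂ} (hf : f ∈ core φ) :
    ∃ (h1 : MemLp f 2 (mu φ)) (h2 : MemLp (grad f) 2 (mu φ)), (h1.toLp, h2.toLp) ∈ coreGraph φ := by
  obtain ⟨h1, h2⟩ := (mem_core_iff hφ).1 hf
  exact ⟨memLp_of_continuous_of_hasCompactSupport hφ.continuous h1.continuous h2,
    memLp_of_continuous_of_hasCompactSupport hφ.continuous (ContDiff.continuous_grad h1)
    (HasCompactSupport.grad h2),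
    f, hf, MemLp.coeFn_toLp (memLp_of_continuous_of_hasCompactSupport hφ.continuous h1.continuous h2),
    MemLp.coeFn_toLp (memLp_of_continuous_of_hasCompactSupport hφ.continuous
      (ContDiff.continuous_grad h1) (HasCompactSupport.grad h2))⟩

/-- Real test functions already determine a locally integrable function. This density of the core
gives injectivity of the resolvent. -/
lemma eq_zero_of_forall_inner_core (hφ : ContDiff ℝ ∞ φ) (h : L2 φ)
    (hh : ∀ p ∈ coreSubmodule hφ, inner ℂ p.1 h = 0) : h = 0 := by
  have hloc : LocallyIntegrable (h : E d → ℂ) (mu φ) := by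
    have := isLocallyFiniteMeasure_mu hφ.continuous
    exact (Lp.memLp h).locallyIntegrable (by norm_num)
  have := isLocallyFiniteMeasure_mu hφ.continuous
  have key : ∀ᵐ x ∂(mu φ), (h : E d → ℂ) x = 0 := by
    refine ae_eq_zero_of_integral_contDiff_smul_eq_zero hloc fun g hg hgs => ?_
    have hmem : (fun x => (g x : ℂ)) ∈ core φ :=
      (mem_core_iff hφ).2 ⟨Complex.ofRealCLM.contDiff.comp hg,
        hgs.comp_left (g := fun r : ℝ => (r : ℂ)) Complex.ofReal_zero⟩
    obtain ⟨h1, h2, h3⟩ := mk_mem_coreGraph hφ hmem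
    have h4 := hh _ h3
    rw [L2.inner_def] at h4
    rw [← h4]
    refine integral_congr_ae ?_
    filter_upwards [MemLp.coeFn_toLp h1] with x hx
    rw [hx]
    simp [mul_comm]
  exact (Lp.eq_zero_iff_ae_eq_zero).2 key

/-- The resolvent of the Ornstein-Uhlenbeck operator. -/
def ouResolvent (hφ : ContDiff ℝ ∞ φ) : L2 φ →L[ℂ] L2 φ := formResolvent (coreSubmodule hφ)

lemma isResolvent_ouResolvent (hφ : ContDiff ℝ ∞ φ) : IsResolvent (ouResolvent hφ) :=
  isResolvent_formResolvent _ (eq_zero_of_forall_inner_core hφ)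

lemma mem_ouGraph_iff (hφ : ContDiff ℝ ∞ φ) (u w : L2 φ) :
    (u, w) ∈ ouGraph φ ↔ ouResolvent hφ (u + w) = u :=
  (formResolvent_add_eq_iff (coreSubmodule hφ) u w).symm

lemma isOUSemigroup_iff (hφ : ContDiff ℝ ∞ φ) (S : ℝ≥0 → L2 φ →L[ℂ] L2 φ) :
    IsOUSemigroup φ S ↔ IsC0Semigroup S ∧ ∀ u w, ouResolvent hφ (u + w) = u ↔
      Tendsto (fun t : ℝ≥0 => (((t : ℝ) : ℂ))⁻¹ • (S t u - u)) (𝓝[>] 0) (𝓝 (-w)) := by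
  simp_rw [← mem_ouGraph_iff hφ]
  exact ⟨fun h => ⟨h.1, h.2⟩, fun h => ⟨h.1, h.2⟩⟩

theorem existsUnique_isOUSemigroup (hφ : ContDiff ℝ ∞ φ) :
    ∃! S : ℝ≥0 → L2 φ →L[ℂ] L2 φ, IsOUSemigroup φ S := by
  simp_rw [isOUSemigroup_iff hφ]
  exact (isResolvent_ouResolvent hφ).existsUnique_semigroup

end Potential

/-! ### Smooth functions in the domain of the Ornstein-Uhlenbeck operator -/

section Smooth

variable {d : ℕ} {φ : E d → ℝ}

lemma exists_cutoff (d : ℕ) : ∃ χ : E d → ℂ, ContDiff ℝ ∞ χ ∧ HasCompactSupport χ ∧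
    (∀ x, ‖χ x‖ ≤ 1) ∧ ∀ x, ‖x‖ < 1 → χ x = 1 := by
  let b : ContDiffBump (0 : E d) := ⟨1, 2, one_pos, one_lt_two⟩
  refine ⟨fun x => (b x : ℂ), Complex.ofRealCLM.contDiff.comp b.contDiff,
    b.hasCompactSupport.comp_left (g := fun r : ℝ => (r : ℂ)) Complex.ofReal_zero, fun x => ?_,
    fun x hx => ?_⟩
  · rw [Complex.norm_real, Real.norm_of_nonneg b.nonneg]
    exact b.le_one
  · have : x ∈ Metric.closedBall (0 : E d) b.rIn := by
      simpa [b] using hx.le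
    simp [b.one_of_mem_closedBall this]

lemma grad_mul {f g : E d → ℂ} (hf : Differentiable ℝ f) (hg : Differentiable ℝ g) (x : E d) :
    grad (fun y => f y * g y) x = f x • grad g x + g x • grad f x := by
  ext i
  simp [grad, fderiv_fun_mul (hf x) (hg x)]

lemma grad_comp_smul {f : E d → ℂ} (hf : Differentiable ℝ f) (r : ℝ) (x : E d) :
    grad (fun y => f (r • y)) x = (r : ℂ) • grad f (r • x) := by
  ext i
  have h : HasFDerivAt (fun y : E d => f (r • y))
      ((fderiv ℝ f (r • x)).comp (r • ContinuousLinearMap.id ℝ (E d))) x :=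
    (hf (r • x)).hasFDerivAt.comp x ((hasFDerivAt_id x).const_smul r)
  simp [grad, h.fderiv]

/-- Smooth functions with finite Dirichlet energy belong to the domain of the closed form. -/
lemma mem_closure_coreGraph (hφ : ContDiff ℝ ∞ φ) {u : E d → ℂ} (hu : ContDiff ℝ ∞ u)
    (h1 : MemLp u 2 (mu φ)) (h2 : MemLp (grad u) 2 (mu φ)) :
    (h1.toLp, h2.toLp) ∈ closure (coreGraph φ) := by
  obtain ⟨χ, hχ, hχs, hχ1, hχe⟩ := exists_cutoff d
  obtain ⟨C, hC⟩ := (HasCompactSupport.grad hχs).exists_bound_of_continuous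
    (ContDiff.continuous_grad hχ)
  set r : ℕ → ℝ := fun n => 1 / ((n : ℝ) + 1) with hr
  have hr0 (n : ℕ) : 0 < r n := by positivity
  have hr1 (n : ℕ) : r n ≤ 1 := by
    rw [hr]; simp only [one_div]; exact inv_le_one_of_one_le₀ (by linarith [n.cast_nonneg (α := ℝ)])
  have hrlim : Tendsto r atTop (𝓝 0) := tendsto_one_div_add_atTop_nhds_zero_nat
  set f : ℕ → E d → ℂ := fun n x => χ (r n • x) * u x with hf
  have hχn (n : ℕ) : ContDiff ℝ ∞ fun x => χ (r n • x) :=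
    hχ.comp (contDiff_id.const_smul (r n))
  have hcore (n : ℕ) : f n ∈ core φ := by
    refine (mem_core_iff hφ).2 ⟨(hχn n).mul hu, HasCompactSupport.mul_right ?_⟩
    exact hχs.comp_homeomorph (Homeomorph.smulOfNeZero (r n) (hr0 n).ne')
  choose m1 m2 hm using fun n => mk_mem_coreGraph hφ (hcore n)
  have hgrad (n : ℕ) (x : E d) : grad (f n) x
      = χ (r n • x) • grad u x + u x • (r n : ℂ) • grad χ (r n • x) := by
    rw [hf, grad_mul ((hχn n).differentiable (by simp)) (hu.differentiable (by simp)),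
      grad_comp_smul (hχ.differentiable (by simp))]
  have hev (x : E d) : ∀ᶠ n in atTop, χ (r n • x) = 1 := by
    have : Tendsto (fun n => ‖r n • x‖) atTop (𝓝 0) := by
      simpa using (hrlim.smul_const x).norm
    filter_upwards [this.eventually_lt_const one_pos] with n hn using hχe _ hn
  refine mem_closure_of_tendsto (b := atTop) (f := fun n => ((m1 n).toLp, (m2 n).toLp))
    (Tendsto.prodMk_nhds ?_ ?_) (Eventually.of_forall hm)
  · rw [← tendsto_sub_nhds_zero_iff]
    refine tendsto_L2_zero (f := fun n => f n - u) (B := fun x => 2 * ‖u x‖) (h1.norm.const_mul 2)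
      (Eventually.of_forall fun n => ?_)
      (Eventually.of_forall fun n => Eventually.of_forall fun x => ?_)
      (Eventually.of_forall fun x => ?_)
    · exact (Lp.coeFn_sub _ _).trans ((m1 n).coeFn_toLp.sub h1.coeFn_toLp)
    · have h3 : ‖f n x‖ ≤ 1 * ‖u x‖ := by
        rw [hf, norm_mul]; gcongr; exact hχ1 _
      have h4 := norm_sub_le (f n x) (u x)
      rw [Pi.sub_apply]
      linarith
    · refine tendsto_const_nhds.congr' ?_
      filter_upwards [hev x] with n hn
      simp [hf, hn]
  · rw [← tendsto_sub_nhds_zero_iff]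
    -- The cutoffs are `χ (r_n x)` with `r_n ≤ 1`, so the product rule gives a bound independent of
    -- `n`; the term with `∇χ` carries the factor `r_n → 0`.
    refine tendsto_L2_zero (f := fun n => grad (f n) - grad u)
      (B := fun x => 2 * ‖grad u x‖ + |C| * ‖u x‖)
      ((h2.norm.const_mul 2).add (h1.norm.const_mul |C|))
      (Eventually.of_forall fun n => ?_)
      (Eventually.of_forall fun n => Eventually.of_forall fun x => ?_)
      (Eventually.of_forall fun x => ?_)
    · exact (Lp.coeFn_sub _ _).trans ((m2 n).coeFn_toLp.sub h2.coeFn_toLp)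
    · have h3 : ‖χ (r n • x) • grad u x‖ ≤ 1 * ‖grad u x‖ := by
        rw [norm_smul]; gcongr; exact hχ1 _
      have h4 : ‖u x • (r n : ℂ) • grad χ (r n • x)‖ ≤ ‖u x‖ * (1 * |C|) := by
        rw [norm_smul, norm_smul, Complex.norm_real, Real.norm_of_nonneg (hr0 n).le]
        gcongr
        · exact hr1 n
        · exact (hC _).trans (le_abs_self C)
      have h5 := norm_add_le (χ (r n • x) • grad u x) (u x • (r n : ℂ) • grad χ (r n • x))
      have h6 := norm_sub_le (grad (f n) x) (grad u x)
      rw [Pi.sub_apply]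
      rw [← hgrad] at h5
      linarith
    · have h3 : Tendsto (fun n => u x • (r n : ℂ) • grad χ (r n • x)) atTop (𝓝 0) := by
        refine squeeze_zero_norm (a := fun n => ‖u x‖ * (r n * |C|)) (fun n => ?_) ?_
        · rw [norm_smul, norm_smul, Complex.norm_real, Real.norm_of_nonneg (hr0 n).le]
          have := hr0 n
          gcongr
          exact (hC _).trans (le_abs_self C)
        · simpa using (hrlim.mul_const |C|).const_mul ‖u x‖
      refine h3.congr' ?_
      filter_upwards [hev x] with n hn
      rw [Pi.sub_apply, hgrad, hn]
      simp

/-- The sum is the trace of a bilinear form, hence independent of the basis. It lets the gradient,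
defined in standard coordinates, be computed in the eigenbasis. -/
lemma sum_mul_orthonormalBasis {ι ι' : Type*} [Fintype ι] [Fintype ι'] {V : Type*}
    [NormedAddCommGroup V] [InnerProductSpace ℝ V] (e : OrthonormalBasis ι ℝ V)
    (b : OrthonormalBasis ι' ℝ V) (A B : V →L[ℝ] ℂ) :
    ∑ i, A (e i) * B (e i) = ∑ j, A (b j) * B (b j) := by
  have h1 (i : ι) : A (e i) = ∑ j, inner ℝ (b j) (e i) • A (b j) := by
    conv_lhs => rw [← b.sum_repr' (e i), map_sum]
    simp only [map_smul]
  have h2 (j : ι') : B (b j) = ∑ i, inner ℝ (b j) (e i) • B (e i) := by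
    conv_lhs => rw [← e.sum_repr' (b j), map_sum]
    simp only [map_smul, real_inner_comm]
  simp_rw [h1, h2, Finset.sum_mul, Finset.mul_sum]
  rw [Finset.sum_comm]
  refine Finset.sum_congr rfl fun j _ => Finset.sum_congr rfl fun i _ => ?_
  rw [smul_mul_assoc, mul_smul_comm]

lemma fderiv_conj_apply {v : E d → ℂ} (hv : Differentiable ℝ v) (x y : E d) :
    fderiv ℝ (fun x => starRingEnd ℂ (v x)) x y = starRingEnd ℂ (fderiv ℝ v x y) := by
  have : HasFDerivAt (fun x => starRingEnd ℂ (v x))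
      ((Complex.conjCLE : ℂ →L[ℝ] ℂ).comp (fderiv ℝ v x)) x :=
    (Complex.conjCLE : ℂ →L[ℝ] ℂ).hasFDerivAt.comp x (hv x).hasFDerivAt
  rw [this.fderiv]
  rfl

lemma inner_grad_grad (b : OrthonormalBasis (Fin d) ℝ (E d)) {u v : E d → ℂ}
    (hv : Differentiable ℝ v) (x : E d) :
    inner ℂ (grad v x) (grad u x)
      = ∑ j, fderiv ℝ u x (b j) * fderiv ℝ (fun x => starRingEnd ℂ (v x)) x (b j) := by
  rw [← sum_mul_orthonormalBasis (EuclideanSpace.basisFun (Fin d) ℝ) b, PiLp.inner_apply]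
  refine Finset.sum_congr rfl fun i _ => ?_
  rw [fderiv_conj_apply hv]
  simp [grad]

/-- Integration by parts against a test function, in one direction. -/
lemma integral_exp_neg_mul_fderiv (hφ : ContDiff ℝ ∞ φ) {g v : E d → ℂ} (hg : ContDiff ℝ ∞ g)
    (hv : ContDiff ℝ ∞ v) (hvs : HasCompactSupport v) (e : E d) :
    ∫ x, (Real.exp (-φ x) : ℂ) * g x * fderiv ℝ v x e
      = ∫ x, (Real.exp (-φ x) : ℂ) * (-fderiv ℝ g x e + fderiv ℝ φ x e * g x) * v x := by
  have hexp : ContDiff ℝ ∞ fun x => (Real.exp (-φ x) : ℂ) :=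
    Complex.ofRealCLM.contDiff.comp (Real.contDiff_exp.comp hφ.neg)
  have hf : ContDiff ℝ ∞ fun x => (Real.exp (-φ x) : ℂ) * g x := hexp.mul hg
  have hd (x : E d) : fderiv ℝ (fun x => (Real.exp (-φ x) : ℂ) * g x) x e
      = -((Real.exp (-φ x) : ℂ) * (-fderiv ℝ g x e + fderiv ℝ φ x e * g x)) := by
    have h1 : HasFDerivAt (fun x => (Real.exp (-φ x) : ℂ))
        (Complex.ofRealCLM.comp (Real.exp (-φ x) • -fderiv ℝ φ x)) x :=
      Complex.ofRealCLM.hasFDerivAt.comp x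
        ((hφ.differentiable (by simp) x).hasFDerivAt.neg.exp)
    rw [(h1.fun_mul (hg.differentiable (by simp) x).hasFDerivAt).fderiv]
    simp
    ring
  have hc {F : E d → ℂ} (h : Continuous F) (hs : HasCompactSupport F) : Integrable F :=
    h.integrable_of_hasCompactSupport hs
  have hdf := hf.continuous_fderiv (by simp)
  have hdv := hv.continuous_fderiv (by simp)
  have hcf := hf.continuous
  have hcv := hv.continuous
  rw [integral_mul_fderiv_eq_neg_fderiv_mul_of_integrable, ← integral_neg]
  · refine integral_congr_ae (Eventually.of_forall fun x => ?_)
    simp only [hd]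
    ring
  · exact hc (by fun_prop) hvs.mul_left
  · exact hc (by fun_prop) (HasCompactSupport.mul_left (hvs.fderiv_apply (𝕜 := ℝ) e))
  · exact hc (by fun_prop) hvs.mul_left
  · exact fun x _ => hf.differentiable (by simp) x
  · exact fun x _ => hv.differentiable (by simp) x

/-- A smooth function `u` such that `u`, its gradient and `w = -Δu + ∇φ·∇u` are in `L²(μ)` is in
the domain of the Ornstein-Uhlenbeck operator, which maps it to `w`. -/
lemma mk_mem_ouGraph (hφ : ContDiff ℝ ∞ φ) (b : OrthonormalBasis (Fin d) ℝ (E d)) {u w : E d → ℂ}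
    (hu : ContDiff ℝ ∞ u) (h1 : MemLp u 2 (mu φ)) (h2 : MemLp (grad u) 2 (mu φ))
    (h3 : MemLp w 2 (mu φ))
    (hw : ∀ x, w x = ∑ j, (-fderiv ℝ (fun y => fderiv ℝ u y (b j)) x (b j)
      + fderiv ℝ φ x (b j) * fderiv ℝ u x (b j))) :
    (h1.toLp, h3.toLp) ∈ ouGraph φ := by
  refine ⟨h2.toLp, mem_closure_coreGraph hφ hu h1 h2, ?_⟩
  rintro p ⟨v, hv, hpv, hpg⟩
  obtain ⟨hv1, hvs⟩ := (mem_core_iff hφ).1 hv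
  have hconj : ContDiff ℝ ∞ fun x => starRingEnd ℂ (v x) :=
    (Complex.conjCLE : ℂ →L[ℝ] ℂ).contDiff.comp hv1
  have hconjs : HasCompactSupport fun x => starRingEnd ℂ (v x) :=
    hvs.comp_left (map_zero _)
  have hDu (j : Fin d) : ContDiff ℝ ∞ fun y => fderiv ℝ u y (b j) :=
    (hu.fderiv_right (m := ∞) (by simp)).clm_apply contDiff_const
  rw [L2.inner_def, L2.inner_def]
  have e1 : ∫ x, inner ℂ (p.2 x) ((h2.toLp (grad u)) x) ∂(mu φ)
      = ∫ x, inner ℂ (grad v x) (grad u x) ∂(mu φ) := by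
    refine integral_congr_ae ?_
    filter_upwards [hpg, h2.coeFn_toLp] with x hx1 hx2
    rw [hx1, hx2]
  have e2 : ∫ x, inner ℂ (p.1 x) ((h3.toLp w) x) ∂(mu φ) = ∫ x, inner ℂ (v x) (w x) ∂(mu φ) := by
    refine integral_congr_ae ?_
    filter_upwards [hpv, h3.coeFn_toLp] with x hx1 hx2
    rw [hx1, hx2]
  rw [e1, e2, integral_mu hφ.continuous, integral_mu hφ.continuous]
  have hexp : Continuous fun x => (Real.exp (-φ x) : ℂ) :=
    Complex.continuous_ofReal.comp (Real.continuous_exp.comp hφ.continuous.neg)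
  have hcv := hconj.continuous
  have hdv := hconj.continuous_fderiv (by simp)
  have hdφ := hφ.continuous_fderiv (by simp)
  calc _ = ∫ x, ∑ j, (Real.exp (-φ x) : ℂ) * fderiv ℝ u x (b j)
          * fderiv ℝ (fun x => starRingEnd ℂ (v x)) x (b j) := by
        refine integral_congr_ae (Eventually.of_forall fun x => ?_)
        simp only [inner_grad_grad b (hv1.differentiable (by simp)), Complex.real_smul,
          Finset.mul_sum, mul_assoc]
    _ = ∑ j, ∫ x, (Real.exp (-φ x) : ℂ) * fderiv ℝ u x (b j)
          * fderiv ℝ (fun x => starRingEnd ℂ (v x)) x (b j) := by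
        refine integral_finsetSum _ fun j _ => ?_
        have := (hDu j).continuous
        exact Continuous.integrable_of_hasCompactSupport (by fun_prop)
          (HasCompactSupport.mul_left (hconjs.fderiv_apply (𝕜 := ℝ) (b j)))
    _ = ∑ j, ∫ x, (Real.exp (-φ x) : ℂ) * (-fderiv ℝ (fun y => fderiv ℝ u y (b j)) x (b j)
          + fderiv ℝ φ x (b j) * fderiv ℝ u x (b j)) * starRingEnd ℂ (v x) :=
        Finset.sum_congr rfl fun j _ => integral_exp_neg_mul_fderiv hφ (hDu j) hconj hconjs (b j)
    _ = ∫ x, ∑ j, (Real.exp (-φ x) : ℂ) * (-fderiv ℝ (fun y => fderiv ℝ u y (b j)) x (b j)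
          + fderiv ℝ φ x (b j) * fderiv ℝ u x (b j)) * starRingEnd ℂ (v x) := by
        refine (integral_finsetSum _ fun j _ => ?_).symm
        have := (hDu j).continuous
        have := (hDu j).continuous_fderiv (by simp)
        exact Continuous.integrable_of_hasCompactSupport (by fun_prop) hconjs.mul_left
    _ = _ := by
        refine integral_congr_ae (Eventually.of_forall fun x => ?_)
        simp only [hw, RCLike.inner_apply, Complex.real_smul, Finset.sum_mul, Finset.mul_sum,
          mul_assoc]

end Smooth

/-! ### Differentiable curves in `L²` -/

section Curve

variable {α : Type*} [MeasurableSpace α] {μ : Measure α}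

open Classical in
/-- The class of a function in `L²(μ)`, and zero if the function is not square integrable. -/
def toL2 (μ : Measure α) (f : α → ℂ) : Lp ℂ 2 μ := if h : MemLp f 2 μ then h.toLp f else 0

lemma toL2_eq {f : α → ℂ} (h : MemLp f 2 μ) : toL2 μ f = h.toLp f := dif_pos h

lemma coeFn_toL2 {f : α → ℂ} (h : MemLp f 2 μ) : toL2 μ f =ᵐ[μ] f := by
  rw [toL2_eq h]; exact h.coeFn_toLp

/-- A curve of functions whose pointwise derivatives are dominated in `L²` is differentiable. -/
lemma toL2_curve {f f' : ℝ → α → ℂ} {B : α → ℝ} {T : ℝ} (hB : MemLp B 2 μ)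
    (hf : ∀ s ∈ Icc 0 T, MemLp (f s) 2 μ) (hf' : ∀ s ∈ Icc 0 T, MemLp (f' s) 2 μ)
    (hd : ∀ s ∈ Icc 0 T, ∀ a, HasDerivAt (fun s => f s a) (f' s a) s)
    (hle : ∀ s ∈ Icc 0 T, ∀ a, ‖f' s a‖ ≤ B a) :
    ContinuousOn (fun s => toL2 μ (f s)) (Icc 0 T) ∧
    ∀ s ∈ Ico 0 T, HasDerivWithinAt (fun s => toL2 μ (f s)) (toL2 μ (f' s)) (Ici s) s := by
  -- The mean value inequality makes `B` dominate all difference quotients, which is what dominated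
  -- convergence needs.
  have hlip (s) (hs : s ∈ Icc 0 T) (t) (ht : t ∈ Icc 0 T) (a : α) :
      ‖f t a - f s a‖ ≤ B a * |t - s| :=
    Convex.norm_image_sub_le_of_norm_hasDerivWithin_le (𝕜 := ℝ)
      (fun x hx => (hd x hx a).hasDerivWithinAt) (fun x hx => hle x hx a) (convex_Icc 0 T) hs ht
  constructor
  · intro s hs
    rw [ContinuousWithinAt, ← tendsto_sub_nhds_zero_iff]
    refine tendsto_L2_zero (f := fun t => f t - f s) (B := fun a => B a * |T|)
      (hB.mul_const |T|) ?_ ?_ (Eventually.of_forall fun a => ?_)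
    · filter_upwards [self_mem_nhdsWithin] with t ht
      exact (Lp.coeFn_sub _ _).trans ((coeFn_toL2 (hf t ht)).sub (coeFn_toL2 (hf s hs)))
    · filter_upwards [self_mem_nhdsWithin] with t ht
      refine Eventually.of_forall fun a => (hlip s hs t ht a).trans ?_
      have hBa : 0 ≤ B a := (norm_nonneg _).trans (hle s hs a)
      obtain ⟨h1, h2⟩ := hs
      obtain ⟨h3, h4⟩ := ht
      exact mul_le_mul_of_nonneg_left (abs_le_abs (by linarith) (by linarith)) hBa
    · have h1 := (hd s hs a).continuousAt.tendsto.mono_left (nhdsWithin_le_nhds (s := Icc 0 T))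
      exact tendsto_sub_nhds_zero_iff.2 h1
  · intro s hs
    have hs' : s ∈ Icc 0 T := ⟨hs.1, hs.2.le⟩
    rw [hasDerivWithinAt_iff_tendsto_slope, Ici_sdiff_left, ← tendsto_sub_nhds_zero_iff]
    have hmem : ∀ᶠ t in 𝓝[>] s, t ∈ Ioc s T := Ioc_mem_nhdsGT hs.2
    refine tendsto_L2_zero (f := fun t a => (t - s)⁻¹ • (f t a - f s a) - f' s a)
      (B := fun a => B a * 2) (hB.mul_const 2) ?_ ?_ (Eventually.of_forall fun a => ?_)
    · filter_upwards [hmem] with t ht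
      have ht' : t ∈ Icc 0 T := ⟨hs.1.trans ht.1.le, ht.2⟩
      rw [slope_def_module]
      filter_upwards [Lp.coeFn_sub ((t - s)⁻¹ • (toL2 μ (f t) - toL2 μ (f s))) (toL2 μ (f' s)),
        Lp.coeFn_smul (t - s)⁻¹ (toL2 μ (f t) - toL2 μ (f s)),
        Lp.coeFn_sub (toL2 μ (f t)) (toL2 μ (f s)), coeFn_toL2 (hf t ht'), coeFn_toL2 (hf s hs'),
        coeFn_toL2 (hf' s hs')] with a h1 h2 h3 h4 h5 h6
      rw [h1, Pi.sub_apply, h2, Pi.smul_apply, h3, Pi.sub_apply, h4, h5, h6]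
    · filter_upwards [hmem] with t ht
      have ht' : t ∈ Icc 0 T := ⟨hs.1.trans ht.1.le, ht.2⟩
      have hts : 0 < t - s := sub_pos.2 ht.1
      refine Eventually.of_forall fun a => (norm_sub_le _ _).trans ?_
      have h1 : ‖(t - s)⁻¹ • (f t a - f s a)‖ ≤ B a := by
        rw [norm_smul, Real.norm_of_nonneg (by positivity), inv_mul_le_iff₀ hts, mul_comm]
        have := hlip s hs' t ht' a
        rwa [abs_of_pos hts] at this
      linarith [hle s hs' a]
    · have h1 := (hd s hs' a).hasDerivWithinAt (s := Ici s)
      rw [hasDerivWithinAt_iff_tendsto_slope, Ici_sdiff_left] at h1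
      have h2 := tendsto_sub_nhds_zero_iff.2 h1
      refine h2.congr fun t => ?_
      rw [slope_def_module]

end Curve

/-! ### Diagonal quadratic potentials -/

section Diagonal

variable {d : ℕ} (b : OrthonormalBasis (Fin d) ℝ (E d)) (n l : Fin d → ℝ)

/-- The potential `∑ n_j y_j² + l_j y_j` in the coordinates of the basis `b`. -/
def diagPotential (y : E d) : ℝ := ∑ j, (n j * inner ℝ (b j) y ^ 2 + l j * inner ℝ (b j) y)

lemma contDiff_diagPotential : ContDiff ℝ ∞ (diagPotential b n l) := by
  unfold diagPotential
  refine ContDiff.sum fun j _ => ?_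
  have h : ContDiff ℝ ∞ fun y : E d => inner ℝ (b j) y := (innerSL ℝ (b j)).contDiff
  fun_prop

lemma fderiv_diagPotential (y : E d) (k : Fin d) :
    fderiv ℝ (diagPotential b n l) y (b k) = 2 * n k * inner ℝ (b k) y + l k := by
  have h (j : Fin d) : HasFDerivAt (fun y : E d => n j * inner ℝ (b j) y ^ 2 + l j * inner ℝ (b j) y)
      ((2 * n j * inner ℝ (b j) y + l j) • innerSL ℝ (b j)) y := by
    have h1 : HasFDerivAt (fun y : E d => inner ℝ (b j) y) (innerSL ℝ (b j)) y :=
      (innerSL ℝ (b j)).hasFDerivAt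
    refine (((h1.pow 2).const_mul (n j)).add (h1.const_mul (l j))).congr_fderiv ?_
    ext v
    simp
    ring
  have h2 := HasFDerivAt.fun_sum (u := Finset.univ) fun j _ => h j
  rw [show diagPotential b n l = fun y => ∑ j, (n j * inner ℝ (b j) y ^ 2 + l j * inner ℝ (b j) y)
    from rfl, h2.fderiv]
  simp [b.inner_eq_ite]

lemma sum_coord_sq (y : E d) : ∑ j, inner ℝ (b j) y ^ 2 = ‖y‖ ^ 2 := by
  rw [← b.sum_sq_norm_inner_right y]
  simp

lemma abs_coord_le (y : E d) (j : Fin d) : |inner ℝ (b j) y| ≤ ‖y‖ := by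
  have := abs_real_inner_le_norm (b j) y
  simpa using this

variable {n} in
-- Only the linear part of the potential can make the density grow, and then at most exponentially.
-- Gaussians thus lie in `L²(μ)` even where the quadratic form degenerates.
lemma neg_diagPotential_le (hn : ∀ j, 0 ≤ n j) (y : E d) :
    -diagPotential b n l y ≤ (∑ j, |l j|) * ‖y‖ := by
  rw [diagPotential, ← Finset.sum_neg_distrib, Finset.sum_mul]
  refine Finset.sum_le_sum fun j _ => ?_
  have h1 := abs_coord_le b y j
  have h2 := mul_nonneg (hn j) (sq_nonneg (inner ℝ (b j) y))
  have h3 := neg_abs_le (l j * inner ℝ (b j) y)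
  rw [abs_mul] at h3
  have h4 : |l j| * |inner ℝ (b j) y| ≤ |l j| * ‖y‖ := by gcongr
  linarith

lemma integrable_exp_neg_mul_sq_norm {δ : ℝ} (hδ : 0 < δ) :
    Integrable fun y : E d => Real.exp (-δ * ‖y‖ ^ 2) := by
  refine Integrable.of_integral_ne_zero ?_
  rw [GaussianFourier.integral_rexp_neg_mul_sq_norm hδ]
  positivity

variable {n} in
lemma memLp_gaussian (hn : ∀ j, 0 ≤ n j) {δ : ℝ} (hδ : 0 < δ) (C : ℝ) :
    MemLp (fun y : E d => C * Real.exp (-δ * ‖y‖ ^ 2)) 2 (mu (diagPotential b n l)) := by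
  have hφ := (contDiff_diagPotential b n l).continuous
  refine MemLp.const_mul ?_ C
  have hc : Continuous fun y : E d => Real.exp (-δ * ‖y‖ ^ 2) := by fun_prop
  rw [memLp_two_iff_integrable_sq hc.aestronglyMeasurable, integrable_mu hφ]
  set Λ := ∑ j, |l j|
  -- Squaring gives decay `2δ‖y‖²`; half of it absorbs `Λ‖y‖` through `Λ‖y‖ ≤ Λ²/(4δ) + δ‖y‖²`.
  refine Integrable.mono' ((integrable_exp_neg_mul_sq_norm hδ).const_mul
    (Real.exp (Λ ^ 2 / (4 * δ)))) (by fun_prop) (Eventually.of_forall fun y => ?_)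
  rw [Real.norm_of_nonneg (by positivity), smul_eq_mul, ← Real.exp_nat_mul, ← Real.exp_add,
    ← Real.exp_add]
  refine Real.exp_le_exp.2 ?_
  have h1 := neg_diagPotential_le b l hn y
  have h2 : Λ * ‖y‖ ≤ Λ ^ 2 / (4 * δ) + δ * ‖y‖ ^ 2 := by
    have : Λ ^ 2 / (4 * δ) + δ * ‖y‖ ^ 2 - Λ * ‖y‖ = (Λ - 2 * δ * ‖y‖) ^ 2 / (4 * δ) := by
      field_simp; ring
    have h3 : 0 ≤ (Λ - 2 * δ * ‖y‖) ^ 2 / (4 * δ) := by positivity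
    linarith
  push_cast
  linarith

lemma mul_exp_neg_le {δ : ℝ} (hδ : 0 < δ) (s : ℝ) :
    (1 + s) ^ 2 * Real.exp (-δ * s ^ 2) ≤ (2 + 4 / δ) * Real.exp (-(δ / 2) * s ^ 2) := by
  have h1 : Real.exp (-δ * s ^ 2) = Real.exp (-(δ / 2) * s ^ 2) * Real.exp (-(δ / 2 * s ^ 2)) := by
    rw [← Real.exp_add]; ring_nf
  have h2 : s ^ 2 * Real.exp (-(δ / 2 * s ^ 2)) ≤ 2 / δ := by
    rw [Real.exp_neg, ← div_eq_mul_inv, div_le_div_iff₀ (Real.exp_pos _) hδ]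
    nlinarith [Real.add_one_le_exp (δ / 2 * s ^ 2)]
  have h3 : Real.exp (-(δ / 2 * s ^ 2)) ≤ 1 := Real.exp_le_one_iff.2 (by nlinarith [sq_nonneg s])
  have h4 : (1 + s) ^ 2 ≤ 2 + 2 * s ^ 2 := by nlinarith [sq_nonneg (1 - s)]
  have h5 := Real.exp_pos (-(δ / 2 * s ^ 2))
  have h6 : (1 + s) ^ 2 * Real.exp (-(δ / 2 * s ^ 2)) ≤ 2 + 4 / δ := by
    have : (4 : ℝ) / δ = 2 * (2 / δ) := by ring
    nlinarith
  rw [h1]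
  have h7 := Real.exp_pos (-(δ / 2) * s ^ 2)
  nlinarith

/-- The exponential of a sum of functions of the coordinates. -/
def expSum (F : Fin d → ℝ → ℂ) (y : E d) : ℂ := Complex.exp (∑ j, F j (inner ℝ (b j) y))

lemma hasFDerivAt_coord {F : ℝ → ℂ} {F' : ℂ} {y : E d} (j : Fin d)
    (h : HasDerivAt F F' (inner ℝ (b j) y)) :
    HasFDerivAt (fun y : E d => F (inner ℝ (b j) y)) ((innerSL ℝ (b j)).smulRight F') y := by
  have h1 : HasFDerivAt (fun y : E d => inner ℝ (b j) y) (innerSL ℝ (b j)) y :=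
    (innerSL ℝ (b j)).hasFDerivAt
  refine (h.hasFDerivAt.comp y h1).congr_fderiv ?_
  ext v
  simp

lemma hasFDerivAt_expSum {F F' : Fin d → ℝ → ℂ} (h : ∀ j s, HasDerivAt (F j) (F' j s) s) (y : E d) :
    HasFDerivAt (expSum b F) (expSum b F y •
      ∑ j, (innerSL ℝ (b j)).smulRight (F' j (inner ℝ (b j) y))) y :=
  (HasFDerivAt.fun_sum fun j _ => hasFDerivAt_coord b j (h j _)).cexp

lemma fderiv_expSum {F F' : Fin d → ℝ → ℂ} (h : ∀ j s, HasDerivAt (F j) (F' j s) s) (y : E d)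
    (k : Fin d) : fderiv ℝ (expSum b F) y (b k) = F' k (inner ℝ (b k) y) * expSum b F y := by
  rw [(hasFDerivAt_expSum b h y).fderiv]
  simp [b.inner_eq_ite, mul_comm]

lemma fderiv_fderiv_expSum {F F' F'' : Fin d → ℝ → ℂ} (h : ∀ j s, HasDerivAt (F j) (F' j s) s)
    (h' : ∀ j s, HasDerivAt (F' j) (F'' j s) s) (y : E d) (k : Fin d) :
    fderiv ℝ (fun y => fderiv ℝ (expSum b F) y (b k)) y (b k)
      = (F'' k (inner ℝ (b k) y) + F' k (inner ℝ (b k) y) ^ 2) * expSum b F y := by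
  have h1 : (fun y => fderiv ℝ (expSum b F) y (b k))
      = fun y => F' k (inner ℝ (b k) y) * expSum b F y := by
    ext y; exact fderiv_expSum b h y k
  have h2 := (hasFDerivAt_coord b k (h' k (inner ℝ (b k) y))).fun_mul (hasFDerivAt_expSum b h y)
  rw [h1, h2.fderiv]
  simp [b.inner_eq_ite]
  ring

lemma contDiff_expSum {F : Fin d → ℝ → ℂ} (h : ∀ j, ContDiff ℝ ∞ (F j)) :
    ContDiff ℝ ∞ (expSum b F) := by
  unfold expSum
  refine ContDiff.cexp (ContDiff.sum fun j _ => ?_)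
  exact (h j).comp (innerSL ℝ (b j)).contDiff

lemma norm_grad_le {u : E d → ℂ} (hu : Differentiable ℝ u) (x : E d) :
    ‖grad u x‖ ≤ ∑ j, ‖fderiv ℝ u x (b j)‖ := by
  refine abs_le_of_sq_le_sq' ?_ (by positivity) |>.2
  refine le_trans ?_ (Finset.sum_sq_le_sq_sum_of_nonneg fun _ _ => norm_nonneg _)
  have h1 : inner ℂ (grad u x) (grad u x) = ((‖grad u x‖ ^ 2 : ℝ) : ℂ) := by
    rw [inner_self_eq_norm_sq_to_K]; simp
  rw [inner_grad_grad b hu] at h1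
  have h2 : ((‖grad u x‖ ^ 2 : ℝ) : ℂ) = ((∑ j, ‖fderiv ℝ u x (b j)‖ ^ 2 : ℝ) : ℂ) := by
    rw [← h1]
    push_cast
    refine Finset.sum_congr rfl fun j _ => ?_
    rw [fderiv_conj_apply hu, Complex.mul_conj, Complex.normSq_eq_norm_sq]
    push_cast
    rfl
  exact (Complex.ofReal_injective h2).le

end Diagonal

/-! ### Gaussian solutions of the Ornstein-Uhlenbeck equation -/

/-- The integral of `exp(-n s)` over `[0, t]`. -/
def relax (n t : ℝ) : ℝ := if n = 0 then t else (1 - Real.exp (-(n * t))) / n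

lemma hasDerivAt_relax (n t : ℝ) : HasDerivAt (relax n) (Real.exp (-(n * t))) t := by
  unfold relax
  split_ifs with h
  · rw [h, zero_mul, neg_zero, Real.exp_zero]
    exact hasDerivAt_id t
  · have h1 : HasDerivAt (fun t => (1 - Real.exp (-(n * t))) / n)
        (-(Real.exp (-(n * t)) * -(n * 1)) / n) t :=
      ((((hasDerivAt_id t).const_mul n).neg.exp).const_sub 1).div_const n
    convert h1 using 1
    field_simp

lemma relax_nonneg {n t : ℝ} (hn : 0 ≤ n) (ht : 0 ≤ t) : 0 ≤ relax n t := by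
  unfold relax
  split_ifs with h
  · exact ht
  · have : Real.exp (-(n * t)) ≤ 1 := Real.exp_le_one_iff.2 (by nlinarith)
    exact div_nonneg (by linarith) hn

lemma relax_pos {n t : ℝ} (hn : 0 ≤ n) (ht : 0 < t) : 0 < relax n t := by
  unfold relax
  split_ifs with h
  · exact ht
  · have hn' : 0 < n := lt_of_le_of_ne hn (Ne.symm h)
    have : Real.exp (-(n * t)) < 1 := Real.exp_lt_one_iff.2 (by nlinarith [mul_pos hn' ht])
    exact div_pos (by linarith) hn'

lemma relax_le {n t : ℝ} (hn : 0 ≤ n) : relax n t ≤ t := by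
  unfold relax
  split_ifs with h
  · exact le_rfl
  · have hn' : 0 < n := lt_of_le_of_ne hn (Ne.symm h)
    rw [div_le_iff₀ hn']
    linarith [Real.add_one_le_exp (-(n * t))]

lemma relax_zero (n : ℝ) : relax n 0 = 0 := by simp [relax]

/-- The variance at time `t` of the solution which starts with variance one. -/
def spread (n t : ℝ) : ℝ := 1 + 2 * relax (4 * n) t

/-- The characteristic through the space point `s` at time `t`, shifted by `iβ`. -/
def charPoint (n l β t s : ℝ) : ℂ :=
  ((Real.exp (-(2 * n * t)) * s - l * relax (2 * n) t : ℝ) : ℂ) - Complex.I * β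

/-- The exponent of the Gaussian solution. -/
def theta (n l β t s : ℝ) : ℂ :=
  ((-(Real.log (spread n t) / 2) : ℝ) : ℂ) - charPoint n l β t s ^ 2 / (2 * (spread n t : ℝ))

/-- The space derivative of the exponent. -/
def thetaDeriv (n l β t s : ℝ) : ℂ :=
  -(charPoint n l β t s * (Real.exp (-(2 * n * t)) : ℝ) / (spread n t : ℝ))

/-- The second space derivative of the exponent. -/
def thetaDeriv2 (n t : ℝ) : ℂ := ((-(Real.exp (-(2 * n * t)) ^ 2 / spread n t) : ℝ) : ℂ)

lemma one_le_spread {n t : ℝ} (hn : 0 ≤ n) (ht : 0 ≤ t) : 1 ≤ spread n t := by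
  have := relax_nonneg (n := 4 * n) (by positivity) ht
  unfold spread; linarith

lemma hasDerivAt_charPoint (n l β t s : ℝ) :
    HasDerivAt (charPoint n l β t) (Real.exp (-(2 * n * t)) : ℝ) s := by
  have h : HasDerivAt (fun s => Real.exp (-(2 * n * t)) * s - l * relax (2 * n) t)
      (Real.exp (-(2 * n * t))) s := by
    simpa using ((hasDerivAt_id s).const_mul (Real.exp (-(2 * n * t)))).sub_const
      (l * relax (2 * n) t)
  exact h.ofReal_comp.sub_const (Complex.I * β)

lemma hasDerivAt_theta {n t : ℝ} (hn : 0 ≤ n) (ht : 0 ≤ t) (l β s : ℝ) :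
    HasDerivAt (theta n l β t) (thetaDeriv n l β t s) s := by
  have hσ : ((spread n t : ℝ) : ℂ) ≠ 0 := by
    have := one_le_spread hn ht
    exact_mod_cast (by linarith : spread n t ≠ 0)
  have h := (((hasDerivAt_charPoint n l β t s).pow 2).div_const (2 * (spread n t : ℝ))).const_sub
    ((-(Real.log (spread n t) / 2) : ℝ) : ℂ)
  refine h.congr_deriv ?_
  unfold thetaDeriv
  field_simp
  simp

lemma hasDerivAt_thetaDeriv (n l β t s : ℝ) :
    HasDerivAt (thetaDeriv n l β t) (thetaDeriv2 n t) s := by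
  have h := (((hasDerivAt_charPoint n l β t s).mul_const
    ((Real.exp (-(2 * n * t)) : ℝ) : ℂ)).div_const ((spread n t : ℝ) : ℂ)).neg
  refine h.congr_deriv ?_
  unfold thetaDeriv2
  push_cast
  ring

/-- Writing `z` for `charPoint` and `σ` for `spread`, one has `∂_t z = -(2ns + l) ∂_s z` and `∂_t σ
= 2 (∂_s z)²`: the drift transports `z` and the diffusion increases `σ`. Therefore `exp θ` solves
`∂_t v = v'' - (ns² + ls)' v'`. -/
lemma hasDerivAt_theta_time {n t : ℝ} (hn : 0 ≤ n) (ht : 0 ≤ t) (l β s : ℝ) :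
    HasDerivAt (fun t => theta n l β t s)
      (thetaDeriv2 n t + thetaDeriv n l β t s ^ 2 - (2 * n * s + l) * thetaDeriv n l β t s) t := by
  have hσ := one_le_spread hn ht
  have hσ' : ((spread n t : ℝ) : ℂ) ≠ 0 := by exact_mod_cast (by linarith : spread n t ≠ 0)
  have hp : HasDerivAt (fun t => Real.exp (-(2 * n * t)))
      (Real.exp (-(2 * n * t)) * -(2 * n)) t := by
    simpa using (((hasDerivAt_id t).const_mul (2 * n)).neg).exp
  have hs : HasDerivAt (spread n) (2 * Real.exp (-(2 * n * t)) ^ 2) t := by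
    refine (((hasDerivAt_relax (4 * n) t).const_mul 2).const_add 1).congr_deriv ?_
    rw [← Real.exp_nat_mul]
    congr 2
    push_cast
    ring
  have hz : HasDerivAt (fun t => charPoint n l β t s)
      ((Real.exp (-(2 * n * t)) * -(2 * n) * s - l * Real.exp (-(2 * n * t)) : ℝ) : ℂ) t :=
    (((hp.mul_const s).sub ((hasDerivAt_relax (2 * n) t).const_mul l)).ofReal_comp).sub_const _
  have hlog := ((hs.log (by linarith)).div_const 2).neg.ofReal_comp
  have h2 := hlog.sub ((hz.pow 2).div (hs.ofReal_comp.const_mul 2) (by simpa using hσ'))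
  refine h2.congr_deriv ?_
  simp only [Pi.pow_apply, thetaDeriv, thetaDeriv2]
  push_cast
  field_simp
  ring

lemma contDiff_theta (n l β t : ℝ) : ContDiff ℝ ∞ (theta n l β t) := by
  have h1 : ContDiff ℝ ∞ (charPoint n l β t) := by
    have : ContDiff ℝ ∞ fun s : ℝ => Real.exp (-(2 * n * t)) * s - l * relax (2 * n) t := by
      fun_prop
    exact (Complex.ofRealCLM.contDiff.comp this).sub contDiff_const
  exact contDiff_const.sub ((h1.pow 2).div_const _)

lemma norm_charPoint_le {n t T : ℝ} (hn : 0 ≤ n) (ht : t ∈ Icc 0 T) (l β s : ℝ) :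
    ‖charPoint n l β t s‖ ≤ |s| + |l| * T + |β| := by
  have h1 : |Real.exp (-(2 * n * t)) * s| ≤ 1 * |s| := by
    rw [abs_mul, abs_of_pos (Real.exp_pos _)]
    gcongr
    exact Real.exp_le_one_iff.2 (by have := mul_nonneg hn ht.1; linarith)
  have h2 : |l * relax (2 * n) t| ≤ |l| * T := by
    rw [abs_mul, abs_of_nonneg (relax_nonneg (by positivity) ht.1)]
    gcongr
    exact (relax_le (by positivity)).trans ht.2
  have h3 := abs_sub (Real.exp (-(2 * n * t)) * s) (l * relax (2 * n) t)
  unfold charPoint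
  refine (norm_sub_le _ _).trans ?_
  rw [Complex.norm_real, Real.norm_eq_abs, norm_mul, Complex.norm_I, Complex.norm_real,
    Real.norm_eq_abs]
  linarith

lemma norm_thetaDeriv_le {n t T : ℝ} (hn : 0 ≤ n) (ht : t ∈ Icc 0 T) (l β s : ℝ) :
    ‖thetaDeriv n l β t s‖ ≤ |s| + |l| * T + |β| := by
  have h1 := norm_charPoint_le hn ht l β s
  have hσ := one_le_spread hn ht.1
  have hp : Real.exp (-(2 * n * t)) ≤ 1 :=
    Real.exp_le_one_iff.2 (by have := mul_nonneg hn ht.1; linarith)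
  rw [thetaDeriv, norm_neg, norm_div, norm_mul, Complex.norm_real, Complex.norm_real,
    Real.norm_of_nonneg (Real.exp_pos _).le,
    Real.norm_of_nonneg (zero_le_one.trans hσ)]
  calc _ ≤ ‖charPoint n l β t s‖ * Real.exp (-(2 * n * t)) :=
        div_le_self (by positivity) hσ
    _ ≤ ‖charPoint n l β t s‖ * 1 := by gcongr
    _ ≤ _ := by linarith

lemma norm_thetaDeriv2_le {n t : ℝ} (hn : 0 ≤ n) (ht : 0 ≤ t) : ‖thetaDeriv2 n t‖ ≤ 1 := by
  have hσ := one_le_spread hn ht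
  have hp : Real.exp (-(2 * n * t)) ≤ 1 :=
    Real.exp_le_one_iff.2 (by have := mul_nonneg hn ht; linarith)
  rw [thetaDeriv2, Complex.norm_real, norm_neg, Real.norm_of_nonneg (by positivity)]
  refine (div_le_self (by positivity) hσ).trans (pow_le_one₀ (Real.exp_pos _).le hp)

/-- The bound is uniform over `t ∈ [0, T]`: `spread` stays between `1` and `1 + 2T`, and `(ps - m)²
≥ (ps)²/2 - m²` isolates the decay from the displacement of the centre. The parameter `nmax`
provides one decay rate for all coordinates. -/
lemma re_theta_le {n nmax t T : ℝ} (hn : 0 ≤ n) (hnm : n ≤ nmax) (ht : t ∈ Icc 0 T) (l β s : ℝ) :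
    (theta n l β t s).re ≤ (β ^ 2 + (l * T) ^ 2) / 2
      - Real.exp (-(4 * nmax * T)) / (4 * (1 + 2 * T)) * s ^ 2 := by
  have hσ := one_le_spread hn ht.1
  have hT : 0 ≤ T := ht.1.trans ht.2
  set p := Real.exp (-(2 * n * t)) with hp
  set m := l * relax (2 * n) t with hm
  have h1 : (charPoint n l β t s ^ 2 / (2 * (spread n t : ℝ))).re
      = ((p * s - m) ^ 2 - β ^ 2) / (2 * spread n t) := by
    rw [show (2 * ((spread n t : ℝ) : ℂ)) = ((2 * spread n t : ℝ) : ℂ) by push_cast; ring,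
      Complex.div_ofReal_re, pow_two, Complex.mul_re]
    simp [charPoint, ← hp, ← hm]
    ring
  have h2 : (theta n l β t s).re
      = -(Real.log (spread n t) / 2) - ((p * s - m) ^ 2 - β ^ 2) / (2 * spread n t) := by
    rw [theta, Complex.sub_re, h1, Complex.ofReal_re]
  have h3 : 0 ≤ Real.log (spread n t) := Real.log_nonneg hσ
  have h4 : (p * s) ^ 2 / 2 - m ^ 2 ≤ (p * s - m) ^ 2 := by nlinarith [sq_nonneg (p * s - 2 * m)]
  have h5 : m ^ 2 ≤ (l * T) ^ 2 := by
    rw [hm, mul_pow, mul_pow]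
    have := relax_nonneg (n := 2 * n) (by positivity) ht.1
    have := (relax_le (n := 2 * n) (t := t) (by positivity)).trans ht.2
    gcongr
  have h6 : Real.exp (-(4 * nmax * T)) / (4 * (1 + 2 * T)) * s ^ 2
      ≤ (p * s) ^ 2 / (4 * spread n t) := by
    have h7 : Real.exp (-(4 * nmax * T)) ≤ p ^ 2 := by
      rw [hp, ← Real.exp_nat_mul]
      apply Real.exp_le_exp.2
      push_cast
      have : n * t ≤ nmax * T := mul_le_mul hnm ht.2 ht.1 (hn.trans hnm)
      linarith
    have h8 : spread n t ≤ 1 + 2 * T := by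
      unfold spread
      linarith [(relax_le (n := 4 * n) (t := t) (by positivity)).trans ht.2]
    rw [mul_pow, mul_div_right_comm]
    gcongr
  have h9 : ((p * s - m) ^ 2 - β ^ 2) / (2 * spread n t)
      ≥ (p * s) ^ 2 / (4 * spread n t) - (m ^ 2 + β ^ 2) / 2 := by
    have e1 : ((p * s - m) ^ 2 - β ^ 2) / (2 * spread n t)
        ≥ ((p * s) ^ 2 / 2 - m ^ 2 - β ^ 2) / (2 * spread n t) := by gcongr
    have e2 : ((p * s) ^ 2 / 2 - m ^ 2 - β ^ 2) / (2 * spread n t)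
        = (p * s) ^ 2 / (4 * spread n t) - (m ^ 2 + β ^ 2) / 2 / spread n t := by
      field_simp; ring
    have e3 : (m ^ 2 + β ^ 2) / 2 / spread n t ≤ (m ^ 2 + β ^ 2) / 2 :=
      div_le_self (by positivity) hσ
    linarith
  rw [h2]
  linarith

/-! ### Gaussian solutions in several variables and their uniform bounds. -/

section Solution

variable {d : ℕ} (b : OrthonormalBasis (Fin d) ℝ (E d)) (n l : Fin d → ℝ)

/-- The Gaussian solution with initial value `exp(-∑ (y_j - iβ_j)²/2)`. -/
def gaussSol (β : Fin d → ℝ) (t : ℝ) : E d → ℂ :=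
  expSum b fun j => theta (n j) (l j) (β j) t

/-- The Ornstein-Uhlenbeck operator, applied to the Gaussian solution. -/
def gaussSolOU (β : Fin d → ℝ) (t : ℝ) (y : E d) : ℂ :=
  -(∑ j, (thetaDeriv2 (n j) t + thetaDeriv (n j) (l j) (β j) t (inner ℝ (b j) y) ^ 2
    - (2 * n j * (inner ℝ (b j) y : ℝ) + l j)
      * thetaDeriv (n j) (l j) (β j) t (inner ℝ (b j) y))) * gaussSol b n l β t y

lemma contDiff_gaussSol (β : Fin d → ℝ) (t : ℝ) : ContDiff ℝ ∞ (gaussSol b n l β t) :=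
  contDiff_expSum b fun j => contDiff_theta (n j) (l j) (β j) t

variable {n}

/-- The gradient and the image under the operator are at most quadratic polynomials times the
solution, so one Gaussian dominates all three on `[0, T]`. It serves both for membership in `L²(μ)`
and for differentiability of the curve. -/
lemma gaussSol_bounds (hn : ∀ j, 0 ≤ n j) (β : Fin d → ℝ) {T : ℝ} (hT : 0 ≤ T) : ∃ C δ : ℝ, 0 < δ ∧
    ∀ t ∈ Icc 0 T, ∀ y, ‖gaussSol b n l β t y‖ ≤ C * Real.exp (-δ * ‖y‖ ^ 2) ∧
      ‖grad (gaussSol b n l β t) y‖ ≤ C * Real.exp (-δ * ‖y‖ ^ 2) ∧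
      ‖gaussSolOU b n l β t y‖ ≤ C * Real.exp (-δ * ‖y‖ ^ 2) := by
  set δ := Real.exp (-(4 * (∑ j, n j) * T)) / (4 * (1 + 2 * T)) with hδ
  have hδ0 : 0 < δ := by positivity
  set C₀ := Real.exp (∑ j, (β j ^ 2 + (l j * T) ^ 2) / 2)
  -- Chosen so that `thetaDeriv` and the drift `2 n_j s + l_j` are both at most `A (1 + ‖y‖)` in
  -- every coordinate.
  set A := 1 + ∑ j, (|l j| * T + |β j| + 2 * n j + |l j|) with hA
  have hA1 (j : Fin d) : 1 + |l j| * T + |β j| + 2 * n j + |l j| ≤ A := by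
    have := Finset.single_le_sum (f := fun j => |l j| * T + |β j| + 2 * n j + |l j|)
      (fun j _ => by have := hn j; positivity) (Finset.mem_univ j)
    linarith
  have hA0 : 1 ≤ A := by
    have : 0 ≤ ∑ j, (|l j| * T + |β j| + 2 * n j + |l j|) :=
      Finset.sum_nonneg fun j _ => by have := hn j; positivity
    linarith
  have hu (t) (ht : t ∈ Icc 0 T) (y : E d) :
      ‖gaussSol b n l β t y‖ ≤ C₀ * Real.exp (-δ * ‖y‖ ^ 2) := by
    rw [gaussSol, expSum, Complex.norm_exp, ← Real.exp_add, Complex.re_sum, ← sum_coord_sq b,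
      Finset.mul_sum, ← Finset.sum_add_distrib]
    refine Real.exp_le_exp.2 (Finset.sum_le_sum fun j _ => ?_)
    have := re_theta_le (hn j) (Finset.single_le_sum (fun j _ => hn j) (Finset.mem_univ j)) ht
      (l j) (β j) (inner ℝ (b j) y)
    linarith
  have hθ (t) (ht : t ∈ Icc 0 T) (y : E d) (j : Fin d) :
      ‖thetaDeriv (n j) (l j) (β j) t (inner ℝ (b j) y)‖ ≤ A * (1 + ‖y‖) := by
    have h1 := norm_thetaDeriv_le (hn j) ht (l j) (β j) (inner ℝ (b j) y)
    have h2 := abs_coord_le b y j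
    have h3 := hA1 j
    have h4 := hn j
    have h5 := norm_nonneg y
    have h6 := abs_nonneg (l j)
    nlinarith
  -- Each coordinate contributes three terms, namely `θ''`, `(θ')²` and drift times `θ'`, each
  -- bounded by `(A (1 + ‖y‖))²`.
  set K := ∑ _j : Fin d, 3 * A ^ 2
  have hK0 : 0 ≤ K := by positivity
  have hw (t) (ht : t ∈ Icc 0 T) (y : E d) :
      ‖gaussSolOU b n l β t y‖ ≤ K * (1 + ‖y‖) ^ 2 * (C₀ * Real.exp (-δ * ‖y‖ ^ 2)) := by
    rw [gaussSolOU, norm_mul, norm_neg]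
    refine mul_le_mul ?_ (hu t ht y) (norm_nonneg _) (by positivity)
    refine (norm_sum_le _ _).trans ?_
    rw [Finset.sum_mul]
    refine Finset.sum_le_sum fun j _ => ?_
    have h0 := norm_nonneg y
    have h1 := hθ t ht y j
    have h2 := norm_thetaDeriv2_le (hn j) ht.1
    have h3 : ‖2 * (n j : ℂ) * (inner ℝ (b j) y : ℝ) + l j‖ ≤ A * (1 + ‖y‖) := by
      have e : 2 * (n j : ℂ) * (inner ℝ (b j) y : ℝ) + l j
          = ((2 * n j * inner ℝ (b j) y + l j : ℝ) : ℂ) := by push_cast; ring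
      rw [e, Complex.norm_real, Real.norm_eq_abs]
      refine (abs_add_le _ _).trans ?_
      rw [abs_mul, abs_of_nonneg (a := 2 * n j) (by have := hn j; positivity)]
      have h4 := hA1 j
      have h5 := abs_coord_le b y j
      have h6 : 2 * n j * |inner ℝ (b j) y| ≤ 2 * n j * ‖y‖ := by have := hn j; gcongr
      have h7 : 2 * n j + |l j| ≤ A := by
        have : 0 ≤ |l j| * T := by positivity
        linarith [abs_nonneg (β j)]
      have h8 : 2 * n j ≤ A := by linarith [abs_nonneg (l j)]
      have h9 : 2 * n j * ‖y‖ ≤ A * ‖y‖ := by gcongr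
      have h10 : |l j| ≤ A := by linarith [hn j]
      linarith
    have h4 : ‖thetaDeriv (n j) (l j) (β j) t (inner ℝ (b j) y)‖ ^ 2 ≤ (A * (1 + ‖y‖)) ^ 2 := by
      gcongr
    have h5 : ‖(2 * (n j : ℂ) * (inner ℝ (b j) y : ℝ) + l j)
        * thetaDeriv (n j) (l j) (β j) t (inner ℝ (b j) y)‖ ≤ (A * (1 + ‖y‖)) ^ 2 := by
      rw [norm_mul, pow_two]
      exact mul_le_mul h3 h1 (norm_nonneg _) (by positivity)
    have h6 : 1 ≤ (A * (1 + ‖y‖)) ^ 2 := one_le_pow₀ (by nlinarith)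
    refine (norm_sub_le _ _).trans ((add_le_add_left (norm_add_le _ _) _).trans ?_)
    rw [norm_pow]
    nlinarith
  have hg (t) (ht : t ∈ Icc 0 T) (y : E d) : ‖grad (gaussSol b n l β t) y‖
      ≤ K * (1 + ‖y‖) ^ 2 * (C₀ * Real.exp (-δ * ‖y‖ ^ 2)) := by
    have hs : Differentiable ℝ (gaussSol b n l β t) :=
      (contDiff_gaussSol b n l β t).differentiable (by simp)
    refine (norm_grad_le b hs y).trans ?_
    simp only [K]
    rw [Finset.sum_mul, Finset.sum_mul]
    refine Finset.sum_le_sum fun j _ => ?_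
    rw [gaussSol, fderiv_expSum b (fun j s => hasDerivAt_theta (hn j) ht.1 (l j) (β j) s), norm_mul]
    refine mul_le_mul ((hθ t ht y j).trans ?_) (hu t ht y) (norm_nonneg _) (by positivity)
    have h0 := norm_nonneg y
    have h1 : 1 ≤ A * (1 + ‖y‖) := by nlinarith
    nlinarith
  have hC (y : E d) : (1 + ‖y‖) ^ 2 * Real.exp (-δ * ‖y‖ ^ 2)
      ≤ (2 + 4 / δ) * Real.exp (-(δ / 2) * ‖y‖ ^ 2) := mul_exp_neg_le hδ0 ‖y‖
  have hC' (y : E d) : K * (1 + ‖y‖) ^ 2 * (C₀ * Real.exp (-δ * ‖y‖ ^ 2))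
      ≤ (C₀ + K * C₀ * (2 + 4 / δ)) * Real.exp (-(δ / 2) * ‖y‖ ^ 2) := by
    calc _ = K * C₀ * ((1 + ‖y‖) ^ 2 * Real.exp (-δ * ‖y‖ ^ 2)) := by ring
      _ ≤ K * C₀ * ((2 + 4 / δ) * Real.exp (-(δ / 2) * ‖y‖ ^ 2)) := mul_le_mul_of_nonneg_left (hC y) (by positivity)
      _ ≤ C₀ * Real.exp (-(δ / 2) * ‖y‖ ^ 2)
          + K * C₀ * ((2 + 4 / δ) * Real.exp (-(δ / 2) * ‖y‖ ^ 2)) :=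
        le_add_of_nonneg_left (by positivity)
      _ = _ := by ring
  refine ⟨C₀ + K * C₀ * (2 + 4 / δ), δ / 2, by positivity, fun t ht y => ⟨?_, ?_, ?_⟩⟩
  · refine (hu t ht y).trans ?_
    have : Real.exp (-δ * ‖y‖ ^ 2) ≤ Real.exp (-(δ / 2) * ‖y‖ ^ 2) :=
      Real.exp_le_exp.2 (by nlinarith [sq_nonneg ‖y‖])
    gcongr
    exact le_add_of_nonneg_right (by positivity)
  · exact (hg t ht y).trans (hC' y)
  · exact (hw t ht y).trans (hC' y)

lemma continuous_gaussSolOU (β : Fin d → ℝ) (t : ℝ) : Continuous (gaussSolOU b n l β t) := by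
  have h1 : Continuous (gaussSol b n l β t) :=
    (contDiff_gaussSol b n l β t).continuous
  have h2 (j : Fin d) : Continuous (thetaDeriv (n j) (l j) (β j) t) :=
    continuous_iff_continuousAt.2 fun s => (hasDerivAt_thetaDeriv _ _ _ _ s).continuousAt
  unfold gaussSolOU
  refine ((continuous_finsetSum _ fun j _ => ?_).neg).mul h1
  have h3 := (h2 j).comp (by fun_prop : Continuous fun y : E d => inner ℝ (b j) y)
  simp only [Function.comp_def] at h3
  fun_prop

/-- The semigroup maps Gaussian initial values to Gaussian solutions. -/
theorem semigroup_gaussSol (hn : ∀ j, 0 ≤ n j) (β : Fin d → ℝ)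
    {S : ℝ≥0 → L2 (diagPotential b n l) →L[ℂ] L2 (diagPotential b n l)}
    (hS : IsOUSemigroup (diagPotential b n l) S) (T : ℝ≥0) :
    ∃ (h0 : MemLp (gaussSol b n l β 0) 2 (mu (diagPotential b n l)))
      (hT : MemLp (gaussSol b n l β T) 2 (mu (diagPotential b n l))),
      S T h0.toLp = hT.toLp := by
  have hφ := contDiff_diagPotential b n l
  obtain ⟨C, δ, hδ, hbd⟩ := gaussSol_bounds b l hn β T.2
  have hB := memLp_gaussian b l hn hδ C
  have hsm (t : ℝ) : ContDiff ℝ ∞ (gaussSol b n l β t) :=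
    contDiff_gaussSol b n l β t
  have m1 (t : ℝ) (ht : t ∈ Icc (0 : ℝ) T) :
      MemLp (gaussSol b n l β t) 2 (mu (diagPotential b n l)) :=
    hB.mono' (hsm t).continuous.aestronglyMeasurable
      (Eventually.of_forall fun y => (hbd t ht y).1)
  have m2 (t : ℝ) (ht : t ∈ Icc (0 : ℝ) T) :
      MemLp (grad (gaussSol b n l β t)) 2 (mu (diagPotential b n l)) :=
    hB.mono' (ContDiff.continuous_grad (hsm t)).aestronglyMeasurable
      (Eventually.of_forall fun y => (hbd t ht y).2.1)
  have m3 (t : ℝ) (ht : t ∈ Icc (0 : ℝ) T) :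
      MemLp (gaussSolOU b n l β t) 2 (mu (diagPotential b n l)) :=
    hB.mono' (continuous_gaussSolOU b l β t).aestronglyMeasurable
      (Eventually.of_forall fun y => (hbd t ht y).2.2)
  have htime (t : ℝ) (ht : t ∈ Icc (0 : ℝ) T) (y : E d) :
      HasDerivAt (fun t => gaussSol b n l β t y) ((-gaussSolOU b n l β t) y) t := by
    have h1 := (HasDerivAt.fun_sum (u := Finset.univ) fun j _ =>
      hasDerivAt_theta_time (hn j) ht.1 (l j) (β j) (inner ℝ (b j) y)).cexp
    refine h1.congr_deriv ?_
    simp only [Pi.neg_apply, gaussSolOU, gaussSol, expSum]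
    ring
  obtain ⟨hc, hd⟩ := toL2_curve (T := T) (f := fun t => gaussSol b n l β t)
    (f' := fun t => -gaussSolOU b n l β t) hB m1 (fun t ht => (m3 t ht).neg) htime
    (fun t ht y => by simpa using (hbd t ht y).2.2)
  obtain ⟨hS0, hgen⟩ := (isOUSemigroup_iff hφ S).1 hS
  have h0 : (0 : ℝ) ∈ Icc (0 : ℝ) T := ⟨le_rfl, T.2⟩
  have hT : (T : ℝ) ∈ Icc (0 : ℝ) T := ⟨T.2, le_rfl⟩
  refine ⟨m1 0 h0, m1 T hT, ?_⟩
  have key := (isResolvent_ouResolvent hφ).semigroup_apply_eq hS0 hgen (T := T)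
    (u := fun t => toL2 (mu (diagPotential b n l)) (gaussSol b n l β t))
    (w := fun t => toL2 (mu (diagPotential b n l)) (gaussSolOU b n l β t)) hc
    (fun s hs => ?_) (fun s hs => ?_)
  · simpa only [toL2_eq (m1 0 h0), toL2_eq (m1 T hT)] using key
  · have hs' : s ∈ Icc (0 : ℝ) T := ⟨hs.1, hs.2.le⟩
    have := hd s hs
    rw [toL2_eq (m3 s hs').neg, MemLp.toLp_neg] at this
    rwa [toL2_eq (m3 s hs')]
  · rw [← mem_ouGraph_iff hφ, toL2_eq (m1 s hs), toL2_eq (m3 s hs)]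
    refine mk_mem_ouGraph hφ b (hsm s) (m1 s hs) (m2 s hs) (m3 s hs) fun y => ?_
    have e1 := fun j s' => hasDerivAt_theta (hn j) hs.1 (l j) (β j) s'
    have e2 := fun j s' => hasDerivAt_thetaDeriv (n j) (l j) (β j) s s'
    simp only [gaussSol, fderiv_fderiv_expSum b e1 e2, fderiv_diagPotential, gaussSolOU]
    simp only [fderiv_expSum b e1]
    rw [neg_mul, Finset.sum_mul, ← Finset.sum_neg_distrib]
    refine Finset.sum_congr rfl fun j _ => ?_
    push_cast
    ring

end Solution

/-! ### Integration in orthonormal coordinates -/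

section Coordinates

variable {d : ℕ} (b : OrthonormalBasis (Fin d) ℝ (E d))

lemma measurePreserving_coord :
    MeasurePreserving (fun (x : E d) (j : Fin d) => inner ℝ (b j) x) volume volume := by
  have h := (PiLp.volume_preserving_ofLp (Fin d)).comp b.measurePreserving_repr
  have e : (fun (x : E d) (j : Fin d) => inner ℝ (b j) x) = WithLp.ofLp ∘ b.repr := by
    funext x j
    simp [b.repr_apply_apply]
  rwa [e]

lemma measurableEmbedding_coord :
    MeasurableEmbedding (fun (x : E d) (j : Fin d) => inner ℝ (b j) x) := by
  have h := (MeasurableEquiv.toLp 2 (Fin d → ℝ)).symm.measurableEmbedding.comp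
    b.repr.toHomeomorph.measurableEmbedding
  convert h using 1
  ext x j
  simp [b.repr_apply_apply]

lemma integral_prod_coord (f : Fin d → ℝ → ℂ) :
    ∫ x : E d, ∏ j, f j (inner ℝ (b j) x) = ∏ j, ∫ s, f j s := by
  rw [← integral_fintype_prod_volume_eq_prod f]
  exact (measurePreserving_coord b).integral_comp (measurableEmbedding_coord b)
    (fun x => ∏ j, f j (x j))

lemma integrable_prod_coord {f : Fin d → ℝ → ℂ} (hf : ∀ j, Integrable (f j)) :
    Integrable fun x : E d => ∏ j, f j (inner ℝ (b j) x) :=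
  ((measurePreserving_coord b).integrable_comp_emb (measurableEmbedding_coord b)).2
    (Integrable.fintype_prod hf)

end Coordinates

/-! ### The Mehler kernel -/

/-- The transition density of the one-dimensional Ornstein-Uhlenbeck process. -/
def mehlerKernel (n l t y x : ℝ) : ℝ :=
  (√(2 * Real.pi * (2 * relax (4 * n) t)))⁻¹ *
    Real.exp (-(x - (Real.exp (-(2 * n * t)) * y - l * relax (2 * n) t)) ^ 2
      / (2 * (2 * relax (4 * n) t)))

lemma gauss_kernel_mul {v : ℝ} (hv : 0 < v) (q β x : ℝ) :
    (((√(2 * Real.pi * v))⁻¹ * Real.exp (-(x - q) ^ 2 / (2 * v)) : ℝ) : ℂ)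
      * Complex.exp (-((x - Complex.I * β) ^ 2 / 2))
    = ((√(2 * Real.pi * v))⁻¹ : ℝ) * Complex.exp (((-((1 + v) / (2 * v)) : ℝ) : ℂ) * x ^ 2
      + (q / v + Complex.I * β) * x + (-(q ^ 2 / (2 * v)) + β ^ 2 / 2)) := by
  have hv' : (v : ℂ) ≠ 0 := by exact_mod_cast hv.ne'
  rw [Complex.ofReal_mul, mul_assoc, Complex.ofReal_exp, ← Complex.exp_add]
  congr 2
  push_cast
  have hI := Complex.I_sq
  field_simp
  linear_combination (-(v : ℂ) * β ^ 2) * hI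

lemma integrable_gauss_kernel_mul {v : ℝ} (hv : 0 < v) (q β : ℝ) :
    Integrable fun x : ℝ => (((√(2 * Real.pi * v))⁻¹ * Real.exp (-(x - q) ^ 2 / (2 * v)) : ℝ) : ℂ)
      * Complex.exp (-((x - Complex.I * β) ^ 2 / 2)) := by
  simp_rw [gauss_kernel_mul hv]
  refine Integrable.const_mul ?_ _
  refine integrable_cexp_quadratic' ?_ _ _
  rw [Complex.ofReal_re]
  have : 0 < (1 + v) / (2 * v) := by positivity
  linarith

/-- A Gaussian of variance `v` convolved with one of variance `1` has variance `1 + v`, also at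
complex centres. For `v = 2 * relax (4 * n) t` this is `spread n t`, so the result is `theta` at
time `t`. -/
lemma integral_gauss_kernel_mul {v : ℝ} (hv : 0 < v) (q β : ℝ) :
    ∫ x : ℝ, (((√(2 * Real.pi * v))⁻¹ * Real.exp (-(x - q) ^ 2 / (2 * v)) : ℝ) : ℂ)
      * Complex.exp (-((x - Complex.I * β) ^ 2 / 2))
    = Complex.exp (((-(Real.log (1 + v) / 2) : ℝ) : ℂ)
      - ((q : ℂ) - Complex.I * β) ^ 2 / (2 * (1 + v : ℝ))) := by
  have hv' : (v : ℂ) ≠ 0 := by exact_mod_cast hv.ne'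
  have hv1 : (1 + v : ℂ) ≠ 0 := by exact_mod_cast (by positivity : (1 + v : ℝ) ≠ 0)
  have hpos : 0 < (1 + v) / (2 * v) := by positivity
  simp_rw [gauss_kernel_mul hv]
  rw [integral_const_mul, integral_cexp_quadratic (by rw [Complex.ofReal_re]; linarith), ← mul_assoc,
    sub_eq_add_neg ((-(Real.log (1 + v) / 2) : ℝ) : ℂ), Complex.exp_add]
  congr 1
  · have h1 : ((Real.pi : ℂ) / -((-((1 + v) / (2 * v)) : ℝ) : ℂ))
        = ((2 * Real.pi * v / (1 + v) : ℝ) : ℂ) := by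
      push_cast
      field_simp
    have h2 : ((1 : ℂ) / 2) = ((1 / 2 : ℝ) : ℂ) := by push_cast; rfl
    rw [h1, h2, ← Complex.ofReal_cpow (by positivity), ← Complex.ofReal_exp, ← Complex.ofReal_mul]
    congr 1
    rw [← Real.sqrt_eq_rpow, Real.sqrt_div (by positivity), Real.exp_neg, Real.exp_half,
      Real.exp_log (by positivity)]
    have : √(2 * Real.pi * v) ≠ 0 := by positivity
    field_simp
  · congr 1
    have hI := Complex.I_sq
    push_cast
    field_simp
    linear_combination (4 * (v : ℂ) * β ^ 2 + 4 * (v : ℂ) ^ 2 * β ^ 2) * hI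

lemma theta_zero (n l β s : ℝ) : theta n l β 0 s = -((s - Complex.I * β) ^ 2 / 2) := by
  simp [theta, charPoint, spread, relax_zero]

lemma integrable_mehlerKernel_mul {n t : ℝ} (hn : 0 ≤ n) (ht : 0 < t) (l β y : ℝ) :
    Integrable fun x : ℝ => (mehlerKernel n l t y x : ℂ) * Complex.exp (theta n l β 0 x) := by
  have hv : 0 < 2 * relax (4 * n) t := by
    have := relax_pos (n := 4 * n) (by positivity) ht
    positivity
  simp_rw [theta_zero]
  exact integrable_gauss_kernel_mul hv (Real.exp (-(2 * n * t)) * y - l * relax (2 * n) t) β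

lemma integral_mehlerKernel_mul {n t : ℝ} (hn : 0 ≤ n) (ht : 0 < t) (l β y : ℝ) :
    ∫ x : ℝ, (mehlerKernel n l t y x : ℂ) * Complex.exp (theta n l β 0 x)
      = Complex.exp (theta n l β t y) := by
  have hv : 0 < 2 * relax (4 * n) t := by
    have := relax_pos (n := 4 * n) (by positivity) ht
    positivity
  simp_rw [theta_zero]
  exact integral_gauss_kernel_mul hv (Real.exp (-(2 * n * t)) * y - l * relax (2 * n) t) β

/-! ### The Mehler kernel in several variables and its action on Gaussians. -/

section Kernel

variable {d : ℕ} (b : OrthonormalBasis (Fin d) ℝ (E d)) (n l : Fin d → ℝ)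

/-- The transition density of the Ornstein-Uhlenbeck process. -/
def mehler (t : ℝ) (y x : E d) : ℝ :=
  ∏ j, mehlerKernel (n j) (l j) t (inner ℝ (b j) y) (inner ℝ (b j) x)

lemma mehler_nonneg (t : ℝ) (y x : E d) : 0 ≤ mehler b n l t y x :=
  Finset.prod_nonneg fun j _ => by unfold mehlerKernel; positivity

lemma continuous_mehler (t : ℝ) {X : Type*} [TopologicalSpace X] {f g : X → E d}
    (hf : Continuous f) (hg : Continuous g) : Continuous fun x => mehler b n l t (f x) (g x) := by
  unfold mehler mehlerKernel
  fun_prop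

variable {n}

lemma mehler_mul_gaussSol (β : Fin d → ℝ) (t : ℝ) (y x : E d) :
    (mehler b n l t y x : ℂ) * gaussSol b n l β 0 x
      = ∏ j, ((mehlerKernel (n j) (l j) t (inner ℝ (b j) y) (inner ℝ (b j) x) : ℂ)
        * Complex.exp (theta (n j) (l j) (β j) 0 (inner ℝ (b j) x))) := by
  rw [Finset.prod_mul_distrib, mehler, gaussSol, expSum, Complex.exp_sum, Complex.ofReal_prod]

lemma integrable_mehler_mul_gaussSol (hn : ∀ j, 0 ≤ n j) (β : Fin d → ℝ) {t : ℝ} (ht : 0 < t)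
    (y : E d) : Integrable fun x => (mehler b n l t y x : ℂ) * gaussSol b n l β 0 x := by
  simp_rw [mehler_mul_gaussSol]
  exact integrable_prod_coord b (f := fun j s =>
    (mehlerKernel (n j) (l j) t (inner ℝ (b j) y) s : ℂ)
        * Complex.exp (theta (n j) (l j) (β j) 0 s))
    fun j => integrable_mehlerKernel_mul (hn j) ht (l j) (β j) _

lemma integral_mehler_mul_gaussSol (hn : ∀ j, 0 ≤ n j) (β : Fin d → ℝ) {t : ℝ} (ht : 0 < t)
    (y : E d) : ∫ x, (mehler b n l t y x : ℂ) * gaussSol b n l β 0 x = gaussSol b n l β t y := by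
  simp_rw [mehler_mul_gaussSol]
  rw [integral_prod_coord b (f := fun j s =>
    (mehlerKernel (n j) (l j) t (inner ℝ (b j) y) s : ℂ)
        * Complex.exp (theta (n j) (l j) (β j) 0 s)), gaussSol, expSum, Complex.exp_sum]
  exact Finset.prod_congr rfl fun j _ => integral_mehlerKernel_mul (hn j) ht _ _ _

end Kernel

/-! ### The Weyl form of the Mehler kernel -/

lemma tanhDiv_pos {n t : ℝ} (hn : 0 ≤ n) (ht : 0 < t) : 0 < tanhDiv t n := by
  unfold tanhDiv
  split_ifs with h
  · exact ht
  · have hn' : 0 < n := lt_of_le_of_ne hn (Ne.symm h)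
    exact div_pos (by rw [Real.tanh_eq_sinh_div_cosh]; exact div_pos (Real.sinh_pos_iff.2
      (by positivity)) (Real.cosh_pos _)) hn'

/-- The eigenvalue of `cosh(tN)⁻¹ exp(tN)`. -/
def expDivCosh (t n : ℝ) : ℝ := (Real.cosh (t * n))⁻¹ * Real.exp (t * n)

lemma expDivCosh_pos (t n : ℝ) : 0 < expDivCosh t n := by
  have := Real.cosh_pos (t * n)
  have := Real.exp_pos (t * n)
  unfold expDivCosh
  positivity

/-- For `n ≠ 0` these are rational identities in `exp(tn)`. They translate the decay factor, drift
and variance of the process into the parameter `ν = tanh(tn)/n` of the symbol. -/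
lemma tanhDiv_identities (t n : ℝ) :
    1 + tanhDiv t n * n = expDivCosh t n ∧
    1 - tanhDiv t n * n = expDivCosh t n * Real.exp (-(2 * n * t)) ∧
    tanhDiv t n = expDivCosh t n * relax (2 * n) t ∧
    2 * relax (4 * n) t * expDivCosh t n ^ 2 = 2 * tanhDiv t n := by
  rcases eq_or_ne n 0 with rfl | hn
  · simp [tanhDiv, expDivCosh, relax]
  · have h2 : (2 : ℝ) * n ≠ 0 := by positivity
    have h4 : (4 : ℝ) * n ≠ 0 := by positivity
    have he := Real.exp_pos (t * n)
    have hc : Real.cosh (t * n) = (Real.exp (t * n) + (Real.exp (t * n))⁻¹) / 2 := by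
      rw [Real.cosh_eq, Real.exp_neg]
    have hs : Real.sinh (t * n) = (Real.exp (t * n) - (Real.exp (t * n))⁻¹) / 2 := by
      rw [Real.sinh_eq, Real.exp_neg]
    have e2 : Real.exp (-(2 * n * t)) = ((Real.exp (t * n))⁻¹) ^ 2 := by
      rw [← Real.exp_neg, ← Real.exp_nat_mul]; push_cast; ring_nf
    have e4 : Real.exp (-(4 * n * t)) = ((Real.exp (t * n))⁻¹) ^ 4 := by
      rw [← Real.exp_neg, ← Real.exp_nat_mul]; push_cast; ring_nf
    simp only [tanhDiv, if_neg hn, expDivCosh, relax, if_neg h2, if_neg h4, Real.tanh_eq_sinh_div_cosh,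
      hc, hs, e2, e4]
    generalize Real.exp (t * n) = e at he
    have h5 : e + e⁻¹ ≠ 0 := by positivity
    have h6 : e ^ 2 + 1 ≠ 0 := by positivity
    refine ⟨?_, ?_, ?_, ?_⟩ <;> field_simp <;> ring

/-- Multiply numerator and denominator by `κ²`, where `κ = expDivCosh t n`. The identities turn the
linear form into `(x - y) + 2νa` with `a = n(x + y)/2 + l/2`, and the denominator into `4ν`. In the
expanded square the cross term `-(x - y)a` is half the difference of the potentials at `y` and at
`x`. -/
lemma weyl_exponent {n t : ℝ} (hn : 0 ≤ n) (ht : 0 < t) (l y x : ℝ) :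
    -(x - (Real.exp (-(2 * n * t)) * y - l * relax (2 * n) t)) ^ 2 / (2 * (2 * relax (4 * n) t))
      = -(tanhDiv t n * (n * (x + y) / 2 + l / 2) ^ 2) - (x - y) ^ 2 / (4 * tanhDiv t n)
        + ((n * y ^ 2 + l * y) - (n * x ^ 2 + l * x)) / 2 := by
  obtain ⟨h1, h2, h3, h4⟩ := tanhDiv_identities t n
  have hν := tanhDiv_pos hn ht
  have hκ := expDivCosh_pos t n
  have hv := relax_pos (n := 4 * n) (by positivity) ht
  set ν := tanhDiv t n
  set κ := expDivCosh t n
  set p := Real.exp (-(2 * n * t))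
  set r := relax (2 * n) t
  set w := relax (4 * n) t
  have e1 : -(x - (p * y - l * r)) ^ 2 / (2 * (2 * w))
      = -(κ * x - (κ * p * y - l * (κ * r))) ^ 2 / (2 * (2 * w * κ ^ 2)) := by
    field_simp
  rw [e1, h4, ← h2, ← h3, ← h1]
  field_simp
  ring

lemma weyl_prefactor {n t : ℝ} (hn : 0 ≤ n) (ht : 0 < t) :
    (√(2 * Real.pi * (2 * relax (4 * n) t)))⁻¹
      = expDivCosh t n * (√(2 * Real.pi * (2 * tanhDiv t n)))⁻¹ := by
  obtain ⟨-, -, -, h4⟩ := tanhDiv_identities t n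
  have hκ := expDivCosh_pos t n
  have hv := relax_pos (n := 4 * n) (by positivity) ht
  rw [← h4, ← mul_assoc (2 * Real.pi) (2 * relax (4 * n) t),
    Real.sqrt_mul (x := 2 * Real.pi * (2 * relax (4 * n) t)) (by positivity), Real.sqrt_sq hκ.le]
  have : √(2 * Real.pi * (2 * relax (4 * n) t)) ≠ 0 := by positivity
  field_simp

lemma mehlerKernel_eq {n t : ℝ} (hn : 0 ≤ n) (ht : 0 < t) (l y x : ℝ) :
    mehlerKernel n l t y x = expDivCosh t n * (√(2 * Real.pi * (2 * tanhDiv t n)))⁻¹ *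
      Real.exp (-(tanhDiv t n * (n * (x + y) / 2 + l / 2) ^ 2)
        - (x - y) ^ 2 / (4 * tanhDiv t n)
        + ((n * y ^ 2 + l * y) - (n * x ^ 2 + l * x)) / 2) := by
  rw [mehlerKernel, weyl_exponent hn ht, weyl_prefactor hn ht]

/-- Detailed balance: in the Weyl form the only part not symmetric in `x` and `y` is `exp((φ(y) -
φ(x))/2)`, which the densities correct. -/
lemma mehlerKernel_symm {n t : ℝ} (hn : 0 ≤ n) (ht : 0 < t) (l y x : ℝ) :
    mehlerKernel n l t y x * Real.exp (-(n * y ^ 2 + l * y))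
      = mehlerKernel n l t x y * Real.exp (-(n * x ^ 2 + l * x)) := by
  rw [mehlerKernel_eq hn ht, mehlerKernel_eq hn ht, mul_assoc, mul_assoc (_ * _) (Real.exp _),
    ← Real.exp_add, ← Real.exp_add]
  ring_nf

lemma mehler_symm {d : ℕ} (b : OrthonormalBasis (Fin d) ℝ (E d)) {n : Fin d → ℝ} (l : Fin d → ℝ)
    (hn : ∀ j, 0 ≤ n j) {t : ℝ} (ht : 0 < t) (y x : E d) :
    mehler b n l t y x * Real.exp (-diagPotential b n l y)
      = mehler b n l t x y * Real.exp (-diagPotential b n l x) := by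
  simp only [mehler, diagPotential, ← Finset.sum_neg_distrib, Real.exp_sum,
    ← Finset.prod_mul_distrib]
  exact Finset.prod_congr rfl fun j _ => mehlerKernel_symm (hn j) ht _ _ _

/-! ### Uniqueness of Fourier transforms -/

section Uniqueness

variable {d : ℕ}

lemma ae_eq_zero_of_integral_schwartz {h : E d → ℂ} (hi : Integrable h)
    (h0 : ∀ ψ : 𝓢(E d, ℂ), ∫ x, h x * ψ x = 0) : h =ᵐ[volume] 0 := by
  refine ae_eq_zero_of_integral_contDiff_smul_eq_zero hi.locallyIntegrable fun g hg hgs => ?_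
  have hs : HasCompactSupport fun x => (g x : ℂ) :=
    hgs.comp_left (g := fun r : ℝ => (r : ℂ)) Complex.ofReal_zero
  have := h0 (hs.toSchwartzMap (Complex.ofRealCLM.contDiff.comp hg))
  rw [← this]
  refine integral_congr_ae (Eventually.of_forall fun x => ?_)
  change g x • h x = h x * (g x : ℂ)
  rw [Complex.real_smul, mul_comm]

lemma ae_eq_zero_of_integral_char {h : E d → ℂ} (hi : Integrable h)
    (h0 : ∀ β : E d, ∫ y, h y * Complex.exp (-Complex.I * (inner ℝ β y : ℝ)) = 0) :
    h =ᵐ[volume] 0 := by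
  refine ae_eq_zero_of_integral_schwartz hi fun ψ => ?_
  have hF (w : E d) : FourierTransform.fourier h w = 0 := by
    -- The factor `2π` passes between the two normalisations of the character. Every Schwartz
    -- function is a Fourier transform, so the multiplication formula then finishes.
    rw [Real.fourier_eq', ← h0 ((2 * Real.pi) • w)]
    refine integral_congr_ae (Eventually.of_forall fun y => ?_)
    simp only [smul_eq_mul, mul_comm (h y), inner_smul_left, real_inner_comm w y]
    congr 2
    simp only [conj_trivial]
    push_cast
    ring
  set χ : 𝓢(E d, ℂ) := FourierTransformInv.fourierInv ψ with hχ
  have hψ : ψ = FourierTransform.fourier χ := by rw [hχ, FourierTransform.fourier_fourierInv_eq]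
  have key := VectorFourier.integral_fourierIntegral_smul_eq_flip (L := innerₗ (E d))
    Real.continuous_fourierChar continuous_inner χ.integrable hi (μ := volume) (ν := volume)
  have e1 (x : E d) : ψ x = VectorFourier.fourierIntegral Real.fourierChar volume (innerₗ (E d)) χ x
      := by
    rw [hψ, SchwartzMap.fourier_coe]; rfl
  have e2 (x : E d) : VectorFourier.fourierIntegral Real.fourierChar volume (innerₗ (E d)).flip h x
      = 0 := by
    rw [flip_innerₗ]; exact hF x
  simp_rw [← e1, e2, smul_zero, integral_zero] at key
  rw [← key]
  refine integral_congr_ae (Eventually.of_forall fun x => ?_)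
  simp [mul_comm]

end Uniqueness

/-! ### The semigroup on the core -/

section Core

variable {d : ℕ} (b : OrthonormalBasis (Fin d) ℝ (E d)) {n : Fin d → ℝ} (l : Fin d → ℝ)

-- Pairing with the initial Gaussian of parameter `β` is therefore, up to a constant, the Fourier
-- transform at `β` of the function times `exp(-‖y‖²/2)`.
variable (n) in
lemma conj_gaussSol_zero (β y : E d) :
    starRingEnd ℂ (gaussSol b n l (fun j => inner ℝ (b j) β) 0 y)
      = ((Real.exp (‖β‖ ^ 2 / 2) * Real.exp (-(‖y‖ ^ 2 / 2)) : ℝ) : ℂ)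
        * Complex.exp (-Complex.I * (inner ℝ β y : ℝ)) := by
  rw [← Real.exp_add, Complex.ofReal_exp, ← Complex.exp_add, gaussSol, expSum, ← Complex.exp_conj]
  congr 1
  rw [← sum_coord_sq b, ← sum_coord_sq b, ← b.sum_inner_mul_inner β y, map_sum]
  push_cast
  rw [Finset.sum_div, Finset.sum_div, Finset.mul_sum, ← Finset.sum_neg_distrib,
    ← Finset.sum_add_distrib, ← Finset.sum_add_distrib]
  refine Finset.sum_congr rfl fun j _ => ?_
  rw [theta_zero, real_inner_comm β (b j)]
  simp only [map_neg, map_div₀, map_pow, map_sub, map_mul, Complex.conj_ofReal, Complex.conj_I,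
    map_ofNat]
  linear_combination (-(((inner ℝ β (b j) : ℝ) : ℂ) ^ 2) / 2) * Complex.I_sq

variable (n) in
lemma gaussSol_zero_zero (y : E d) :
    gaussSol b n l (fun _ => 0) 0 y = (Real.exp (-(‖y‖ ^ 2 / 2)) : ℝ) := by
  have h := congrArg (starRingEnd ℂ) (conj_gaussSol_zero b n l 0 y)
  rw [Complex.conj_conj, map_mul, Complex.conj_ofReal] at h
  simpa using h

lemma integrable_kernel_mul {k : E d → E d → ℂ} (hk : Continuous fun p : E d × E d => k p.1 p.2)
    {g : E d → ℂ} (hg : Continuous g) (hgs : HasCompactSupport g) {K : E d → ℝ} (hK : Continuous K)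
    (hint : ∀ x, Integrable fun y => k y x) (hnorm : ∀ x, ∫ y, ‖k y x‖ = K x) :
    Integrable (fun p : E d × E d => k p.1 p.2 * g p.2)
      ((volume : Measure (E d)).prod volume) := by
  have hc : Continuous fun p : E d × E d => k p.1 p.2 * g p.2 := by fun_prop
  refine (integrable_prod_iff' hc.aestronglyMeasurable).2
    ⟨Eventually.of_forall fun x => (hint x).mul_const (g x), ?_⟩
  simp_rw [norm_mul, integral_mul_const, hnorm]
  exact Continuous.integrable_of_hasCompactSupport (by fun_prop) hgs.norm.mul_left

lemma integral_kernel_mul {k : E d → E d → ℂ} {g : E d → ℂ}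
    (h : Integrable (fun p : E d × E d => k p.1 p.2 * g p.2)
      ((volume : Measure (E d)).prod volume)) :
    Integrable (fun y => ∫ x, k y x * g x) ∧
      ∫ y, ∫ x, k y x * g x = ∫ x, (∫ y, k y x) * g x := by
  refine ⟨h.integral_prod_left, ?_⟩
  rw [integral_integral_swap (f := fun y x => k y x * g x) h]
  simp_rw [integral_mul_const]

variable (n) in
/-- The Mehler kernel times the conjugate of a Gaussian initial value. -/
def dualKernel (t : ℝ) (β y x : E d) : ℂ :=
  (mehler b n l t x y : ℂ) * starRingEnd ℂ (gaussSol b n l (fun j => inner ℝ (b j) β) 0 y)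

variable (n) in
lemma continuous_dualKernel (t : ℝ) (β : E d) :
    Continuous fun p : E d × E d => dualKernel b n l t β p.1 p.2 := by
  have h1 : Continuous fun p : E d × E d => mehler b n l t p.2 p.1 :=
    continuous_mehler b n l t continuous_snd continuous_fst
  have h2 : Continuous (gaussSol b n l (fun j => inner ℝ (b j) β) 0) :=
    (contDiff_gaussSol b n l _ _).continuous
  exact (Complex.continuous_ofReal.comp h1).mul
    (Complex.continuous_conj.comp (h2.comp continuous_fst))

variable (n) in
lemma dualKernel_eq_conj (t : ℝ) (β y x : E d) : dualKernel b n l t β y x = starRingEnd ℂ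
    ((mehler b n l t x y : ℂ) * gaussSol b n l (fun j => inner ℝ (b j) β) 0 y) := by
  rw [dualKernel, map_mul, Complex.conj_ofReal]

lemma integrable_dualKernel (hn : ∀ j, 0 ≤ n j) {t : ℝ} (ht : 0 < t) (β x : E d) :
    Integrable fun y => dualKernel b n l t β y x := by
  simp_rw [dualKernel_eq_conj]
  exact (LinearIsometryEquiv.integrable_comp_iff Complex.conjLIE).2
    (integrable_mehler_mul_gaussSol b l hn _ ht x)

lemma integral_dualKernel (hn : ∀ j, 0 ≤ n j) {t : ℝ} (ht : 0 < t) (β x : E d) :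
    ∫ y, dualKernel b n l t β y x
      = starRingEnd ℂ (gaussSol b n l (fun j => inner ℝ (b j) β) t x) := by
  simp_rw [dualKernel_eq_conj]
  rw [integral_conj, integral_mehler_mul_gaussSol b l hn _ ht x]

-- The character has modulus one, so up to a constant the norm is the kernel for `β = 0`. Its
-- integral is an explicit continuous function of `x`, which justifies Fubini.
variable (n) in
lemma norm_dualKernel (t : ℝ) (β y x : E d) : ‖dualKernel b n l t β y x‖
    = Real.exp (‖β‖ ^ 2 / 2) * ((mehler b n l t x y : ℂ) * gaussSol b n l (fun _ => 0) 0 y).re := by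
  have h1 : ‖Complex.exp (-Complex.I * (inner ℝ β y : ℝ))‖ = 1 := by
    rw [Complex.norm_exp]; simp
  rw [dualKernel, conj_gaussSol_zero, gaussSol_zero_zero, ← Complex.ofReal_mul, norm_mul, norm_mul,
    h1, Complex.norm_real, Complex.norm_real, Real.norm_of_nonneg (mehler_nonneg b n l t x y),
    Real.norm_of_nonneg (by positivity), Complex.ofReal_re]
  ring

lemma integral_norm_dualKernel (hn : ∀ j, 0 ≤ n j) {t : ℝ} (ht : 0 < t) (β x : E d) :
    ∫ y, ‖dualKernel b n l t β y x‖
      = Real.exp (‖β‖ ^ 2 / 2) * (gaussSol b n l (fun _ => 0) t x).re := by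
  simp_rw [norm_dualKernel]
  rw [integral_const_mul, ← integral_mehler_mul_gaussSol b l hn (fun _ => 0) ht x]
  congr 1
  exact integral_re (𝕜 := ℂ) (integrable_mehler_mul_gaussSol b l hn (fun _ => 0) ht x)

lemma integrable_mehler_prod (hn : ∀ j, 0 ≤ n j) {t : ℝ} (ht : 0 < t) {g : E d → ℂ}
    (hg : Continuous g) (hgs : HasCompactSupport g) (β : E d) :
    Integrable (fun p : E d × E d => dualKernel b n l t β p.1 p.2 * g p.2)
      ((volume : Measure (E d)).prod volume) := by
  have hu : Continuous (gaussSol b n l (fun _ => 0) t) :=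
    (contDiff_gaussSol b n l _ _).continuous
  exact integrable_kernel_mul (continuous_dualKernel b n l t β) hg hgs
    (continuous_const.mul (Complex.continuous_re.comp hu)) (integrable_dualKernel b l hn ht β)
    (integral_norm_dualKernel b l hn ht β)

/-- The integral operator of the Mehler kernel. -/
def mehlerOp (n : Fin d → ℝ) (t : ℝ) (f : E d → ℂ) (y : E d) : ℂ :=
  ∫ x, (mehler b n l t y x : ℂ) * f x

lemma integrable_mehler_mul (t : ℝ) {f : E d → ℂ} (hf : Continuous f) (hfs : HasCompactSupport f)
    (y : E d) : Integrable fun x => (mehler b n l t y x : ℂ) * f x := by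
  have hm : Continuous fun x => mehler b n l t y x :=
    continuous_mehler b n l t continuous_const continuous_id
  exact ((Complex.continuous_ofReal.comp hm).mul hf).integrable_of_hasCompactSupport hfs.mul_left

/-- Fubini and detailed balance move the kernel from `f` to the Gaussian, where its action is known.
-/
lemma mehlerOp_dual (hn : ∀ j, 0 ≤ n j) {t : ℝ} (ht : 0 < t) {f : E d → ℂ}
    (hf : Continuous f) (hfs : HasCompactSupport f) (β : E d) :
    Integrable (fun y => (Real.exp (-diagPotential b n l y) : ℂ) * (mehlerOp b l n t f y
      * starRingEnd ℂ (gaussSol b n l (fun j => inner ℝ (b j) β) 0 y))) ∧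
    ∫ y, (Real.exp (-diagPotential b n l y) : ℂ) * (mehlerOp b l n t f y
        * starRingEnd ℂ (gaussSol b n l (fun j => inner ℝ (b j) β) 0 y))
      = ∫ x, (Real.exp (-diagPotential b n l x) : ℂ) * (f x
        * starRingEnd ℂ (gaussSol b n l (fun j => inner ℝ (b j) β) t x)) := by
  have hφ := (contDiff_diagPotential b n l).continuous
  have hg : Continuous fun x => f x * (Real.exp (-diagPotential b n l x) : ℂ) := by fun_prop
  have hint := integrable_mehler_prod b l hn ht hg hfs.mul_right β
  have e (y : E d) : (Real.exp (-diagPotential b n l y) : ℂ) * (mehlerOp b l n t f y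
      * starRingEnd ℂ (gaussSol b n l (fun j => inner ℝ (b j) β) 0 y))
      = ∫ x, dualKernel b n l t β y x * (f x * (Real.exp (-diagPotential b n l x) : ℂ)) := by
    rw [mehlerOp, ← integral_mul_const, ← integral_const_mul]
    refine integral_congr_ae (Eventually.of_forall fun x => ?_)
    have hs : (mehler b n l t y x : ℂ) * (Real.exp (-diagPotential b n l y) : ℂ)
        = (mehler b n l t x y : ℂ) * (Real.exp (-diagPotential b n l x) : ℂ) := by
      exact_mod_cast mehler_symm b l hn ht y x
    simp only [dualKernel]
    linear_combination (f x * starRingEnd ℂ (gaussSol b n l (fun j => inner ℝ (b j) β) 0 y)) * hs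
  obtain ⟨h1, h2⟩ := integral_kernel_mul (k := dualKernel b n l t β)
    (g := fun x => f x * (Real.exp (-diagPotential b n l x) : ℂ)) hint
  simp_rw [e]
  refine ⟨h1, h2.trans ?_⟩
  refine integral_congr_ae (Eventually.of_forall fun x => ?_)
  simp only [integral_dualKernel b l hn ht]
  ring

/-- By uniqueness the semigroup consists of real functions of the self-adjoint resolvent. -/
lemma IsOUSemigroup.isSymmetric {φ : E d → ℝ} (hφ : ContDiff ℝ ∞ φ)
    {S : ℝ≥0 → L2 φ →L[ℂ] L2 φ} (hS : IsOUSemigroup φ S) (t : ℝ≥0) (u v : L2 φ) :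
    inner ℂ u (S t v) = inner ℂ (S t u) v := by
  have hJ := isResolvent_ouResolvent hφ
  have h1 : S = resolventSemigroup (ouResolvent hφ) :=
    (existsUnique_isOUSemigroup hφ).unique hS
      ((isOUSemigroup_iff hφ _).2 ⟨hJ.isC0Semigroup, hJ.generator_iff⟩)
  have h2 : IsSelfAdjoint (resolventSemigroup (ouResolvent hφ) t) := by
    unfold resolventSemigroup
    split_ifs
    · exact IsSelfAdjoint.one _
    · exact cfc_predicate _ _
  rw [h1]
  exact (h2.isSymmetric u v).symm

/-- The Ornstein-Uhlenbeck semigroup is given by the Mehler kernel on the core. -/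
theorem semigroup_apply_core (hn : ∀ j, 0 ≤ n j)
    {S : ℝ≥0 → L2 (diagPotential b n l) →L[ℂ] L2 (diagPotential b n l)}
    (hS : IsOUSemigroup (diagPotential b n l) S) {t : ℝ≥0} (ht : 0 < t) {f : E d → ℂ}
    (hf : f ∈ core (diagPotential b n l)) :
    LocallyIntegrable (mehlerOp b l n t f) ∧
    ∃ hf2 : MemLp f 2 (mu (diagPotential b n l)),
      (S t hf2.toLp : E d → ℂ) =ᵐ[volume] mehlerOp b l n t f := by
  have hφ := contDiff_diagPotential b n l
  obtain ⟨hf1, hfs⟩ := (mem_core_iff hφ).1 hf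
  have hf2 := memLp_of_continuous_of_hasCompactSupport hφ.continuous hf1.continuous hfs
  -- The density of `μ` times the Gaussian common to all the data. Multiplied by this weight, both
  -- images of `f` become integrable, and `w` is continuous without zeros, so nothing is lost.
  set w : E d → ℂ := fun y =>
    ((Real.exp (-diagPotential b n l y) * Real.exp (-(‖y‖ ^ 2 / 2)) : ℝ) : ℂ) with hw
  have hw0 (y : E d) : w y ≠ 0 := by
    have : Real.exp (-diagPotential b n l y) * Real.exp (-(‖y‖ ^ 2 / 2)) ≠ 0 := by positivity
    simpa only [hw, ne_eq, Complex.ofReal_eq_zero] using this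
  have hwc : Continuous w := by have := hφ.continuous; fun_prop
  have hconj (F : E d → ℂ) (β y : E d) : (Real.exp (-diagPotential b n l y) : ℂ) * (F y
      * starRingEnd ℂ (gaussSol b n l (fun j => inner ℝ (b j) β) 0 y))
      = (Real.exp (‖β‖ ^ 2 / 2) : ℝ) * (F y * w y
        * Complex.exp (-Complex.I * (inner ℝ β y : ℝ))) := by
    rw [conj_gaussSol_zero, hw]
    push_cast
    ring
  have hKint : Integrable fun y => mehlerOp b l n t f y * w y := by
    have := (mehlerOp_dual b l hn (NNReal.coe_pos.2 ht) hf1.continuous hfs 0).1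
    simp_rw [hconj] at this
    simpa using this
  have hSint : Integrable fun y => (S t hf2.toLp : E d → ℂ) y * w y := by
    obtain ⟨h0, -, -⟩ := semigroup_gaussSol b l hn (fun j => inner ℝ (b j) 0) hS t
    have := (integrable_mu hφ.continuous).1 (L2.integrable_inner (𝕜 := ℂ) h0.toLp (S t hf2.toLp))
    refine this.congr ?_
    have hae := h0.coeFn_toLp
    rw [Filter.EventuallyEq, ae_mu hφ.continuous] at hae
    filter_upwards [hae] with y hy
    have := hconj (S t hf2.toLp) 0 y
    rw [hy, RCLike.inner_apply, Complex.real_smul, this]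
    simp
  refine ⟨?_, hf2, ?_⟩
  · have h1 := hKint.locallyIntegrable.smul_continuous (g := fun y => (w y)⁻¹)
      (hwc.inv₀ hw0)
    refine h1.congr (Eventually.of_forall fun y => ?_)
    simp only [smul_eq_mul]
    rw [mul_assoc, mul_inv_cancel₀ (hw0 y), mul_one]
  · have key := ae_eq_zero_of_integral_char (hSint.sub hKint) fun β => ?_
    · filter_upwards [key] with y hy
      have h1 : ((S t hf2.toLp : E d → ℂ) y - mehlerOp b l n t f y) * w y = 0 := by
        rw [sub_mul]; exact hy
      exact sub_eq_zero.1 ((mul_eq_zero.1 h1).resolve_right (hw0 y))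
    · obtain ⟨h0, hT, hST⟩ := semigroup_gaussSol b l hn (fun j => inner ℝ (b j) β) hS t
      have h1 := hS.isSymmetric hφ t h0.toLp hf2.toLp
      rw [hST, L2.inner_def, L2.inner_def, integral_mu hφ.continuous, integral_mu hφ.continuous]
        at h1
      have h2 := (mehlerOp_dual b l hn (NNReal.coe_pos.2 ht) hf1.continuous hfs β).2
      have hae0 := h0.coeFn_toLp
      have haeT := hT.coeFn_toLp
      have haef := hf2.coeFn_toLp
      rw [Filter.EventuallyEq, ae_mu hφ.continuous] at hae0 haeT haef
      -- With `G_β` the Gaussian datum and `K` the kernel operator: `⟨G_β, S f⟩ = ⟨S G_β, f⟩ = ⟨K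
      -- G_β, f⟩ = ⟨G_β, K f⟩`.
      have h3 : ∫ y, (Real.exp (-diagPotential b n l y) : ℂ) * ((S t hf2.toLp : E d → ℂ) y
          * starRingEnd ℂ (gaussSol b n l (fun j => inner ℝ (b j) β) 0 y))
          = ∫ y, (Real.exp (-diagPotential b n l y) : ℂ) * (mehlerOp b l n t f y
          * starRingEnd ℂ (gaussSol b n l (fun j => inner ℝ (b j) β) 0 y)) := by
        rw [h2]
        refine Eq.trans ?_ (h1.trans ?_)
        · refine integral_congr_ae ?_
          filter_upwards [hae0] with y hy
          rw [hy, RCLike.inner_apply, Complex.real_smul]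
        · refine integral_congr_ae ?_
          filter_upwards [haeT, haef] with y hy hy'
          rw [hy, hy', RCLike.inner_apply, Complex.real_smul]
      simp_rw [hconj] at h3
      rw [integral_const_mul, integral_const_mul] at h3
      have h4 := mul_left_cancel₀ (by
        have : Real.exp (‖β‖ ^ 2 / 2) ≠ 0 := (Real.exp_pos _).ne'
        exact_mod_cast this) h3
      have hchar (F : E d → ℂ) (hF : Integrable F) :
          Integrable fun y => F y * Complex.exp (-Complex.I * (inner ℝ β y : ℝ)) := by
        refine hF.mul_bdd (c := 1) ?_ (Eventually.of_forall fun y => ?_)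
        · have : Continuous fun y : E d => Complex.exp (-Complex.I * (inner ℝ β y : ℝ)) := by
            fun_prop
          exact this.aestronglyMeasurable
        · rw [Complex.norm_exp]; simp
      simp_rw [Pi.sub_apply, sub_mul]
      rw [integral_sub (hchar _ hSint) (hchar _ hKint), h4, sub_self]

end Core

/-! ### Quadratic potentials and Gaussian symbols in the eigenbasis -/

section Eigenbasis

variable {d : ℕ} {N : Matrix (Fin d) (Fin d) ℝ}

lemma cfc_eq_conj_diagonal (hN : N.IsHermitian) (f : ℝ → ℝ) :
    cfc f N = (hN.eigenvectorUnitary : Matrix (Fin d) (Fin d) ℝ)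
      * Matrix.diagonal (f ∘ hN.eigenvalues)
      * star (hN.eigenvectorUnitary : Matrix (Fin d) (Fin d) ℝ) := by
  rw [hN.cfc_eq, Matrix.IsHermitian.cfc, Unitary.conjStarAlgAut_apply]
  rfl

lemma act_cfc_eigenvector (hN : N.IsHermitian) (f : ℝ → ℝ) (j : Fin d) :
    act (cfc f N) (hN.eigenvectorBasis j) = f (hN.eigenvalues j) • hN.eigenvectorBasis j := by
  have h : (cfc f N).mulVec (hN.eigenvectorBasis j).ofLp
      = f (hN.eigenvalues j) • (hN.eigenvectorBasis j).ofLp := by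
    rw [cfc_eq_conj_diagonal hN, ← Matrix.mulVec_mulVec, ← Matrix.mulVec_mulVec,
      hN.star_eigenvectorUnitary_mulVec]
    have h1 : (Matrix.diagonal (f ∘ hN.eigenvalues)).mulVec (Pi.single j 1)
        = f (hN.eigenvalues j) • Pi.single j (1 : ℝ) := by
      ext i
      rw [Matrix.mulVec_diagonal]
      rcases eq_or_ne i j with rfl | hij
      · simp
      · simp [hij]
    rw [h1, Matrix.mulVec_smul, hN.eigenvectorUnitary_mulVec]
  exact congrArg (WithLp.toLp 2) h

lemma act_eigenvector (hN : N.IsHermitian) (j : Fin d) :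
    act N (hN.eigenvectorBasis j) = hN.eigenvalues j • hN.eigenvectorBasis j :=
  congrArg (WithLp.toLp 2) (hN.mulVec_eigenvectorBasis j)

lemma inner_apply_of_eigenbasis (b : OrthonormalBasis (Fin d) ℝ (E d)) {T : E d →ₗ[ℝ] E d}
    {a : Fin d → ℝ} (h : ∀ j, T (b j) = a j • b j) (x : E d) (j : Fin d) :
    inner ℝ (b j) (T x) = a j * inner ℝ (b j) x := by
  conv_lhs => rw [← b.sum_repr' x, map_sum, inner_sum]
  simp [h, inner_smul_right, b.inner_eq_ite, mul_comm]

lemma inner_self_apply_of_eigenbasis (b : OrthonormalBasis (Fin d) ℝ (E d)) {T : E d →ₗ[ℝ] E d}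
    {a : Fin d → ℝ} (h : ∀ j, T (b j) = a j • b j) (x : E d) :
    inner ℝ x (T x) = ∑ j, a j * inner ℝ (b j) x ^ 2 := by
  rw [← b.sum_inner_mul_inner x (T x)]
  refine Finset.sum_congr rfl fun j _ => ?_
  rw [inner_apply_of_eigenbasis b h, real_inner_comm]
  ring

lemma quadPotential_eq (hN : N.IsHermitian) (l : E d) : quadPotential N l
    = diagPotential hN.eigenvectorBasis hN.eigenvalues
      fun j => inner ℝ (hN.eigenvectorBasis j) l := by
  ext x
  rw [quadPotential, diagPotential, Finset.sum_add_distrib,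
    inner_self_apply_of_eigenbasis hN.eigenvectorBasis (act_eigenvector hN),
    ← hN.eigenvectorBasis.sum_inner_mul_inner l x]
  simp only [real_inner_comm]

lemma det_cfc (hN : N.IsHermitian) (f : ℝ → ℝ) : (cfc f N).det = ∏ j, f (hN.eigenvalues j) := by
  rw [cfc_eq_conj_diagonal hN, Matrix.det_mul, Matrix.det_mul, mul_right_comm, ← Matrix.det_mul,
    Unitary.mul_star_self_of_mem hN.eigenvectorUnitary.2, Matrix.det_one, one_mul, Matrix.det_diagonal]
  rfl

/-- The `x`-dependent factor of the Gaussian symbol. -/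
def symbolAmp (b : OrthonormalBasis (Fin d) ℝ (E d)) (n l : Fin d → ℝ) (c t : ℝ) (x : E d) : ℝ :=
  ∏ j, (expDivCosh t (n j)
    * Real.exp (-(tanhDiv t (n j) * (c * (n j * inner ℝ (b j) x) + l j / 2) ^ 2)))

lemma gaussSymbol_eq (hN : N.IsHermitian) (l : E d) (c t : ℝ) (x ξ : E d) :
    gaussSymbol N l c t (x, ξ) = (symbolAmp hN.eigenvectorBasis hN.eigenvalues
      (fun j => inner ℝ (hN.eigenvectorBasis j) l) c t x : ℂ)
      * ∏ j, Complex.exp (-((tanhDiv t (hN.eigenvalues j) / c ^ 2 : ℝ) : ℂ)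
        * (inner ℝ (hN.eigenvectorBasis j) ξ : ℝ) ^ 2) := by
  set b := hN.eigenvectorBasis
  set n := hN.eigenvalues
  have hT := act_cfc_eigenvector hN (tanhDiv t)
  have h1 (j : Fin d) : inner ℝ (b j) (c • act N x + (1 / 2 : ℝ) • l)
      = c * (n j * inner ℝ (b j) x) + inner ℝ (b j) l / 2 := by
    rw [inner_add_right, inner_smul_right, inner_smul_right,
      inner_apply_of_eigenbasis b (act_eigenvector hN)]
    ring
  have h2 : ((cfc (fun n => Real.cosh (t * n)) N)⁻¹ * cfc (fun n => Real.exp (t * n)) N).det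
      = ∏ j, expDivCosh t (n j) := by
    rw [Matrix.det_mul, Matrix.det_nonsing_inv, Ring.inverse_eq_inv', det_cfc hN, det_cfc hN,
      ← Finset.prod_inv_distrib, ← Finset.prod_mul_distrib]
    rfl
  rw [gaussSymbol, h2, Nt, inner_self_apply_of_eigenbasis b hT, inner_self_apply_of_eigenbasis b hT,
    symbolAmp, Finset.prod_mul_distrib]
  simp only [h1]
  rw [← Complex.exp_sum, ← Real.exp_sum, Complex.ofReal_mul, Complex.ofReal_mul, mul_assoc]
  congr 1
  rw [Complex.ofReal_exp, Complex.ofReal_exp, ← Complex.exp_add]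
  congr 1
  push_cast
  rw [Finset.mul_sum, ← Finset.sum_sub_distrib, ← Finset.sum_add_distrib]
  refine Finset.sum_congr rfl fun j _ => ?_
  ring

end Eigenbasis

/-! ### The Fourier transform of the Gaussian symbol -/

section Fourier

variable {d : ℕ} (b : OrthonormalBasis (Fin d) ℝ (E d))

lemma integrable_prod_gaussian {α : Fin d → ℝ} (hα : ∀ j, 0 < α j) :
    Integrable fun ξ : E d => ∏ j, Complex.exp (-(α j : ℂ) * (inner ℝ (b j) ξ : ℝ) ^ 2) :=
  integrable_prod_coord b (f := fun j s => Complex.exp (-(α j : ℂ) * (s : ℂ) ^ 2)) fun j =>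
    integrable_cexp_neg_mul_sq (b := (α j : ℂ)) (by simpa using hα j)

lemma fourierU_prod_gaussian {α : Fin d → ℝ} (hα : ∀ j, 0 < α j) (k : E d) :
    fourierU (fun ξ : E d => ∏ j, Complex.exp (-(α j : ℂ) * (inner ℝ (b j) ξ : ℝ) ^ 2)) k
      = (((2 * Real.pi) ^ (-(d : ℝ) / 2) * ∏ j, (√(Real.pi / α j)
        * Real.exp (-inner ℝ (b j) k ^ 2 / (4 * α j))) : ℝ) : ℂ) := by
  rw [fourierU, Complex.ofReal_mul]
  congr 1
  have e (ξ : E d) : (∏ j, Complex.exp (-(α j : ℂ) * (inner ℝ (b j) ξ : ℝ) ^ 2))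
      * Complex.exp (-Complex.I * (inner ℝ ξ k : ℝ))
      = ∏ j, (Complex.exp (Complex.I * ((-inner ℝ (b j) k : ℝ) : ℂ) * (inner ℝ (b j) ξ : ℝ))
        * Complex.exp (-(α j : ℂ) * (inner ℝ (b j) ξ : ℝ) ^ 2)) := by
    rw [Finset.prod_mul_distrib, mul_comm, ← Complex.exp_sum (Finset.univ) fun j =>
      Complex.I * ((-inner ℝ (b j) k : ℝ) : ℂ) * (inner ℝ (b j) ξ : ℝ)]
    congr 2
    rw [← b.sum_inner_mul_inner ξ k]
    push_cast
    rw [Finset.mul_sum]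
    refine Finset.sum_congr rfl fun j _ => ?_
    rw [real_inner_comm ξ (b j)]
    ring
  simp_rw [e]
  rw [integral_prod_coord b (f := fun j s => Complex.exp (Complex.I
    * ((-inner ℝ (b j) k : ℝ) : ℂ) * (s : ℂ)) * Complex.exp (-(α j : ℂ) * (s : ℂ) ^ 2)),
    Complex.ofReal_prod]
  refine Finset.prod_congr rfl fun j _ => ?_
  rw [fourierIntegral_gaussian (by simpa using hα j), Complex.ofReal_mul, Real.sqrt_eq_rpow,
    Complex.ofReal_cpow (by have := hα j; positivity)]
  push_cast
  ring_nf

/-- The Fourier transform is symmetric for the bilinear pairing. -/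
lemma integral_mul_fourierU {f g : E d → ℂ} (hf : Integrable f) (hg : Integrable g) :
    ∫ ξ, f ξ * fourierU g ξ = ∫ k, fourierU f k * g k := by
  set C : ℂ := (((2 * Real.pi) ^ (-(d : ℝ) / 2) : ℝ) : ℂ)
  have hint : Integrable (fun p : E d × E d => Complex.exp (-Complex.I * ((inner ℝ p.1 p.2 : ℝ) : ℂ))
      * (f p.1 * g p.2)) ((volume : Measure (E d)).prod volume) := by
    refine (hf.mul_prod hg).bdd_mul (c := 1) ?_ (Eventually.of_forall fun p => ?_)
    · have : Continuous fun p : E d × E d =>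
          Complex.exp (-Complex.I * ((inner ℝ p.1 p.2 : ℝ) : ℂ)) := by fun_prop
      exact this.aestronglyMeasurable
    · rw [Complex.norm_exp]; simp
  have e1 (ξ : E d) : f ξ * fourierU g ξ = C * ∫ k, Complex.exp (-Complex.I *
      ((inner ℝ ξ k : ℝ) : ℂ)) * (f ξ * g k) := by
    rw [fourierU, mul_left_comm, ← integral_const_mul]
    congr 2
    ext k
    rw [real_inner_comm]
    ring
  have e2 (k : E d) : fourierU f k * g k = C * ∫ ξ, Complex.exp (-Complex.I *
      ((inner ℝ ξ k : ℝ) : ℂ)) * (f ξ * g k) := by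
    rw [fourierU, mul_assoc, ← integral_mul_const]
    congr 2
    ext ξ
    ring
  simp_rw [e1, e2]
  rw [integral_const_mul, integral_const_mul]
  congr 1
  exact integral_integral_swap (f := fun ξ k => Complex.exp (-Complex.I *
      ((inner ℝ ξ k : ℝ) : ℂ)) * (f ξ * g k)) hint

/-- Two functions which represent the same symbol have the same partial Fourier transform. -/
lemma Represents.F2_ae_eq {M : E d → E d} (hM : Measurable M) {a g : E d × E d → ℂ}
    (h : Represents M a g) (ha : ∀ x, Integrable fun ξ => a (x, ξ)) {A : E d → E d → ℂ}
    (hA : ∀ x k, fourierU (fun ξ => a (x, ξ)) k = A x k)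
    (hAm : Measurable fun p : E d × E d => A p.1 p.2) (hAi : ∀ x, Integrable (A x)) :
    ∀ᵐ p : E d × E d ∂volume, F2 M g p.1 p.2 = A p.1 p.2 := by
  obtain ⟨G, hG, hdom⟩ := h.dominated
  have hweight : Measurable fun p : E d × E d =>
      (((2 * Real.pi) ^ ((d : ℝ) / 2) * Real.exp (-|inner ℝ (M p.1) p.2|) : ℝ) : ℂ) := by
    have h1 : Measurable fun p : E d × E d => inner ℝ (M p.1) p.2 :=
      Measurable.inner (hM.comp measurable_fst) measurable_snd
    fun_prop
  have hF : AEStronglyMeasurable (fun p : E d × E d => F2 M g p.1 p.2) volume :=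
    hweight.aestronglyMeasurable.mul h.aestronglyMeasurable
  -- The function is only almost everywhere measurable. A measurable modification makes the
  -- exceptional set measurable, so that equality on almost every slice gives equality almost
  -- everywhere on the product.
  have hFae := hF.ae_eq_mk
  have h1 := Measure.ae_ae_of_ae_prod (μ := (volume : Measure (E d)))
    (ν := (volume : Measure (E d))) hFae
  have h2 := Measure.ae_ae_of_ae_prod (μ := (volume : Measure (E d)))
    (ν := (volume : Measure (E d))) hdom
  have h3 : ∀ᵐ x : E d, ∀ᵐ k : E d, hF.mk _ (x, k) = A x k := by
    filter_upwards [h1, h2, h.fourier] with x hx1 hx2 hx3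
    have hmeas : AEStronglyMeasurable (F2 M g x) volume := by
      have h4 : Measurable fun k => hF.mk _ (x, k) :=
        hF.stronglyMeasurable_mk.measurable.comp measurable_prodMk_left
      exact h4.aestronglyMeasurable.congr (hx1.mono fun k hk => hk.symm)
    have hint : Integrable (F2 M g x) := by
      refine (hG.const_mul ((2 * Real.pi) ^ ((d : ℝ) / 2))).mono' hmeas ?_
      filter_upwards [hx2] with k hk
      rw [F2, norm_mul, Complex.norm_real, Real.norm_of_nonneg (by positivity), mul_assoc]
      gcongr
      have h5 : Real.exp (-|inner ℝ (M x) k|) ≤ 1 :=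
        Real.exp_le_one_iff.2 (neg_nonpos.2 (abs_nonneg _))
      calc _ ≤ 1 * ‖g (x, k)‖ := by gcongr
        _ ≤ _ := by rw [one_mul]; exact hk.le
    have key := ae_eq_zero_of_integral_schwartz (hint.sub (hAi x)) fun ψ => ?_
    · filter_upwards [key, hx1] with k hk hk1
      rw [← hk1]
      exact sub_eq_zero.1 hk
    · obtain ⟨K, hK⟩ : ∃ K, ∀ k, ‖ψ k‖ ≤ K :=
        ⟨_, fun k => ψ.norm_le_seminorm ℝ k⟩
      have hm (F : E d → ℂ) (hF : Integrable F) : Integrable fun k => F k * ψ k :=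
        hF.mul_bdd (c := K) ψ.continuous.aestronglyMeasurable (Eventually.of_forall hK)
      simp_rw [Pi.sub_apply, sub_mul]
      rw [integral_sub (hm _ hint) (hm _ (hAi x)), ← hx3 ψ,
        integral_mul_fourierU (ha x) ψ.integrable]
      simp_rw [hA]
      exact sub_self _
  have h6 : ∀ᵐ p : E d × E d ∂((volume : Measure (E d)).prod volume),
      hF.mk _ p = A p.1 p.2 := by
    rw [Measure.ae_prod_iff_ae_ae]
    · exact h3
    · exact measurableSet_eq_fun hF.stronglyMeasurable_mk.measurable hAm
  have h7 : ∀ᵐ p : E d × E d ∂volume, hF.mk _ p = A p.1 p.2 := h6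
  filter_upwards [hFae, h7] with p hp1 hp2
  rw [← hp2]
  exact hp1

end Fourier

/-! ### The Weyl quantisation of the Gaussian symbol -/

section Weyl

variable {d : ℕ} (b : OrthonormalBasis (Fin d) ℝ (E d))

/-- The partial Fourier transform of the Gaussian symbol. -/
def symbolHat (n l : Fin d → ℝ) (c t : ℝ) (x k : E d) : ℝ :=
  symbolAmp b n l c t x * ((2 * Real.pi) ^ (-(d : ℝ) / 2) *
    ∏ j, (√(Real.pi / (tanhDiv t (n j) / c ^ 2))
      * Real.exp (-inner ℝ (b j) k ^ 2 / (4 * (tanhDiv t (n j) / c ^ 2)))))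

/-- Coordinatewise this is `mehlerKernel_eq`: the midpoint argument turns the amplitude into
`exp(-νa²)` and the difference argument gives `exp(-(x - y)²/(4ν))`. The powers of `c` cancel, and
the constants combine to `1/(2√(πν))`. -/
lemma weyl_symbolHat {n : Fin d → ℝ} (hn : ∀ j, 0 ≤ n j) (l : Fin d → ℝ) {c t : ℝ} (hc : 0 < c)
    (ht : 0 < t) (y x : E d) :
    (2 * Real.pi) ^ (-(d : ℝ) / 2) * (c ^ d)⁻¹
      * (symbolHat b n l c t ((2 * c)⁻¹ • (x + y)) (c⁻¹ • (x - y))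
        * Real.exp ((diagPotential b n l y - diagPotential b n l x) / 2))
      = mehler b n l t y x := by
  have hpi : (2 * Real.pi) ^ (-(d : ℝ) / 2) = ∏ _j : Fin d, (√(2 * Real.pi))⁻¹ := by
    rw [Finset.prod_const, Finset.card_univ, Fintype.card_fin, Real.sqrt_eq_rpow,
      ← Real.rpow_neg (by positivity), ← Real.rpow_natCast, ← Real.rpow_mul (by positivity)]
    congr 1
    ring
  have hcd : (c ^ d)⁻¹ = ∏ _j : Fin d, c⁻¹ := by
    rw [Finset.prod_const, Finset.card_univ, Fintype.card_fin, inv_pow]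
  have hexp : Real.exp ((diagPotential b n l y - diagPotential b n l x) / 2)
      = ∏ j, Real.exp (((n j * inner ℝ (b j) y ^ 2 + l j * inner ℝ (b j) y)
        - (n j * inner ℝ (b j) x ^ 2 + l j * inner ℝ (b j) x)) / 2) := by
    rw [← Real.exp_sum, diagPotential, diagPotential, ← Finset.sum_sub_distrib, Finset.sum_div]
  rw [symbolHat, symbolAmp, hexp, hpi, hcd, mehler]
  simp only [← Finset.prod_mul_distrib]
  refine Finset.prod_congr rfl fun j _ => ?_
  have hν := tanhDiv_pos (hn j) ht
  rw [mehlerKernel_eq (hn j) ht, Real.exp_add, Real.exp_sub]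
  simp only [inner_smul_right, inner_add_right, inner_sub_right]
  generalize inner ℝ (b j) x = x'
  generalize inner ℝ (b j) y = y'
  have e1 : c * (n j * ((2 * c)⁻¹ * (x' + y'))) + l j / 2 = n j * (x' + y') / 2 + l j / 2 := by
    field_simp
  have e2 : -(c⁻¹ * (x' - y')) ^ 2 / (4 * (tanhDiv t (n j) / c ^ 2))
      = -((x' - y') ^ 2 / (4 * tanhDiv t (n j))) := by
    field_simp
  have e3 : √(Real.pi / (tanhDiv t (n j) / c ^ 2)) = c * (√Real.pi / √(tanhDiv t (n j))) := by
    rw [div_div_eq_mul_div, mul_comm, mul_div_assoc, Real.sqrt_mul (by positivity),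
      Real.sqrt_sq hc.le, Real.sqrt_div Real.pi_pos.le]
  have e4 : √(2 * Real.pi * (2 * tanhDiv t (n j))) = 2 * (√Real.pi * √(tanhDiv t (n j))) := by
    rw [show 2 * Real.pi * (2 * tanhDiv t (n j)) = 2 ^ 2 * (Real.pi * tanhDiv t (n j)) by ring,
      Real.sqrt_mul (by positivity), Real.sqrt_sq (by norm_num), Real.sqrt_mul Real.pi_pos.le]
  have e5 : √(2 * Real.pi) ^ 2 = 2 * Real.pi := Real.sq_sqrt (by positivity)
  have e6 : √Real.pi ^ 2 = Real.pi := Real.sq_sqrt Real.pi_pos.le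
  have h1 : √(tanhDiv t (n j)) ≠ 0 := by positivity
  have h2 : √Real.pi ≠ 0 := by positivity
  have h3 : √(2 * Real.pi) ≠ 0 := by positivity
  rw [e1, e2, e3, e4, Real.exp_neg ((x' - y') ^ 2 / (4 * tanhDiv t (n j)))]
  field_simp
  rw [e5, e6]
  ring

lemma continuous_symbolHat (n l : Fin d → ℝ) (c t : ℝ) :
    Continuous fun p : E d × E d => symbolHat b n l c t p.1 p.2 := by
  unfold symbolHat symbolAmp
  fun_prop

lemma symbolAmp_nonneg (n l : Fin d → ℝ) (c t : ℝ) (x : E d) : 0 ≤ symbolAmp b n l c t x :=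
  Finset.prod_nonneg fun j _ => mul_nonneg (expDivCosh_pos t (n j)).le (Real.exp_pos _).le

lemma symbolAmp_le {n : Fin d → ℝ} (hn : ∀ j, 0 ≤ n j) (l : Fin d → ℝ) (c : ℝ) {t : ℝ} (ht : 0 < t)
    (x : E d) : symbolAmp b n l c t x ≤ ∏ j, expDivCosh t (n j) := by
  refine Finset.prod_le_prod
    (fun j _ => mul_nonneg (expDivCosh_pos t (n j)).le (Real.exp_pos _).le) fun j _ => ?_
  refine mul_le_of_le_one_right (expDivCosh_pos t (n j)).le (Real.exp_le_one_iff.2 ?_)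
  have := tanhDiv_pos (hn j) ht
  exact neg_nonpos.2 (by positivity)

lemma integrable_hat_factor {α : Fin d → ℝ} (hα : ∀ j, 0 < α j) : Integrable fun k : E d =>
    (2 * Real.pi) ^ (-(d : ℝ) / 2) *
      ∏ j, (√(Real.pi / α j) * Real.exp (-inner ℝ (b j) k ^ 2 / (4 * α j))) := by
  refine Integrable.const_mul ?_ _
  have h := integrable_prod_coord b (f := fun j s =>
    (√(Real.pi / α j) : ℂ) * Complex.exp (-((1 / (4 * α j) : ℝ) : ℂ) * (s : ℂ) ^ 2)) fun j =>
    (integrable_cexp_neg_mul_sq (b := ((1 / (4 * α j) : ℝ) : ℂ))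
      (by rw [Complex.ofReal_re]; have := hα j; positivity)).const_mul _
  refine h.re.congr (Eventually.of_forall fun k => ?_)
  have e (j : Fin d) : (√(Real.pi / α j) : ℂ)
      * Complex.exp (-((1 / (4 * α j) : ℝ) : ℂ) * ((inner ℝ (b j) k : ℝ) : ℂ) ^ 2)
      = ((√(Real.pi / α j) * Real.exp (-inner ℝ (b j) k ^ 2 / (4 * α j)) : ℝ) : ℂ) := by
    push_cast
    congr 2
    ring
  simp only [e, ← Complex.ofReal_prod]
  exact Complex.ofReal_re _

end Weyl

/-! ### The Gaussian symbol: membership in the class and its Weyl kernel. -/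

section Symbol

variable {d : ℕ} {N : Matrix (Fin d) (Fin d) ℝ}

lemma tanhDiv_div_pos (hN : N.PosSemidef) {c t : ℝ} (hc : 0 < c) (ht : 0 < t) (j : Fin d) :
    0 < tanhDiv t (hN.isHermitian.eigenvalues j) / c ^ 2 :=
  div_pos (tanhDiv_pos (hN.eigenvalues_nonneg j) ht) (by positivity)

lemma integrable_gaussSymbol (hN : N.PosSemidef) (l : E d) {c t : ℝ} (hc : 0 < c) (ht : 0 < t)
    (x : E d) : Integrable fun ξ => gaussSymbol N l c t (x, ξ) := by
  simp_rw [gaussSymbol_eq hN.isHermitian]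
  exact (integrable_prod_gaussian hN.isHermitian.eigenvectorBasis
    (tanhDiv_div_pos hN hc ht)).const_mul _

lemma fourierU_const_mul (C : ℂ) (f : E d → ℂ) (k : E d) :
    fourierU (fun ξ => C * f ξ) k = C * fourierU f k := by
  rw [fourierU, fourierU, mul_left_comm, ← integral_const_mul C]
  simp_rw [mul_assoc]

lemma fourierU_gaussSymbol (hN : N.PosSemidef) (l : E d) {c t : ℝ} (hc : 0 < c) (ht : 0 < t)
    (x k : E d) : fourierU (fun ξ => gaussSymbol N l c t (x, ξ)) k
      = (symbolHat hN.isHermitian.eigenvectorBasis hN.isHermitian.eigenvalues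
        (fun j => inner ℝ (hN.isHermitian.eigenvectorBasis j) l) c t x k : ℂ) := by
  simp_rw [gaussSymbol_eq hN.isHermitian]
  rw [fourierU_const_mul, fourierU_prod_gaussian _ (tanhDiv_div_pos hN hc ht), symbolHat,
    Complex.ofReal_mul (symbolAmp _ _ _ _ _ _)]

lemma integrable_symbolHat (hN : N.PosSemidef) (l : E d) {c t : ℝ} (hc : 0 < c) (ht : 0 < t)
    (x : E d) : Integrable fun k =>
      (symbolHat hN.isHermitian.eigenvectorBasis hN.isHermitian.eigenvalues
        (fun j => inner ℝ (hN.isHermitian.eigenvectorBasis j) l) c t x k : ℂ) :=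
  ((integrable_hat_factor hN.isHermitian.eigenvectorBasis
    (tanhDiv_div_pos hN hc ht)).const_mul _).ofReal

lemma Represents.F2_gaussSymbol (hN : N.PosSemidef) (l : E d) {c t : ℝ} (hc : 0 < c) (ht : 0 < t)
    {M : E d → E d} (hM : Measurable M) {g : E d × E d → ℂ}
    (h : Represents M (gaussSymbol N l c t) g) : ∀ᵐ p : E d × E d ∂volume, F2 M g p.1 p.2
      = (symbolHat hN.isHermitian.eigenvectorBasis hN.isHermitian.eigenvalues
        (fun j => inner ℝ (hN.isHermitian.eigenvectorBasis j) l) c t p.1 p.2 : ℂ) :=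
  h.F2_ae_eq hM (integrable_gaussSymbol hN l hc ht) (fourierU_gaussSymbol hN l hc ht)
    (Complex.measurable_ofReal.comp (continuous_symbolHat _ _ _ _ _).measurable)
    (integrable_symbolHat hN l hc ht)

lemma F2_zero (g : E d × E d → ℂ) (x k : E d) :
    F2 (fun _ => 0) g x k = (((2 * Real.pi) ^ ((d : ℝ) / 2) : ℝ) : ℂ) * g (x, k) := by
  simp [F2]

lemma memLp_gaussSymbol (hN : N.PosSemidef) (l : E d) {c t : ℝ} (hc : 0 < c) (ht : 0 < t) :
    MemLp (gaussSymbol N l c t) ∞ volume := by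
  set b := hN.isHermitian.eigenvectorBasis
  set n := hN.isHermitian.eigenvalues
  have e : gaussSymbol N l c t = fun p => (symbolAmp b n (fun j => inner ℝ (b j) l) c t p.1 : ℂ)
      * ∏ j, Complex.exp (-((tanhDiv t (n j) / c ^ 2 : ℝ) : ℂ) * (inner ℝ (b j) p.2 : ℝ) ^ 2) := by
    ext p
    exact gaussSymbol_eq hN.isHermitian l c t p.1 p.2
  rw [e]
  refine memLp_top_of_bound (C := ∏ j, expDivCosh t (n j)) ?_ (Eventually.of_forall fun p => ?_)
  · have : Continuous fun p : E d × E d => (symbolAmp b n (fun j => inner ℝ (b j) l) c t p.1 : ℂ)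
        * ∏ j, Complex.exp (-((tanhDiv t (n j) / c ^ 2 : ℝ) : ℂ)
          * (inner ℝ (b j) p.2 : ℝ) ^ 2) := by
      unfold symbolAmp
      fun_prop
    exact this.aestronglyMeasurable
  · rw [norm_mul, Complex.norm_real, Real.norm_of_nonneg (symbolAmp_nonneg _ _ _ _ _ _), norm_prod]
    have h1 := symbolAmp_le b hN.eigenvalues_nonneg (fun j => inner ℝ (b j) l) c ht p.1
    have h2 : ∏ j, ‖Complex.exp (-((tanhDiv t (n j) / c ^ 2 : ℝ) : ℂ)
        * (inner ℝ (b j) p.2 : ℝ) ^ 2)‖ ≤ 1 := by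
      refine Finset.prod_le_one (fun j _ => norm_nonneg _) fun j _ => ?_
      rw [← Complex.ofReal_neg, ← Complex.ofReal_pow, ← Complex.ofReal_mul, ← Complex.ofReal_exp,
        Complex.norm_real, Real.norm_of_nonneg (Real.exp_pos _).le]
      refine Real.exp_le_one_iff.2 ?_
      have := tanhDiv_div_pos hN hc ht j
      rw [neg_mul]
      exact neg_nonpos.2 (mul_nonneg this.le (sq_nonneg _))
    calc _ ≤ symbolAmp b n (fun j => inner ℝ (b j) l) c t p.1 * 1 :=
          mul_le_mul_of_nonneg_left h2 (symbolAmp_nonneg _ _ _ _ _ _)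
      _ ≤ _ := by rw [mul_one]; exact h1

/-- The Gaussian symbol is a holomorphic strip symbol. -/
theorem gaussSymbol_mem_HS0 (hN : N.PosSemidef) (l : E d) {c t : ℝ} (hc : 0 < c) (ht : 0 < t) :
    gaussSymbol N l c t ∈ HS0 (fun _ : E d => (0 : E d)) := by
  set b := hN.isHermitian.eigenvectorBasis
  set n := hN.isHermitian.eigenvalues
  set hat := symbolHat b n (fun j => inner ℝ (b j) l) c t
  set D := ∏ j, expDivCosh t (n j)
  have hD : 0 < D := Finset.prod_pos fun j _ => expDivCosh_pos t (n j)
  set P : ℝ := (2 * Real.pi) ^ ((d : ℝ) / 2)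
  have hP : 0 < P := by positivity
  have hP' : (P : ℂ) ≠ 0 := by exact_mod_cast hP.ne'
  set Γ : E d → ℝ := fun k => (2 * Real.pi) ^ (-(d : ℝ) / 2) *
    ∏ j, (√(Real.pi / (tanhDiv t (n j) / c ^ 2))
      * Real.exp (-inner ℝ (b j) k ^ 2 / (4 * (tanhDiv t (n j) / c ^ 2))))
  have hΓ0 (k : E d) : 0 < Γ k := by
    refine mul_pos (by positivity) (Finset.prod_pos fun j _ => ?_)
    have := tanhDiv_div_pos hN hc ht j
    positivity
  have hΓi : Integrable Γ := integrable_hat_factor b (tanhDiv_div_pos hN hc ht)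
  have hrep : Represents (fun _ : E d => (0 : E d)) (gaussSymbol N l c t)
      (fun p => (P : ℂ)⁻¹ * (hat p.1 p.2 : ℂ)) := by
    -- The amplitude is at most `D`; the domination is required to be strict, hence `D + 1`.
    refine ⟨?_, ⟨fun k => P⁻¹ * (D + 1) * Γ k, hΓi.const_mul _, Eventually.of_forall fun p => ?_⟩,
      Eventually.of_forall fun x ψ => ?_⟩
    · have hcont := continuous_symbolHat b n (fun j => inner ℝ (b j) l) c t
      have : Continuous fun p : E d × E d => (P : ℂ)⁻¹ * (hat p.1 p.2 : ℂ) :=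
        continuous_const.mul (Complex.continuous_ofReal.comp hcont)
      exact this.aestronglyMeasurable
    · have h1 := symbolAmp_le b hN.eigenvalues_nonneg (fun j => inner ℝ (b j) l) c ht p.1
      have h2 : hat p.1 p.2 = symbolAmp b n (fun j => inner ℝ (b j) l) c t p.1 * Γ p.2 := rfl
      have h3 := symbolAmp_nonneg b n (fun j => inner ℝ (b j) l) c t p.1
      have h4 := hΓ0 p.2
      beta_reduce
      rw [norm_mul, norm_inv, Complex.norm_real, Complex.norm_real, Real.norm_of_nonneg hP.le, h2,
        Real.norm_of_nonneg (mul_nonneg h3 h4.le), mul_assoc P⁻¹]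
      refine mul_lt_mul_of_pos_left ?_ (by positivity)
      exact mul_lt_mul_of_pos_right (by linarith) h4
    · rw [integral_mul_fourierU (integrable_gaussSymbol hN l hc ht x) ψ.integrable]
      refine integral_congr_ae (Eventually.of_forall fun k => ?_)
      simp only [fourierU_gaussSymbol hN l hc ht, F2_zero]
      rw [mul_inv_cancel_left₀ hP']
  refine ⟨memLp_gaussSymbol hN l hc ht, _, hrep, fun g' hg' => ?_⟩
  filter_upwards [hg'.F2_gaussSymbol hN l hc ht measurable_const] with p hp
  rw [F2_zero] at hp
  rw [← hp, inv_mul_cancel_left₀ hP']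

/-- The coordinate change `(y, x) ↦ ((x + y) / (2c), (x - y) / c)` preserves null sets. -/
lemma quasiMeasurePreserving_weyl {c : ℝ} (hc : 0 < c) : Measure.QuasiMeasurePreserving
    (fun p : E d × E d => ((2 * c)⁻¹ • (p.2 + p.1), c⁻¹ • (p.2 - p.1))) volume volume := by
  let T : (E d × E d) →ₗ[ℝ] (E d × E d) :=
    ((2 * c)⁻¹ • (LinearMap.snd ℝ (E d) (E d) + LinearMap.fst ℝ (E d) (E d))).prod
      (c⁻¹ • (LinearMap.snd ℝ (E d) (E d) - LinearMap.fst ℝ (E d) (E d)))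
  let T' : (E d × E d) →ₗ[ℝ] (E d × E d) :=
    (c • LinearMap.fst ℝ (E d) (E d) - (c / 2) • LinearMap.snd ℝ (E d) (E d)).prod
      (c • LinearMap.fst ℝ (E d) (E d) + (c / 2) • LinearMap.snd ℝ (E d) (E d))
  have hTT : T ∘ₗ T' = LinearMap.id := by
    refine LinearMap.ext fun p => Prod.ext ?_ ?_
    · change (2 * c)⁻¹ • ((c • p.1 + (c / 2) • p.2) + (c • p.1 - (c / 2) • p.2)) = p.1
      match_scalars <;> field_simp <;> norm_num
    · change c⁻¹ • ((c • p.1 + (c / 2) • p.2) - (c • p.1 - (c / 2) • p.2)) = p.2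
      match_scalars <;> field_simp <;> norm_num
  have hdet : LinearMap.det T ≠ 0 := by
    intro h0
    have h1 := congrArg LinearMap.det hTT
    rw [LinearMap.det_comp, h0, zero_mul, LinearMap.det_id] at h1
    exact zero_ne_one h1
  have : (volume : Measure (E d × E d)).IsAddHaarMeasure :=
    inferInstanceAs ((volume : Measure (E d)).prod volume).IsAddHaarMeasure
  exact Measure.LinearMap.quasiMeasurePreserving volume T hdet

/-- The partial Fourier transform is known off a null set of the product; its preimage under the
invertible change of variables is null, and so is almost every slice. -/
lemma Represents.weylKernel_ae_eq (hN : N.PosSemidef) (l : E d) {c t : ℝ} (hc : 0 < c) (ht : 0 < t)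
    {M : E d → E d} (hM : Measurable M) {g : E d × E d → ℂ}
    (h : Represents M (gaussSymbol N l c t) g) : ∀ᵐ y : E d, ∀ᵐ x : E d,
      (((2 * Real.pi) ^ (-(d : ℝ) / 2) * (c ^ d)⁻¹ : ℝ) : ℂ)
        * (F2 M g ((2 * c)⁻¹ • (x + y)) (c⁻¹ • (x - y))
        * (Real.exp ((quadPotential N l y - quadPotential N l x) / 2) : ℂ))
      = (mehler hN.isHermitian.eigenvectorBasis hN.isHermitian.eigenvalues
        (fun j => inner ℝ (hN.isHermitian.eigenvectorBasis j) l) t y x : ℂ) := by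
  have h1 := (quasiMeasurePreserving_weyl (d := d) hc).ae (h.F2_gaussSymbol hN l hc ht hM)
  have h2 := Measure.ae_ae_of_ae_prod (μ := (volume : Measure (E d)))
    (ν := (volume : Measure (E d))) h1
  filter_upwards [h2] with y hy
  filter_upwards [hy] with x hx
  rw [hx, quadPotential_eq hN.isHermitian, ← Complex.ofReal_mul, ← Complex.ofReal_mul,
    weyl_symbolHat _ hN.eigenvalues_nonneg _ hc ht]

end Symbol

end

end OUWeyl

/-! ### The main theorem. -/

open OUWeyl in
theorem mainTheorem4 {d : ℕ} (N : Matrix (Fin d) (Fin d) ℝ) (hN : N.PosSemidef)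
    (l : OUWeyl.E d) (c : ℝ) (hc : 0 < c) :
    (∃! S : ℝ≥0 → OUWeyl.L2 (OUWeyl.quadPotential N l) →L[ℂ] OUWeyl.L2 (OUWeyl.quadPotential N l),
      OUWeyl.IsOUSemigroup (OUWeyl.quadPotential N l) S) ∧
    ∀ S : ℝ≥0 → OUWeyl.L2 (OUWeyl.quadPotential N l) →L[ℂ] OUWeyl.L2 (OUWeyl.quadPotential N l),
      OUWeyl.IsOUSemigroup (OUWeyl.quadPotential N l) S →
      ∀ t : ℝ≥0, 0 < t →
        (∃ M : OUWeyl.E d → OUWeyl.E d, Measurable M ∧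
          OUWeyl.gaussSymbol N l c t ∈ OUWeyl.HS0 M) ∧
        ∀ M : OUWeyl.E d → OUWeyl.E d, Measurable M →
          ∀ g : OUWeyl.E d × OUWeyl.E d → ℂ,
            OUWeyl.Represents M (OUWeyl.gaussSymbol N l c t) g →
            ∀ f ∈ OUWeyl.core (OUWeyl.quadPotential N l),
              (∀ᵐ y : OUWeyl.E d ∂volume, Integrable
                (OUWeyl.weylIntegrand (OUWeyl.quadPotential N l) c (OUWeyl.F2 M g) f y) volume) ∧
              LocallyIntegrable
                (OUWeyl.weylOp (OUWeyl.quadPotential N l) c (OUWeyl.F2 M g) f) volume ∧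
              ∃ hf : MemLp f 2 (OUWeyl.mu (OUWeyl.quadPotential N l)),
                (S t (hf.toLp f) : OUWeyl.E d → ℂ) =ᵐ[volume]
                  OUWeyl.weylOp (OUWeyl.quadPotential N l) c (OUWeyl.F2 M g) f := by
  set b := hN.isHermitian.eigenvectorBasis
  set n := hN.isHermitian.eigenvalues
  have hφe : quadPotential N l = diagPotential b n fun j => inner ℝ (b j) l :=
    quadPotential_eq hN.isHermitian l
  have hφ : ContDiff ℝ ∞ (quadPotential N l) := hφe ▸ contDiff_diagPotential b n _
  refine ⟨existsUnique_isOUSemigroup hφ, fun S hS t ht => ?_⟩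
  have ht' : (0 : ℝ) < t := NNReal.coe_pos.2 ht
  refine ⟨⟨_, measurable_const, gaussSymbol_mem_HS0 hN l hc ht'⟩, fun M hM g hg f hf => ?_⟩
  obtain ⟨hf1, hfs⟩ := (mem_core_iff hφ).1 hf
  have hker := hg.weylKernel_ae_eq hN l hc ht' hM
  set C : ℂ := (((2 * Real.pi) ^ (-(d : ℝ) / 2) * (c ^ d)⁻¹ : ℝ) : ℂ) with hC
  have hC0 : C ≠ 0 := by
    have : (2 * Real.pi) ^ (-(d : ℝ) / 2) * (c ^ d)⁻¹ ≠ 0 := by positivity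
    rw [hC]
    exact_mod_cast this
  have hint := integrable_mehler_mul b (n := n) (fun j => inner ℝ (b j) l) t hf1.continuous hfs
  have hkf : ∀ᵐ y : E d, ∀ᵐ x : E d, C * weylIntegrand (quadPotential N l) c (F2 M g) f y x
      = (mehler b n (fun j => inner ℝ (b j) l) t y x : ℂ) * f x := by
    filter_upwards [hker] with y hy
    filter_upwards [hy] with x hx
    rw [weylIntegrand, ← mul_assoc, hx]
  have hop : weylOp (quadPotential N l) c (F2 M g) f
      =ᵐ[volume] mehlerOp b (fun j => inner ℝ (b j) l) n t f := by
    filter_upwards [hkf] with y hy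
    rw [weylOp, mehlerOp, ← integral_const_mul]
    exact integral_congr_ae hy
  -- The type of `S` depends on the potential, so the potential is generalised before it is replaced
  -- by its diagonal form.
  have hmain : ∀ (φ : E d → ℝ) (_ : φ = diagPotential b n fun j => inner ℝ (b j) l)
      (S : ℝ≥0 → L2 φ →L[ℂ] L2 φ), IsOUSemigroup φ S → f ∈ core φ →
      LocallyIntegrable (mehlerOp b (fun j => inner ℝ (b j) l) n t f) ∧
      ∃ hf2 : MemLp f 2 (mu φ),
        (S t hf2.toLp : E d → ℂ) =ᵐ[volume] mehlerOp b (fun j => inner ℝ (b j) l) n t f := by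
    rintro φ rfl S hS hf
    exact semigroup_apply_core b _ hN.eigenvalues_nonneg hS ht hf
  obtain ⟨h1, hf2, h2⟩ := hmain _ hφe S hS hf
  refine ⟨?_, h1.congr hop.symm, hf2, h2.trans hop.symm⟩
  filter_upwards [hkf] with y hy
  have h3 := ((hint y).congr (hy.mono fun x hx => hx.symm)).const_mul C⁻¹
  refine h3.congr (Eventually.of_forall fun x => ?_)
  simp only
  rw [inv_mul_cancel_left₀ hC0]
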